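/- Let $p$ be a prime and let $k=\overline{\mathbb F}_p$. For a ring $S$ let $\mathrm{Mod}(S)$ be the category of left $S$-modules. Call a module trivial if it has finite projective dimension, and let $\mathrm{Ho}(S)$ be the localization of $\mathrm{Mod}(S)$ at the smallest class of morphisms that is closed under composition and contains all epimorphisms with trivial kernel and all monomorphisms with trivial cokernel. If $S$ is a Gorenstein $k$-algebra, $\mathrm{Ho}(S)$ is triangulated as follows. The shift $\Sigma M$ is the cokernel of an injection of $M$ into a module of finite projective dimension; functorially, $\Sigma M=\mathrm{coker}(M\to \mathrm{Hom}_k(S,M))$. A short exact sequence $0\to M_1\to M_2\to M_3\to 0$ of modules induces a morphism $M_3\to\Sigma M_1$ in $\mathrm{Ho}(S)$, obtained by extending $M_1\to\mathrm{Hom}_k(S,M_1)$ to $M_2$ and passing to cokernels. The distinguished triangles are those isomorphic to a triangle $M_1\to M_2\to M_3\to\Sigma M_1$ obtained in this way. Let $\mathrm{Mod}(k^2)_{2,\mathrm{triv}}$ be the category $\mathrm{Mod}(k^2)=\mathrm{Mod}(k)\times\mathrm{Mod}(k)$ with shift $\Sigma(X_1,X_2)=(X_2,X_1)$, where the distinguished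 triangles are the sequences $X\xrightarrow{f}Y\xrightarrow{g}Z\xrightarrow{h}\Sigma X$ that are exact at $Y$ and $Z$ and satisfy $\mathrm{Im}(h)=\Sigma\,\mathrm{Ker}(f)$. Let $R$ be the $k$-algebra generated by $e_1,e_2,T$ with relations $e_1+e_2=1$, $e_ie_j=\delta_{ij}e_i$, $e_iT=Te_{3-i}$, $T^2=0$ $(i,j\in\{1,2\})$, and let $\chi_i$ $(i=1,2)$ be the one-dimensional left $R$-module given by the character $\chi_i(T)=0$, $\chi_i(e_j)=\delta_{ij}$. Let $A=k[X_1,X_2]/(X_1X_2)$. 1. $R$ is a $4$-dimensional $k$-algebra that is self-injective (on both sides). It is the regular component of the finite Hecke algebra in the following sense. Let $\mathbb F_q$ be a finite field of characteristic $p$, let $\mathbf G\in\{\mathrm{SL}_2,\mathrm{GL}_2,\mathrm{PGL}_2\}$ with diagonal torus $\mathbf T$, positive coroot $\alpha^\vee$ and nontrivial Weyl group element $s$. Let $\mathcal H_{\mathrm{aff}}$ be the $k$-algebra with generators $T_t$ $(t\in \mathbf T(\mathbb F_q))$, $T_{s_0},T_{s_1}$ and relations $T_1=1$, $T_tT_{t'}=T_{tt'}$,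 $T_{s_i}T_t=T_{s(t)}T_{s_i}$, $T_{s_i}^2=T_{s_i}\sum_{x\in\mathbb F_q^\times}T_{\alpha^\vee(x)}$, and let $\mathcal H_{x_0}$ be the subalgebra generated by all $T_t$ and $T_{s_0}$. Let $\xi:\mathbf T(\mathbb F_q)\to k^\times$ be a character with $\xi\ne\xi^s:=\xi\circ s$, let $\gamma=\{\xi,\xi^s\}$, $e_\xi=|\mathbf T(\mathbb F_q)|^{-1}\sum_t\xi(t^{-1})T_t$ and $e_\gamma=e_\xi+e_{\xi^s}$. Then there is an isomorphism of $k$-algebras $R\cong e_\gamma\mathcal H_{x_0}$ with $e_1\mapsto e_\xi$, $e_2\mapsto e_{\xi^s}$, $T\mapsto e_\gamma T_{s_0}$. 2. The functor $\mathrm{Mod}(k^2)_{2,\mathrm{triv}}\to\mathrm{Ho}(R)$, $(V_1,V_2)\mapsto(\chi_1\otimes_kV_1)\oplus(\chi_2\otimes_kV_2)$, is a triangle equivalence. 3. The functor $\mathrm{Mod}(k^2)_{2,\mathrm{triv}}\to\mathrm{Ho}(A)$, $(V_1,V_2)\mapsto(A/X_2A\otimes_kV_1)\oplus(A/X_1A\otimes_kV_2)$,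 is a triangle equivalence. -/

import Mathlib

open CategoryTheory CategoryTheory.Limits
open scoped TensorProduct

universe u v

noncomputable section

/-! ### Categories with a shift and distinguished triangles, triangle equivalences -/

/-- A shift functor together with a class of (distinguished) triangles `X ⟶ Y ⟶ Z ⟶ ΣX`. -/
structure TriangleData (C : Type*) [Category C] where
  shift : C ⥤ C
  distinguished : ∀ {X Y Z : C}, (X ⟶ Y) → (Y ⟶ Z) → (Z ⟶ shift.obj X) → Prop

/-- `F` is a triangle equivalence: it is an equivalence of categories which commutes with the
shifts up to a natural isomorphism `φ : F Σ ≅ Σ F`, in such a way that a triangle is distinguished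
if and only if its image (formed with `φ`) is distinguished. -/
def IsTriangleEquivalence {C D : Type*} [Category C] [Category D]
    (TC : TriangleData C) (TD : TriangleData D) (F : C ⥤ D) : Prop :=
  F.IsEquivalence ∧ ∃ φ : TC.shift ⋙ F ≅ F ⋙ TD.shift,
    ∀ {X Y Z : C} (f : X ⟶ Y) (g : Y ⟶ Z) (h : Z ⟶ TC.shift.obj X),
      TC.distinguished f g h ↔
        TD.distinguished (F.map f) (F.map g) (F.map h ≫ φ.hom.app X)

/-- The category `Mod(k²) = Mod(k) × Mod(k)` with its structure `Mod(k²)_{2,triv}`: the shift is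
`Σ(X₁, X₂) = (X₂, X₁)`, and `X ⟶ Y ⟶ Z ⟶ ΣX` (maps `f, g, h`) is distinguished when it is exact at
`Y` and at `Z` and `Im h = Σ (Ker f)`. -/
def modSqTriv (k : Type u) [Field k] :
    TriangleData (ModuleCat.{u} k × ModuleCat.{u} k) where
  shift := CategoryTheory.Prod.swap (ModuleCat.{u} k) (ModuleCat.{u} k)
  distinguished {X _ _} f g h :=
    -- exactness at `Y`
    (LinearMap.range f.1.hom = LinearMap.ker g.1.hom ∧
      LinearMap.range f.2.hom = LinearMap.ker g.2.hom) ∧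
    -- exactness at `Z`
    (LinearMap.range g.1.hom = LinearMap.ker h.1.hom ∧
      LinearMap.range g.2.hom = LinearMap.ker h.2.hom) ∧
    -- `Im h = Σ (Ker f)`; here `h.1 : Z.1 ⟶ X.2` and `h.2 : Z.2 ⟶ X.1`
    ((LinearMap.range h.1.hom : Submodule k X.2) = LinearMap.ker f.2.hom ∧
      (LinearMap.range h.2.hom : Submodule k X.1) = LinearMap.ker f.1.hom)

/-! ### The homotopy category of a (Gorenstein) ring -/

section Ho

variable (S : Type u) [Ring S]

/-- The trivial modules: those of finite projective dimension. -/
def IsTrivialModule (M : ModuleCat.{u} S) : Prop :=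
  ∃ n : ℕ, HasProjectiveDimensionLE M n

/-- Epimorphisms with trivial kernel and monomorphisms with trivial cokernel. -/
def basicWeakEquivalences : MorphismProperty (ModuleCat.{u} S) := fun _ _ f =>
  (Epi f ∧ IsTrivialModule S (kernel f)) ∨ (Mono f ∧ IsTrivialModule S (cokernel f))

/-- The weak equivalences: the smallest class of morphisms closed under composition and
containing all epimorphisms with trivial kernel and all monomorphisms with trivial cokernel. -/
def weakEquivalences : MorphismProperty (ModuleCat.{u} S) :=
  (basicWeakEquivalences S).multiplicativeClosure

/-- The homotopy category `Ho(S)`: the localization of `Mod(S)` at the weak equivalences. -/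
abbrev Ho := (weakEquivalences S).Localization

/-- The localization functor `Mod(S) ⥤ Ho(S)`. -/
abbrev toHo : ModuleCat.{u} S ⥤ Ho S := (weakEquivalences S).Q

end Ho

section Triangulated

variable (k : Type u) [Field k] (S : Type u) [Ring S] [Algebra k S]

/-- The functor `M ↦ Hom_k(S, M)`, where `(s • f)(t) = f(ts)`. The `S`-module `Hom_k(S, M)` is
injective, as `k` is a field; so it has finite projective dimension when `S` is Gorenstein. -/
abbrev coind : ModuleCat.{u} S ⥤ ModuleCat.{u} S :=
  ModuleCat.restrictScalars.{u} (algebraMap k S) ⋙ ModuleCat.coextendScalars.{u, u, u} (algebraMap k S)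

/-- The natural embedding `M ⟶ Hom_k(S, M)`, `m ↦ (s ↦ s • m)`. -/
abbrev toCoind : 𝟭 (ModuleCat.{u} S) ⟶ coind k S :=
  (ModuleCat.restrictCoextendScalarsAdj.{u, u, u} (algebraMap k S)).unit

/-- The functor `M ↦ coker (M ⟶ Hom_k(S, M))` on `Mod(S)`. -/
def cosyzygy : ModuleCat.{u} S ⥤ ModuleCat.{u} S where
  obj M := cokernel ((toCoind k S).app M)
  map {M N} f := cokernel.map ((toCoind k S).app M) ((toCoind k S).app N) f ((coind k S).map f)
    ((toCoind k S).naturality f).symm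
  map_id M := by
    rw [← cancel_epi (cokernel.π _), cokernel.π_desc]
    simp only [CategoryTheory.Functor.map_id, Category.id_comp, Category.comp_id]
  map_comp f g := by
    rw [← cancel_epi (cokernel.π _), cokernel.π_desc, cokernel.π_desc_assoc, Category.assoc,
      cokernel.π_desc, CategoryTheory.Functor.map_comp, Category.assoc]

/-- The functor `M ↦ coker (M ⟶ Hom_k(S, M))` respects weak equivalences, i.e. it becomes
well defined on `Ho(S)`. -/
def CosyzygyDescends : Prop :=
  (weakEquivalences S).IsInvertedBy (cosyzygy k S ⋙ toHo S)

variable {k S}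

/-- The shift functor of `Ho(S)`: the cokernel of an injection into a module of finite projective
dimension (namely `M ⟶ Hom_k(S, M)`). -/
def hoShift (hS : CosyzygyDescends k S) : Ho S ⥤ Ho S :=
  Localization.Construction.lift (cosyzygy k S ⋙ toHo S) hS

/-- In `Ho(S)` the shift of a module `M` is `coker (M ⟶ Hom_k(S, M))`. -/
def hoShiftIso (hS : CosyzygyDescends k S) :
    toHo S ⋙ hoShift hS ≅ cosyzygy k S ⋙ toHo S :=
  eqToIso (Localization.Construction.fac (cosyzygy k S ⋙ toHo S) hS)

/-- The triangulated structure of `Ho(S)`. Every short exact sequence `0 → M₁ → M₂ → M₃ → 0` of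
modules gives a morphism `M₃ ⟶ ΣM₁` in `Ho(S)`: take any commutative diagram
```
0 → M₁ →    M₂       →  M₃  → 0
    ‖       ↓ b         ↓ δ
0 → M₁ → Hom_k(S,M₁) → ΣM₁  → 0
```
and the image of `δ` in `Ho(S)`. The distinguished triangles are those isomorphic in `Ho(S)` to a
triangle `M₁ ⟶ M₂ ⟶ M₃ ⟶ ΣM₁` arising in this way. -/
def hoTriangles (hS : CosyzygyDescends k S) : TriangleData (Ho S) where
  shift := hoShift hS
  distinguished {X Y Z} f g h :=
    ∃ (E : ShortComplex (ModuleCat.{u} S)) (_ : E.ShortExact)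
      (b : E.X₂ ⟶ (coind k S).obj E.X₁) (δ : E.X₃ ⟶ (cosyzygy k S).obj E.X₁)
      (_ : E.f ≫ b = (toCoind k S).app E.X₁)
      (_ : E.g ≫ δ = b ≫ cokernel.π ((toCoind k S).app E.X₁))
      (x : X ≅ (toHo S).obj E.X₁) (y : Y ≅ (toHo S).obj E.X₂) (z : Z ≅ (toHo S).obj E.X₃),
      f ≫ y.hom = x.hom ≫ (toHo S).map E.f ∧
      g ≫ z.hom = y.hom ≫ (toHo S).map E.g ∧
      h ≫ (hoShift hS).map x.hom =
        z.hom ≫ (toHo S).map δ ≫ (hoShiftIso hS).inv.app E.X₁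

end Triangulated

/-! ### The functors `(V₁, V₂) ↦ (N₁ ⊗ V₁) ⊕ (N₂ ⊗ V₂)` -/

section TensorSum

variable (k : Type u) [Field k] (S : Type u) [Ring S] [Algebra k S]
  (N₁ N₂ : Type u) [AddCommGroup N₁] [AddCommGroup N₂]
  [Module k N₁] [Module S N₁] [IsScalarTower k S N₁]
  [Module k N₂] [Module S N₂] [IsScalarTower k S N₂]

/-- For two `S`-modules `N₁`, `N₂`, the functor
`Mod(k²) ⥤ Mod(S)`, `(V₁, V₂) ↦ (N₁ ⊗[k] V₁) ⊕ (N₂ ⊗[k] V₂)`. -/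
def tensorSum : ModuleCat.{u} k × ModuleCat.{u} k ⥤ ModuleCat.{u} S where
  obj V := ModuleCat.of S ((N₁ ⊗[k] V.1) × (N₂ ⊗[k] V.2))
  map f := ModuleCat.ofHom (LinearMap.prodMap
    (TensorProduct.AlgebraTensorModule.map (LinearMap.id : N₁ →ₗ[S] N₁) f.1.hom)
    (TensorProduct.AlgebraTensorModule.map (LinearMap.id : N₂ →ₗ[S] N₂) f.2.hom))
  map_id V := by
    simp only [prod_id_fst, prod_id_snd, ModuleCat.hom_id, TensorProduct.AlgebraTensorModule.map_id,
      LinearMap.prodMap_id]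
    rfl
  map_comp f g := by
    rw [← ModuleCat.ofHom_comp, LinearMap.prodMap_comp,
      ← TensorProduct.AlgebraTensorModule.map_comp, ← TensorProduct.AlgebraTensorModule.map_comp]

end TensorSum

/-! ### The algebra `R` and its characters -/

/-- The generators `e₁, e₂, T` of `R` (the index set `{1, 2}` is `Fin 2`). -/
inductive RGen : Type
  | e (i : Fin 2)
  | T

/-- The defining relations of `R`. For `i : Fin 2` the other index is `1 - i`. -/
inductive RRel (k : Type u) [Field k] : FreeAlgebra k RGen → FreeAlgebra k RGen → Prop
  | sum : RRel k (FreeAlgebra.ι k (.e 0) + FreeAlgebra.ι k (.e 1)) 1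
  | idem (i j : Fin 2) : RRel k (FreeAlgebra.ι k (.e i) * FreeAlgebra.ι k (.e j))
      (if i = j then FreeAlgebra.ι k (.e i) else 0)
  | swap (i : Fin 2) : RRel k (FreeAlgebra.ι k (.e i) * FreeAlgebra.ι k .T)
      (FreeAlgebra.ι k .T * FreeAlgebra.ι k (.e (1 - i)))
  | sq : RRel k (FreeAlgebra.ι k .T * FreeAlgebra.ι k .T) 0

/-- The `k`-algebra `R` generated by `e₁, e₂, T` subject to `e₁ + e₂ = 1`, `e_i e_j = δ_ij e_i`,
`e_i T = T e_{3-i}` and `T² = 0`. -/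
abbrev RAlg (k : Type u) [Field k] : Type u := RingQuot (RRel k)

namespace RAlg

variable (k : Type u) [Field k]

/-- The idempotent `e_i` of `R`. -/
def e (i : Fin 2) : RAlg k := RingQuot.mkAlgHom k (RRel k) (FreeAlgebra.ι k (.e i))

/-- The element `T` of `R`. -/
def T : RAlg k := RingQuot.mkAlgHom k (RRel k) (FreeAlgebra.ι k .T)

/-- The values of the character `χ_i` on the generators. -/
def charGen (i : Fin 2) : RGen → k
  | .e j => if i = j then 1 else 0
  | .T => 0

/-- The character `χ_i : R → k` with `χ_i(T) = 0` and `χ_i(e_j) = δ_ij`. -/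
def character (i : Fin 2) : RAlg k →ₐ[k] k :=
  RingQuot.liftAlgHom k ⟨FreeAlgebra.lift k (charGen k i), by
    intro x y h
    induction h with
    | sum => fin_cases i <;> simp [charGen]
    | idem a b => fin_cases i <;> fin_cases a <;> fin_cases b <;> simp [charGen]
    | swap a => simp [charGen]
    | sq => simp [charGen]⟩

theorem character_e (i j : Fin 2) : character k i (e k j) = if i = j then 1 else 0 := by
  simp [character, e, charGen]

theorem character_T (i : Fin 2) : character k i (T k) = 0 := by
  simp [character, T, charGen]

/-- The one-dimensional left `R`-module `χ_i`: the vector space `k` on which `R` acts through the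
character `χ_i`. -/
def CharModule (_i : Fin 2) : Type u := k

instance (i : Fin 2) : AddCommGroup (CharModule k i) := inferInstanceAs (AddCommGroup k)

instance (i : Fin 2) : Module k (CharModule k i) := inferInstanceAs (Module k k)

instance (i : Fin 2) : Module (RAlg k) (CharModule k i) :=
  Module.compHom k (character k i).toRingHom

instance (i : Fin 2) : IsScalarTower k (RAlg k) (CharModule k i) where
  smul_assoc c r m := by
    change (character k i (c • r) * (show k from m) : k) =
      c * (character k i r * (show k from m))
    rw [map_smul, smul_eq_mul, mul_assoc]

end RAlg

/-- The functor `Mod(k²) ⥤ Ho(R)`, `(V₁, V₂) ↦ (χ₁ ⊗ V₁) ⊕ (χ₂ ⊗ V₂)`. -/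
def functorR (k : Type u) [Field k] : ModuleCat.{u} k × ModuleCat.{u} k ⥤ Ho (RAlg k) :=
  tensorSum k (RAlg k) (RAlg.CharModule k 0) (RAlg.CharModule k 1) ⋙ toHo (RAlg k)

/-! ### The algebra `A = k[X₁, X₂]/(X₁X₂)` -/

/-- The `k`-algebra `A = k[X₁, X₂]/(X₁X₂)`. -/
abbrev AAlg (k : Type u) [Field k] : Type u :=
  MvPolynomial (Fin 2) k ⧸
    Ideal.span {(MvPolynomial.X 0 * MvPolynomial.X 1 : MvPolynomial (Fin 2) k)}

namespace AAlg

variable (k : Type u) [Field k]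

/-- The class of `X₁` in `A`. -/
def X₁ : AAlg k := Ideal.Quotient.mk _ (MvPolynomial.X 0)

/-- The class of `X₂` in `A`. -/
def X₂ : AAlg k := Ideal.Quotient.mk _ (MvPolynomial.X 1)

/-- The `A`-module `M₁ = A/X₂A` (isomorphic to `X₁A`). -/
abbrev M₁ : Type u := AAlg k ⧸ Ideal.span {X₂ k}

/-- The `A`-module `M₂ = A/X₁A` (isomorphic to `X₂A`). -/
abbrev M₂ : Type u := AAlg k ⧸ Ideal.span {X₁ k}

end AAlg

/-- The functor `Mod(k²) ⥤ Ho(A)`, `(V₁, V₂) ↦ (A/X₂A ⊗ V₁) ⊕ (A/X₁A ⊗ V₂)`. -/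
def functorA (k : Type u) [Field k] : ModuleCat.{u} k × ModuleCat.{u} k ⥤ Ho (AAlg k) :=
  tensorSum k (AAlg k) (AAlg.M₁ k) (AAlg.M₂ k) ⋙ toHo (AAlg k)

/-! ### The finite Hecke algebra and its regular components -/

/-- The generators `T_t` (`t` in the finite torus) and `T_{s_0}, T_{s_1}` of the affine Hecke
algebra. -/
inductive HeckeGen (D : Type v) : Type v
  | torus (t : D)
  | refl (i : Fin 2)

section Hecke

variable (k : Type u) [Field k] {D : Type v} [CommGroup D] [Fintype D]
  {U : Type v} [CommGroup U] [Fintype U] (s : D →* D) (α : U →* D)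

/-- The braid relations and quadratic relations of the affine pro-`p` Iwahori-Hecke algebra (over
a field of characteristic `p`) of a rank one group with finite torus `D = T(F_q)`, action `s` of
the nontrivial Weyl group element on `D`, and coroot `α : U = F_q^× → D`. The quadratic relation
is `T_{s_i}² = T_{s_i} ∑_{x ∈ F_q^×} T_{α(x)}`. -/
inductive HeckeRel :
    FreeAlgebra k (HeckeGen D) → FreeAlgebra k (HeckeGen D) → Prop
  | one : HeckeRel (FreeAlgebra.ι k (.torus 1)) 1
  | mul (t t' : D) :
      HeckeRel (FreeAlgebra.ι k (.torus t) * FreeAlgebra.ι k (.torus t'))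
        (FreeAlgebra.ι k (.torus (t * t')))
  | braid (i : Fin 2) (t : D) :
      HeckeRel (FreeAlgebra.ι k (.refl i) * FreeAlgebra.ι k (.torus t))
        (FreeAlgebra.ι k (.torus (s t)) * FreeAlgebra.ι k (.refl i))
  | quad (i : Fin 2) :
      HeckeRel (FreeAlgebra.ι k (.refl i) * FreeAlgebra.ι k (.refl i))
        (FreeAlgebra.ι k (.refl i) * ∑ x : U, FreeAlgebra.ι k (.torus (α x)))

/-- The affine Hecke algebra. -/
abbrev HeckeAff : Type max u v := RingQuot (HeckeRel k s α)

namespace HeckeAff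

/-- The element `T_t`. -/
def torus (t : D) : HeckeAff k s α :=
  RingQuot.mkAlgHom k (HeckeRel k s α) (FreeAlgebra.ι k (.torus t))

/-- The element `T_{s_i}`. -/
def refl (i : Fin 2) : HeckeAff k s α :=
  RingQuot.mkAlgHom k (HeckeRel k s α) (FreeAlgebra.ι k (.refl i))

/-- The finite Hecke algebra `H_{x_0}`: the subalgebra generated by the `T_t` and `T_{s_0}`. -/
def finiteHecke : Subalgebra k (HeckeAff k s α) :=
  Algebra.adjoin k (Set.range (torus k s α) ∪ {refl k s α 0})

/-- The idempotent `e_ξ = |T(F_q)|⁻¹ ∑_t ξ(t⁻¹) T_t` of a character `ξ` of the torus. -/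
def idem (ξ : D →* kˣ) : HeckeAff k s α :=
  ((Fintype.card D : k)⁻¹) • ∑ t : D, (ξ t⁻¹ : k) • torus k s α t

end HeckeAff

/-- For every regular orbit `γ = {ξ, ξ^s}` (i.e. `ξ ≠ ξ^s`), the component `e_γ H_{x_0}`, where
`e_γ = e_ξ + e_{ξ^s}`, is a copy of the algebra `R`: there is an isomorphism of `k`-algebras from
`R` onto `e_γ H_{x_0}` (whose unit is `e_γ`) with `e₁ ↦ e_ξ`, `e₂ ↦ e_{ξ^s}`,
`T ↦ e_γ T_{s_0}`. -/
def RegularComponentsAreR : Prop :=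
  ∀ ξ : D →* kˣ, ξ ≠ ξ.comp s →
    ∃ φ : RAlg k →ₙₐ[k] HeckeAff k s α,
      Function.Injective φ ∧
      Set.range φ = {y | ∃ h ∈ HeckeAff.finiteHecke k s α,
        y = (HeckeAff.idem k s α ξ + HeckeAff.idem k s α (ξ.comp s)) * h} ∧
      φ 1 = HeckeAff.idem k s α ξ + HeckeAff.idem k s α (ξ.comp s) ∧
      φ (RAlg.e k 0) = HeckeAff.idem k s α ξ ∧
      φ (RAlg.e k 1) = HeckeAff.idem k s α (ξ.comp s) ∧
      φ (RAlg.T k) = (HeckeAff.idem k s α ξ + HeckeAff.idem k s α (ξ.comp s)) *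
        HeckeAff.refl k s α 0

end Hecke

section RankOneTori

variable (F : Type v) [Field F]

/-- The nontrivial Weyl group element acting on the torus `{diag(x, x⁻¹)} = F^×` of `SL₂`, or on
the torus `{diag(x, y)}/{scalars} = F^×` (coordinate `x y⁻¹`) of `PGL₂`: inversion. -/
def weylInv : Fˣ →* Fˣ := invMonoidHom

/-- The nontrivial Weyl group element acting on the torus `{diag(x, y)} = F^× × F^×` of `GL₂`. -/
def weylGL : Fˣ × Fˣ →* Fˣ × Fˣ := (MonoidHom.snd Fˣ Fˣ).prod (MonoidHom.fst Fˣ Fˣ)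

/-- The coroot `x ↦ diag(x, x⁻¹)` of `SL₂`, in the coordinate of its torus. -/
def corootSL : Fˣ →* Fˣ := MonoidHom.id Fˣ

/-- The coroot `x ↦ diag(x, x⁻¹)` of `GL₂`. -/
def corootGL : Fˣ →* Fˣ × Fˣ := (MonoidHom.id Fˣ).prod invMonoidHom

/-- The coroot `x ↦ diag(x, x⁻¹)` of `PGL₂`, in the coordinate of its torus: `x ↦ x²`. -/
def corootPGL : Fˣ →* Fˣ := powMonoidHom 2

end RankOneTori

end

/-!
Both equivalences come from one argument about two-periodic homology.

For `R`, multiplication with `T` gives, for every module `M`, a two-periodic complex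
`⋯ → e₂M → e₁M → e₂M → ⋯`; for `A` the complex `⋯ → M → M → M → ⋯` is given alternately by `X₁` and
`X₂`. A `PeriodicPair` in a ring `S` is the common abstraction. As it is exact on `S` from both
sides, the homology of the complex vanishes on projective modules, hence on modules of finite
projective dimension, and on the modules `Hom_k(S, M)`. So the long exact sequence shows that
homology is a functor from `Ho(S)` to `Mod(k) × Mod(k)` (`totalHomology_inverts`), that the shift
of `Ho(S)` swaps the two homology spaces (`totalHomologyCosyzygyIso`), and that homology sends
distinguished triangles to triples of exact sequences of the kind asked for in `modSqTriv`
(`distinguished_hoHomology`).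

The modules in the theorem (`χ₁`, `χ₂`, respectively `A/X₂A`, `A/X₁A`) represent the two spaces of
cycles and have one-dimensional homology (`PeriodicPair.Generator`). A choice of cycles therefore
gives a map from `(N₁ ⊗ H₁) ⊕ (N₂ ⊗ H₂)` to each module `M` with homology `(H₁, H₂)`, which is an
isomorphism on homology; it is natural up to maps factoring through projective modules. If
conversely modules without homology have finite projective dimension, these maps are isomorphisms
in `Ho(S)` (`isIso_toHo_map`), so homology is quasi-inverse to the functor of the theorem
(`hoEquivalence`). Finally, homology detects distinguished triangles since every morphism is part of
one, and a triangle in `Mod(k²)_{2,triv}` is determined up to isomorphism by its first morphism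
(`modSqTriv_exists_iso`). The result is `PeriodicPair.isTriangleEquivalence_tensorSum`.

That modules without homology have finite projective dimension is proved separately. Over `R`, a
contracting homotopy of `T` on `M` turns a linear section of a free cover of `M` into one commuting
with `T`, and averaging over `e₁, e₂` makes it `R`-linear; so `M` is projective
(`RGenerators.projective`), and the same device shows that `R` is injective on both sides. Over `A`,
let `K` be the first syzygy of `M`. Then `K/X_iK` embeds in a free module over the principal ideal
domain `A/X_iA`, hence is projective, and `K` is glued from these two quotients, hence projective
(`Module.Projective.of_exact`).

The isomorphism between `R` and the regular component of the Hecke algebra rests on the fact that a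
character `ξ ≠ ξ^s` is nontrivial on the coroot, so that the sum in the quadratic relation is
annihilated by `e_γ`. Injectivity is seen in a representation by `2 × 2` matrices over the dual
numbers (`HeckeAff.regularComponentsAreR`).
-/

noncomputable section

/-! ### Periodic pairs and their homology -/

/-- A two-periodic complex `⋯ → fS → eS → fS → eS → ⋯` of right ideals of a ring `S`, given by
left multiplication with `d : eS → fS` and `c : fS → eS`, which is exact, and such that the
complex of left ideals given by right multiplication with `c` and `d` is exact as well. -/
structure PeriodicPair (S : Type*) [Ring S] where
  (e f c d : S)
  e_mul_e : e * e = e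
  f_mul_f : f * f = f
  e_mul_c : e * c = c
  c_mul_f : c * f = c
  f_mul_d : f * d = d
  d_mul_e : d * e = d
  c_mul_d : c * d = 0
  d_mul_c : d * c = 0
  exact_left : ∀ s, e * s = s → d * s = 0 → ∃ t, c * t = s
  exact_left' : ∀ s, f * s = s → c * s = 0 → ∃ t, d * t = s
  exact_right : ∀ s, s * c = 0 → ∃ t, t * d = s * e
  exact_right' : ∀ s, s * d = 0 → ∃ t, t * c = s * f

namespace PeriodicPair

/-- The complex shifted by one. -/
def swap {S : Type*} [Ring S] (P : PeriodicPair S) : PeriodicPair S where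
  e := P.f
  f := P.e
  c := P.d
  d := P.c
  e_mul_e := P.f_mul_f
  f_mul_f := P.e_mul_e
  e_mul_c := P.f_mul_d
  c_mul_f := P.d_mul_e
  f_mul_d := P.e_mul_c
  d_mul_e := P.c_mul_f
  c_mul_d := P.d_mul_c
  d_mul_c := P.c_mul_d
  exact_left := P.exact_left'
  exact_left' := P.exact_left
  exact_right := P.exact_right'
  exact_right' := P.exact_right

section Homology

variable (k : Type*) [Field k] {S : Type*} [Ring S] [Algebra k S] (P : PeriodicPair S)
  (M : Type*) [AddCommGroup M] [Module k M] [Module S M] [IsScalarTower k S M]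
  {N : Type*} [AddCommGroup N] [Module k N] [Module S N] [IsScalarTower k S N]
  {L : Type*} [AddCommGroup L] [Module k L] [Module S L] [IsScalarTower k S L]

/-- The cycles of the complex `⋯ → fM → eM → fM → ⋯` at `eM`. -/
def cycles : Submodule k M where
  carrier := {m | P.e • m = m ∧ P.d • m = 0}
  add_mem' := by
    rintro a b ⟨h, h'⟩ ⟨g, g'⟩
    exact ⟨by rw [smul_add, h, g], by rw [smul_add, h', g', add_zero]⟩
  zero_mem' := ⟨smul_zero _, smul_zero _⟩
  smul_mem' := by
    rintro a b ⟨h, h'⟩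
    exact ⟨by rw [smul_comm, h], by rw [smul_comm, h', smul_zero]⟩

/-- The boundaries of the complex `⋯ → fM → eM → fM → ⋯` at `eM`. -/
def boundaries : Submodule k (P.cycles k M) where
  carrier := {z | ∃ n : M, P.c • n = z}
  add_mem' := by
    rintro a b ⟨m, h⟩ ⟨n, h'⟩
    exact ⟨m + n, by rw [smul_add, h, h', Submodule.coe_add]⟩
  zero_mem' := ⟨0, smul_zero _⟩
  smul_mem' := by
    rintro a b ⟨m, h⟩
    exact ⟨a • m, by rw [smul_comm, h, Submodule.coe_smul]⟩

/-- The homology at `eM` of the complex `⋯ → fM → eM → fM → ⋯`. -/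
abbrev Homology : Type _ := P.cycles k M ⧸ P.boundaries k M

variable {M}

/-- The homology class of a cycle. -/
def cls : P.cycles k M →ₗ[k] P.Homology k M := Submodule.mkQ _

variable {k P}

theorem cls_surjective : Function.Surjective (P.cls k (M := M)) := Submodule.mkQ_surjective _

theorem cls_eq_zero {z : P.cycles k M} : P.cls k z = 0 ↔ ∃ n : M, P.c • n = z :=
  Submodule.Quotient.mk_eq_zero _

theorem cls_eq {z w : P.cycles k M} : P.cls k z = P.cls k w ↔ ∃ n : M, P.c • n = (z - w : M) := by
  rw [← sub_eq_zero, ← map_sub, cls_eq_zero, Submodule.coe_sub]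

theorem c_smul_mem (n : M) : P.c • n ∈ P.cycles k M :=
  ⟨by rw [← mul_smul, P.e_mul_c], by rw [← mul_smul, P.d_mul_c, zero_smul]⟩

theorem map_mem_cycles (φ : M →ₗ[S] N) {m : M} (h : m ∈ P.cycles k M) : φ m ∈ P.cycles k N :=
  ⟨by rw [← map_smul, h.1], by rw [← map_smul, h.2, map_zero]⟩

/-- The homology of the complex vanishes if and only if the complex is exact. -/
theorem subsingleton_homology_iff : Subsingleton (P.Homology k M) ↔
    ∀ m : M, P.e • m = m → P.d • m = 0 → ∃ n : M, P.c • n = m := by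
  refine ⟨fun h m h₁ h₂ => cls_eq_zero.1 (Subsingleton.elim (P.cls k ⟨m, h₁, h₂⟩) 0), fun h => ?_⟩
  refine subsingleton_of_forall_eq 0 fun x => ?_
  obtain ⟨z, rfl⟩ := cls_surjective x
  exact cls_eq_zero.2 (h z z.2.1 z.2.2)

variable (k P)

/-- The map induced on homology. -/
def mapHomology (φ : M →ₗ[S] N) : P.Homology k M →ₗ[k] P.Homology k N :=
  Submodule.mapQ _ _ ((φ.restrictScalars k).restrict fun _ h => map_mem_cycles φ h) <| by
    rintro z ⟨n, h⟩
    exact ⟨φ n, by rw [← map_smul, h]; rfl⟩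

variable {k P}

theorem mapHomology_cls (φ : M →ₗ[S] N) (z : P.cycles k M) :
    P.mapHomology k φ (P.cls k z) = P.cls k ⟨φ z, map_mem_cycles φ z.2⟩ := rfl

theorem mapHomology_id : P.mapHomology k (LinearMap.id : M →ₗ[S] M) = LinearMap.id := by
  refine LinearMap.ext fun x => ?_
  obtain ⟨z, rfl⟩ := cls_surjective x
  rfl

theorem mapHomology_comp (ψ : N →ₗ[S] L) (φ : M →ₗ[S] N) :
    P.mapHomology k (ψ ∘ₗ φ) = P.mapHomology k ψ ∘ₗ P.mapHomology k φ := by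
  refine LinearMap.ext fun x => ?_
  obtain ⟨z, rfl⟩ := cls_surjective x
  rfl

theorem mapHomology_add (ψ φ : M →ₗ[S] N) :
    P.mapHomology k (ψ + φ) = P.mapHomology k ψ + P.mapHomology k φ := by
  refine LinearMap.ext fun x => ?_
  obtain ⟨z, rfl⟩ := cls_surjective x
  rfl

theorem mapHomology_sub (ψ φ : M →ₗ[S] N) :
    P.mapHomology k (ψ - φ) = P.mapHomology k ψ - P.mapHomology k φ := by
  rw [eq_sub_iff_add_eq, ← mapHomology_add, sub_add_cancel]

/-- A direct summand whose complement has no homology has the same homology as the whole. -/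
theorem bijective_mapHomology_of_split {φ : M →ₗ[S] N} {π : N →ₗ[S] M} {ψ : L →ₗ[S] N}
    {π' : N →ₗ[S] L} (h : π ∘ₗ φ = LinearMap.id) (h' : φ ∘ₗ π + ψ ∘ₗ π' = LinearMap.id)
    [Subsingleton (P.Homology k L)] : Function.Bijective (P.mapHomology k φ) := by
  replace h : P.mapHomology k π ∘ₗ P.mapHomology k φ = LinearMap.id := by
    rw [← mapHomology_comp, h, mapHomology_id]
  replace h' : P.mapHomology k φ ∘ₗ P.mapHomology k π = LinearMap.id := by
    rw [← mapHomology_comp, ← mapHomology_id, ← h', mapHomology_add, mapHomology_comp ψ,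
      Subsingleton.elim (P.mapHomology k π') 0, LinearMap.comp_zero, add_zero]
  exact Function.bijective_iff_has_inverse.2
    ⟨P.mapHomology k π, LinearMap.congr_fun h, LinearMap.congr_fun h'⟩

/-! ### The long exact sequence -/

section LongExact

variable {φ : M →ₗ[S] N} {ψ : N →ₗ[S] L} (hφ : Function.Injective φ) (hψ : Function.Surjective ψ)
  (hex : Function.Exact φ ψ)

include hφ hψ hex in
theorem exact_mapHomology : Function.Exact (P.mapHomology k φ) (P.mapHomology k ψ) := by
  intro x
  obtain ⟨z, rfl⟩ := cls_surjective x
  constructor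
  · intro h
    rw [mapHomology_cls, cls_eq_zero] at h
    obtain ⟨l, hl⟩ := h
    obtain ⟨n, rfl⟩ := hψ l
    obtain ⟨m, hm⟩ := (hex (z - P.c • n)).1 (by rw [map_sub, map_smul, hl, sub_self])
    have hc := c_smul_mem (k := k) (P := P) n
    refine ⟨P.cls k ⟨m, hφ ?_, hφ ?_⟩, ?_⟩
    · rw [map_smul, hm, smul_sub, z.2.1, hc.1]
    · rw [map_smul, hm, smul_sub, z.2.2, hc.2, map_zero, sub_zero]
    · rw [mapHomology_cls, cls_eq]
      exact ⟨-n, by simp [hm]⟩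
  · rintro ⟨y, hy⟩
    rw [← hy]
    obtain ⟨w, rfl⟩ := cls_surjective y
    rw [mapHomology_cls, mapHomology_cls, cls_eq_zero]
    exact ⟨0, by simp [hex.apply_apply_eq_zero]⟩

/-- The connecting homomorphism is characterised by the usual diagram chase. It is constructed from
`k`-linear splittings, which makes it a linear map without further choices. -/
theorem exists_connecting (hφ : Function.Injective φ) (hψ : Function.Surjective ψ)
    (hex : Function.Exact φ ψ) : ∃ δ : P.Homology k L →ₗ[k] P.swap.Homology k M,
      ∀ (z : P.cycles k L) (w : P.swap.cycles k M) (n : N), ψ n = z → φ w = P.d • n →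
        δ (P.cls k z) = P.swap.cls k w := by
  obtain ⟨σ, hσ⟩ := (ψ.restrictScalars k).exists_rightInverse_of_surjective
    (LinearMap.range_eq_top.2 hψ)
  obtain ⟨ρ, hρ⟩ := (φ.restrictScalars k).exists_leftInverse_of_injective
    (LinearMap.ker_eq_bot.2 hφ)
  replace hσ (l : L) : ψ (σ l) = l := LinearMap.congr_fun hσ l
  replace hρ (m : M) : ρ (φ m) = m := LinearMap.congr_fun hρ m
  have hφρ (z : P.cycles k L) : φ (ρ (P.d • σ z)) = P.d • σ z := by
    obtain ⟨m, hm⟩ := (hex (P.d • σ z)).1 (by rw [map_smul, hσ, z.2.2])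
    rw [← hm, hρ]
  let δ₀ : P.cycles k L →ₗ[k] P.swap.cycles k M :=
    { toFun z := ⟨ρ (P.d • σ z), hφ (by
          rw [map_smul, hφρ, ← mul_smul]; exact congrArg (· • _) P.f_mul_d), hφ (by
          rw [map_smul, hφρ, ← mul_smul, map_zero]
          exact (congrArg (· • _) P.c_mul_d).trans (zero_smul _ _))⟩
      map_add' z w := Subtype.ext <| by
        change ρ (P.d • σ (z + w : L)) = ρ (P.d • σ z) + ρ (P.d • σ w)
        rw [map_add, smul_add, map_add]
      map_smul' a z := Subtype.ext <| by
        change ρ (P.d • σ (a • z : L)) = a • ρ (P.d • σ z)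
        rw [map_smul σ, smul_comm P.d a, map_smul ρ] }
  have key (z : P.cycles k L) (w : P.swap.cycles k M) (n : N) (hn : ψ n = z)
      (hw : φ w = P.d • n) : P.swap.cls k (δ₀ z) = P.swap.cls k w := by
    obtain ⟨u, hu⟩ := (hex (σ z - n)).1 (by rw [map_sub, hσ, hn, sub_self])
    refine cls_eq.2 ⟨u, hφ ?_⟩
    rw [map_smul, hu, map_sub, hw, smul_sub]
    exact congrArg (· - _) (hφρ z).symm
  refine ⟨Submodule.liftQ _ (P.swap.cls k ∘ₗ δ₀) ?_, key⟩
  rintro z ⟨l, hl⟩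
  refine (key z 0 (P.c • σ l) (by rw [map_smul, hσ, hl]) ?_).trans (map_zero _)
  rw [← mul_smul, P.d_mul_c, zero_smul]
  exact map_zero φ

variable (k P)

/-- The connecting homomorphism `H(L) → H(M)[1]` of a short exact sequence `0 → M → N → L → 0`. -/
def connecting : P.Homology k L →ₗ[k] P.swap.Homology k M := (exists_connecting hφ hψ hex).choose

variable {k P}

theorem connecting_cls {z : P.cycles k L} {w : P.swap.cycles k M} {n : N} (hn : ψ n = z)
    (hw : φ w = P.d • n) : P.connecting k hφ hψ hex (P.cls k z) = P.swap.cls k w :=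
  (exists_connecting hφ hψ hex).choose_spec z w n hn hw

omit [Module k N] [IsScalarTower k S N] in
include hφ hψ hex in
theorem exists_lift_cycle (z : P.cycles k L) :
    ∃ (n : N) (w : P.swap.cycles k M), P.e • n = n ∧ ψ n = z ∧ φ w = P.d • n := by
  obtain ⟨n, hn⟩ := hψ z
  obtain ⟨m, hm⟩ := (hex (P.d • n)).1 (by rw [map_smul, hn, z.2.2])
  refine ⟨P.e • n, ⟨m, hφ ?_, hφ ?_⟩, ?_, ?_, ?_⟩
  · rw [map_smul, hm, ← mul_smul]; exact congrArg (· • _) P.f_mul_d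
  · rw [map_smul, hm, ← mul_smul, map_zero]
    exact (congrArg (· • _) P.c_mul_d).trans (zero_smul _ _)
  · rw [← mul_smul, P.e_mul_e]
  · rw [map_smul, hn, z.2.1]
  · exact hm.trans (by rw [← mul_smul, P.d_mul_e])

theorem exact_mapHomology_connecting :
    Function.Exact (P.mapHomology k ψ) (P.connecting k hφ hψ hex) := by
  intro x
  obtain ⟨z, rfl⟩ := cls_surjective x
  constructor
  · intro h
    obtain ⟨n, w, hen, hn, hw⟩ := exists_lift_cycle (k := k) (P := P) hφ hψ hex z
    rw [connecting_cls hφ hψ hex hn hw, cls_eq_zero] at h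
    obtain ⟨m, hm⟩ := h
    have hm' : φ (P.d • m) = P.d • n := by rw [← hw, ← hm]; rfl
    refine ⟨P.cls k ⟨n - φ (P.e • m), ?_, ?_⟩, ?_⟩
    · rw [smul_sub, hen, map_smul, ← mul_smul, P.e_mul_e]
    · rw [smul_sub, map_smul, ← mul_smul, P.d_mul_e, ← hm', map_smul, sub_self]
    · rw [mapHomology_cls, cls_eq]
      refine ⟨0, ?_⟩
      simp only [map_sub, hn, hex.apply_apply_eq_zero, sub_zero, sub_self, smul_zero]
  · rintro ⟨y, hy⟩
    rw [← hy]
    obtain ⟨v, rfl⟩ := cls_surjective y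
    rw [mapHomology_cls, connecting_cls hφ hψ hex (w := 0) (n := v) rfl, map_zero]
    rw [v.2.2]
    exact map_zero φ

theorem exact_connecting_mapHomology :
    Function.Exact (P.connecting k hφ hψ hex) (P.swap.mapHomology k φ) := by
  intro x
  obtain ⟨w, rfl⟩ := cls_surjective x
  constructor
  · intro h
    rw [mapHomology_cls, cls_eq_zero] at h
    obtain ⟨n, hn⟩ := h
    have hn' : P.d • n = φ w := hn
    refine ⟨P.cls k ⟨ψ (P.e • n), ?_, ?_⟩, connecting_cls hφ hψ hex (n := P.e • n) rfl ?_⟩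
    · rw [← map_smul, ← mul_smul, P.e_mul_e]
    · rw [← map_smul, ← mul_smul, P.d_mul_e, hn', hex.apply_apply_eq_zero]
    · rw [← mul_smul, P.d_mul_e, hn']
  · rintro ⟨y, hy⟩
    rw [← hy]
    obtain ⟨z, rfl⟩ := cls_surjective y
    obtain ⟨n, v, -, hn, hv⟩ := exists_lift_cycle (k := k) (P := P) hφ hψ hex z
    rw [connecting_cls hφ hψ hex hn hv, mapHomology_cls, cls_eq_zero]
    exact ⟨n, hv.symm⟩

/-- Naturality of the connecting homomorphism with respect to the middle and right hand terms, and
to the left hand term. -/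
theorem mapHomology_connecting {M' N' L' : Type*} [AddCommGroup M'] [Module k M'] [Module S M']
    [IsScalarTower k S M'] [AddCommGroup N'] [Module k N'] [Module S N'] [IsScalarTower k S N']
    [AddCommGroup L'] [Module k L'] [Module S L'] [IsScalarTower k S L']
    {φ' : M' →ₗ[S] N'} {ψ' : N' →ₗ[S] L'} (hφ' : Function.Injective φ')
    (hψ' : Function.Surjective ψ') (hex' : Function.Exact φ' ψ')
    {a : M →ₗ[S] M'} {b : N →ₗ[S] N'} {c : L →ₗ[S] L'} (hab : b ∘ₗ φ = φ' ∘ₗ a)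
    (hbc : c ∘ₗ ψ = ψ' ∘ₗ b) (x : P.Homology k L) :
    P.swap.mapHomology k a (P.connecting k hφ hψ hex x) =
      P.connecting k hφ' hψ' hex' (P.mapHomology k c x) := by
  obtain ⟨z, rfl⟩ := cls_surjective x
  obtain ⟨n, w, -, hn, hw⟩ := exists_lift_cycle (k := k) (P := P) hφ hψ hex z
  rw [connecting_cls hφ hψ hex hn hw, mapHomology_cls, mapHomology_cls]
  refine (connecting_cls hφ' hψ' hex' (n := b n) ?_ ?_).symm
  · rw [← LinearMap.comp_apply, ← hbc, LinearMap.comp_apply, hn]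
  · rw [← map_smul, ← hw]
    exact (LinearMap.congr_fun hab w).symm

include hφ hψ hex in
theorem bijective_mapHomology_of_left [Subsingleton (P.Homology k M)]
    [Subsingleton (P.swap.Homology k M)] : Function.Bijective (P.mapHomology k ψ) := by
  constructor
  · rw [injective_iff_map_eq_zero]
    intro x hx
    obtain ⟨y, rfl⟩ := (exact_mapHomology hφ hψ hex x).1 hx
    rw [Subsingleton.elim y 0, map_zero]
  · exact fun x => (exact_mapHomology_connecting hφ hψ hex x).1 (Subsingleton.elim _ _)

include hφ hψ hex in
theorem bijective_mapHomology_of_right [Subsingleton (P.Homology k L)]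
    [Subsingleton (P.swap.Homology k L)] : Function.Bijective (P.mapHomology k φ) := by
  constructor
  · rw [injective_iff_map_eq_zero]
    intro x hx
    obtain ⟨y, rfl⟩ := (exact_connecting_mapHomology (P := P.swap) hφ hψ hex x).1 hx
    exact (congrArg _ (Subsingleton.elim y 0)).trans (map_zero _)
  · exact fun x => (exact_mapHomology hφ hψ hex x).1 (Subsingleton.elim _ _)

include hφ hψ hex in
theorem bijective_connecting [Subsingleton (P.Homology k N)]
    [Subsingleton (P.swap.Homology k N)] :
    Function.Bijective (P.connecting k hφ hψ hex) := by
  constructor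
  · rw [injective_iff_map_eq_zero]
    intro x hx
    obtain ⟨y, rfl⟩ := (exact_mapHomology_connecting hφ hψ hex x).1 hx
    rw [Subsingleton.elim y 0, map_zero]
  · exact fun x => (exact_connecting_mapHomology hφ hψ hex x).1 (Subsingleton.elim _ _)

include hφ hψ hex in
/-- If a surjection with kernel `M` is surjective on homology at `e` and injective on homology at
`f`, then `M` has no homology at `f`. -/
theorem subsingleton_homology_of_bijective (h : Function.Surjective (P.mapHomology k ψ))
    (h' : Function.Injective (P.swap.mapHomology k ψ)) : Subsingleton (P.swap.Homology k M) := by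
  refine subsingleton_of_forall_eq 0 fun x => ?_
  have hx : P.swap.mapHomology k φ x = 0 :=
    h' (((exact_mapHomology hφ hψ hex).apply_apply_eq_zero x).trans (map_zero _).symm)
  obtain ⟨y, rfl⟩ := (exact_connecting_mapHomology hφ hψ hex x).1 hx
  obtain ⟨z, rfl⟩ := h y
  exact (exact_mapHomology_connecting hφ hψ hex).apply_apply_eq_zero z

end LongExact

end Homology

end PeriodicPair

/-! ### Vanishing of homology and finite projective dimension -/

namespace PeriodicPair

section Exact

variable {S : Type*} [Ring S] (P : PeriodicPair S) (M : Type*) [AddCommGroup M] [Module S M]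

/-- The complex `⋯ → fM → eM → fM → ⋯` is exact. -/
def IsExact : Prop :=
  (∀ m : M, P.e • m = m → P.d • m = 0 → ∃ n : M, P.c • n = m) ∧
    ∀ m : M, P.f • m = m → P.c • m = 0 → ∃ n : M, P.d • n = m

variable {P M}

theorem isExact_iff (k : Type*) [Field k] [Algebra k S] [Module k M] [IsScalarTower k S M] :
    P.IsExact M ↔ Subsingleton (P.Homology k M) ∧ Subsingleton (P.swap.Homology k M) := by
  rw [subsingleton_homology_iff, subsingleton_homology_iff]
  rfl

/-- Exactness at `eM` passes from `S` to free modules coordinatewise, and so to projective ones. -/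
theorem exists_smul_eq_of_projective [Module.Projective S M] (m : M) (he : P.e • m = m)
    (hd : P.d • m = 0) : ∃ n : M, P.c • n = m := by
  obtain ⟨s, hs⟩ := Module.projective_lifting_property (Finsupp.linearCombination S (id : M → M))
    LinearMap.id (Finsupp.linearCombination_id_surjective S M)
  replace hs (x : M) : Finsupp.linearCombination S (id : M → M) (s x) = x :=
    LinearMap.congr_fun hs x
  have hc (i : M) : ∃ t : S, P.c * t = s m i := by
    refine P.exact_left _ ?_ ?_
    · rw [← smul_eq_mul, ← Finsupp.smul_apply, ← map_smul, he]
    · rw [← smul_eq_mul, ← Finsupp.smul_apply, ← map_smul, hd, map_zero, Finsupp.zero_apply]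
  choose t ht using hc
  refine ⟨Finsupp.linearCombination S (id : M → M)
    ((s m).sum fun i _ => Finsupp.single i (t i)), ?_⟩
  rw [← map_smul, Finsupp.smul_sum]
  simp_rw [Finsupp.smul_single, smul_eq_mul, ht]
  exact (congrArg _ (Finsupp.sum_single (s m))).trans (hs m)

theorem isExact_of_projective [Module.Projective S M] : P.IsExact M :=
  ⟨exists_smul_eq_of_projective, exists_smul_eq_of_projective (P := P.swap)⟩

end Exact

open scoped ModuleCat

variable (k : Type u) [Field k] {S : Type u} [Ring S] [Algebra k S] (P : PeriodicPair S)

/-- The homology at `eM`, as a functor of `M`. -/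
def homologyFunctor : ModuleCat.{u} S ⥤ ModuleCat.{u} k where
  obj M := ModuleCat.of k (P.Homology k M)
  map φ := ModuleCat.ofHom (P.mapHomology k φ.hom)
  map_id _ := ModuleCat.hom_ext mapHomology_id
  map_comp _ _ := ModuleCat.hom_ext (mapHomology_comp _ _)

/-- The homology at `eM` and at `fM`, as a functor of `M`. -/
def totalHomology : ModuleCat.{u} S ⥤ ModuleCat.{u} k × ModuleCat.{u} k :=
  (P.homologyFunctor k).prod' (P.swap.homologyFunctor k)

variable {P}

theorem isIso_totalHomology_map_iff {M N : ModuleCat.{u} S} (φ : M ⟶ N) :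
    IsIso ((P.totalHomology k).map φ) ↔ Function.Bijective (P.mapHomology k φ.hom) ∧
      Function.Bijective (P.swap.mapHomology k φ.hom) := by
  rw [isIso_prod_iff]
  exact and_congr (ConcreteCategory.isIso_iff_bijective _)
    (ConcreteCategory.isIso_iff_bijective _)

section ShortExact

variable {E : ShortComplex (ModuleCat.{u} S)} (hE : E.ShortExact)

include hE in
theorem isExact_X₁ (h : IsIso ((P.totalHomology k).map E.g)) : P.IsExact E.X₁ := by
  rw [isIso_totalHomology_map_iff] at h
  have hex := (ShortComplex.ShortExact.moduleCat_exact_iff_function_exact E).1 hE.exact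
  exact (isExact_iff k).2
    ⟨subsingleton_homology_of_bijective (P := P.swap) hE.moduleCat_injective_f
      hE.moduleCat_surjective_g hex h.2.2 h.1.1,
    subsingleton_homology_of_bijective (P := P) hE.moduleCat_injective_f
      hE.moduleCat_surjective_g hex h.1.2 h.2.1⟩

include hE in
theorem isIso_of_isExact_X₁ (h : P.IsExact E.X₁) : IsIso ((P.totalHomology k).map E.g) := by
  rw [isIso_totalHomology_map_iff]
  have hex := (ShortComplex.ShortExact.moduleCat_exact_iff_function_exact E).1 hE.exact
  obtain ⟨h₁, h₂⟩ := (isExact_iff k).1 h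
  have h₁' : Subsingleton (P.swap.swap.Homology k E.X₁) := h₁
  exact ⟨bijective_mapHomology_of_left hE.moduleCat_injective_f hE.moduleCat_surjective_g hex,
    bijective_mapHomology_of_left (P := P.swap) hE.moduleCat_injective_f
      hE.moduleCat_surjective_g hex⟩

include hE in
theorem isIso_of_isExact_X₃ (h : P.IsExact E.X₃) : IsIso ((P.totalHomology k).map E.f) := by
  rw [isIso_totalHomology_map_iff]
  have hex := (ShortComplex.ShortExact.moduleCat_exact_iff_function_exact E).1 hE.exact
  obtain ⟨h₁, h₂⟩ := (isExact_iff k).1 h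
  have h₁' : Subsingleton (P.swap.swap.Homology k E.X₃) := h₁
  exact ⟨bijective_mapHomology_of_right hE.moduleCat_injective_f hE.moduleCat_surjective_g hex,
    bijective_mapHomology_of_right (P := P.swap) hE.moduleCat_injective_f
      hE.moduleCat_surjective_g hex⟩

include k hE in
theorem isExact_X₃ (h₁ : P.IsExact E.X₁) (h₂ : P.IsExact E.X₂) : P.IsExact E.X₃ := by
  have h := isIso_of_isExact_X₁ k hE h₁
  rw [isIso_totalHomology_map_iff] at h
  rw [isExact_iff k] at h₂ ⊢
  have := h₂.1
  have := h₂.2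
  exact ⟨h.1.2.subsingleton, h.2.2.subsingleton⟩

end ShortExact

/-- The short exact sequence of the kernel of an epimorphism. -/
theorem shortExact_kernel {M N : ModuleCat.{u} S} (g : M ⟶ N) [Epi g] :
    (ShortComplex.mk (kernel.ι g) g (kernel.condition g)).ShortExact where
  exact := ShortComplex.exact_of_f_is_kernel _ (kernelIsKernel g)

/-- The short exact sequence of the cokernel of a monomorphism. -/
theorem shortExact_cokernel {M N : ModuleCat.{u} S} (g : M ⟶ N) [Mono g] :
    (ShortComplex.mk g (cokernel.π g) (cokernel.condition g)).ShortExact where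
  exact := ShortComplex.exact_of_g_is_cokernel _ (cokernelIsCokernel g)

include k in
/-- Modules of finite projective dimension have vanishing homology, by dimension shifting. -/
theorem isExact_of_isTrivialModule {M : ModuleCat.{u} S} (h : IsTrivialModule S M) :
    P.IsExact M := by
  obtain ⟨n, hn⟩ := h
  have hproj {M : ModuleCat.{u} S} (h : Projective M) : P.IsExact M := by
    rw [← IsProjective.iff_projective] at h
    exact isExact_of_projective
  induction n generalizing M with
  | zero => exact hproj ((projective_iff_hasProjectiveDimensionLE_zero M).2 hn)
  | succ n ih =>
    have hE := shortExact_kernel (Projective.π M)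
    exact isExact_X₃ k hE
      (ih ((hE.hasProjectiveDimensionLT_X₃_iff n inferInstance).1 hn)) (hproj inferInstance)

/-- Homology is defined on `Ho(S)`. -/
theorem totalHomology_inverts :
    (weakEquivalences S).IsInvertedBy (P.totalHomology k) := by
  have h : weakEquivalences S ≤
      (MorphismProperty.isomorphisms _).inverseImage (P.totalHomology k) := by
    refine (MorphismProperty.multiplicativeClosure_le_iff _ _).2 ?_
    rintro M N g (⟨_, hg⟩ | ⟨_, hg⟩)
    · exact isIso_of_isExact_X₁ k (shortExact_kernel g) (isExact_of_isTrivialModule k hg)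
    · exact isIso_of_isExact_X₃ k (shortExact_cokernel g) (isExact_of_isTrivialModule k hg)
  exact fun _ _ g hg => h g hg

end PeriodicPair

/-! ### Morphisms which become equal or invertible in the homotopy category -/

section Localization

variable {S : Type u} [Ring S]

theorem isTrivialModule_of_projective (M : ModuleCat.{u} S) [Projective M] :
    IsTrivialModule S M := ⟨0, inferInstance⟩

theorem isTrivialModule_of_iso {M N : ModuleCat.{u} S} (e : M ≅ N) (h : IsTrivialModule S M) :
    IsTrivialModule S N := by
  obtain ⟨n, hn⟩ := h
  exact ⟨n, hasProjectiveDimensionLT_of_iso e _⟩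

theorem isIso_toHo_map_of_basic {M N : ModuleCat.{u} S} {g : M ⟶ N}
    (hg : basicWeakEquivalences S g) : IsIso ((toHo S).map g) :=
  (weakEquivalences S).Q_inverts g (.of g hg)

instance (M P : ModuleCat.{u} S) [Projective P] :
    IsIso ((toHo S).map (biprod.inl : M ⟶ M ⊞ P)) :=
  isIso_toHo_map_of_basic <| .inr ⟨inferInstance,
    isTrivialModule_of_iso cokernelBiprodInlIso.symm (isTrivialModule_of_projective P)⟩

instance (M P : ModuleCat.{u} S) [Projective P] :
    IsIso ((toHo S).map (biprod.fst : M ⊞ P ⟶ M)) :=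
  isIso_toHo_map_of_basic <| .inl ⟨inferInstance,
    isTrivialModule_of_iso kernelBiprodFstIso.symm (isTrivialModule_of_projective P)⟩

/-- Two morphisms whose difference factors through a projective module agree in `Ho(S)`. -/
theorem toHo_map_eq_of_sub_eq {M N P : ModuleCat.{u} S} [Projective P] {a b : M ⟶ N}
    (i : M ⟶ P) (q : P ⟶ N) (h : a - b = i ≫ q) : (toHo S).map a = (toHo S).map b := by
  have h₁ : (toHo S).map (biprod.lift (𝟙 M) i) = (toHo S).map (biprod.lift (𝟙 M) 0) := by
    rw [← cancel_mono ((toHo S).map (biprod.fst : M ⊞ P ⟶ M)), ← Functor.map_comp,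
      ← Functor.map_comp, biprod.lift_fst, biprod.lift_fst]
  have ha : a = biprod.lift (𝟙 M) i ≫ biprod.desc b q := by
    rw [biprod.lift_desc, Category.id_comp, ← h, add_sub_cancel]
  have hb : b = biprod.lift (𝟙 M) 0 ≫ biprod.desc b q := by
    rw [biprod.lift_desc, Category.id_comp, zero_comp, add_zero]
  rw [ha, Functor.map_comp, h₁, ← Functor.map_comp, ← hb]

end Localization

namespace PeriodicPair

variable {k : Type u} [Field k] {S : Type u} [Ring S] [Algebra k S] {P : PeriodicPair S}

/-- If exact modules are trivial, then every morphism inducing isomorphisms on homology becomes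
invertible in `Ho(S)`: up to a projective summand of the source it is surjective, and then its
kernel is exact. -/
theorem isIso_toHo_map (hP : ∀ M : ModuleCat.{u} S, P.IsExact M → IsTrivialModule S M)
    {M N : ModuleCat.{u} S} (g : M ⟶ N) (hg : IsIso ((P.totalHomology k).map g)) :
    IsIso ((toHo S).map g) := by
  let g' : M ⊞ Projective.over N ⟶ N := biprod.desc g (Projective.π N)
  have hgg' : biprod.inl ≫ g' = g := biprod.inl_desc _ _
  have : Epi (biprod.inr ≫ g') := by rw [biprod.inr_desc]; infer_instance
  have : Epi g' := epi_of_epi biprod.inr g'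
  have : IsIso ((P.totalHomology k).map (biprod.inl : M ⟶ M ⊞ Projective.over N)) :=
    totalHomology_inverts k _ (.of _ <| .inr ⟨inferInstance, isTrivialModule_of_iso
      cokernelBiprodInlIso.symm (isTrivialModule_of_projective (Projective.over N))⟩)
  have : IsIso ((P.totalHomology k).map g') := by
    rw [← hgg', Functor.map_comp] at hg
    exact IsIso.of_isIso_comp_left ((P.totalHomology k).map biprod.inl) _
  have : IsIso ((toHo S).map g') := isIso_toHo_map_of_basic
    (.inl ⟨inferInstance, hP _ (isExact_X₁ k (shortExact_kernel g') this)⟩)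
  rw [← hgg', Functor.map_comp]
  infer_instance

end PeriodicPair

/-! ### The cosyzygy functor shifts the homology -/

section VectorSpace

variable {k V W U : Type*} [Field k] [AddCommGroup V] [Module k V] [AddCommGroup W] [Module k W]
  [AddCommGroup U] [Module k U]

theorem LinearMap.exists_comp_eq_of_ker_le_ker {ρ : V →ₗ[k] W} {φ : V →ₗ[k] U}
    (h : LinearMap.ker ρ ≤ LinearMap.ker φ) : ∃ g : W →ₗ[k] U, g ∘ₗ ρ = φ := by
  obtain ⟨l, hl⟩ := ((LinearMap.ker ρ).liftQ ρ le_rfl).exists_leftInverse_of_injective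
    (Submodule.ker_liftQ_eq_bot _ _ _ le_rfl)
  refine ⟨(LinearMap.ker ρ).liftQ φ h ∘ₗ l, LinearMap.ext fun v => ?_⟩
  have := LinearMap.congr_fun hl ((LinearMap.ker ρ).mkQ v)
  simp only [LinearMap.comp_apply, Submodule.mkQ_apply, Submodule.liftQ_apply,
    LinearMap.id_apply] at this ⊢
  rw [this, Submodule.liftQ_apply]

theorem LinearMap.exists_comp_eq_of_range_le_range {ρ : V →ₗ[k] W} {φ : U →ₗ[k] W}
    (h : LinearMap.range φ ≤ LinearMap.range ρ) : ∃ g : U →ₗ[k] V, ρ ∘ₗ g = φ := by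
  obtain ⟨g, hg⟩ := Module.projective_lifting_property ρ.rangeRestrict
    (φ.codRestrict (LinearMap.range ρ) fun u => h ⟨u, rfl⟩) ρ.surjective_rangeRestrict
  exact ⟨g, LinearMap.ext fun u => congrArg Subtype.val (LinearMap.congr_fun hg u)⟩

end VectorSpace

namespace PeriodicPair

open scoped ModuleCat

variable {k : Type u} [Field k] {S : Type u} [Ring S] [Algebra k S] {P : PeriodicPair S}

/-- Exactness of the complex of left ideals makes `Hom_k(S, M)` exact: `c • g = φ` means that the
linear form `φ` on `S` is `g` composed with right multiplication by `c`. -/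
theorem exists_smul_eq_of_coind {M : ModuleCat.{u} S} (φ : (coind k S).obj M)
    (he : P.e • φ = φ) (hd : P.d • φ = 0) : ∃ g : (coind k S).obj M, P.c • g = φ := by
  let X := (ModuleCat.restrictScalars.{u} (algebraMap k S)).obj (ModuleCat.of S S)
  let E := ModuleCat.CoextendScalars.equiv (algebraMap k S)
    ((ModuleCat.restrictScalars (algebraMap k S)).obj M)
  let ρ : X →ₗ[k] X :=
    { toFun := fun t : S => (t * P.c : S)
      map_add' := fun a b : S => add_mul a b P.c
      map_smul' := fun r (t : S) => mul_assoc (algebraMap k S r) t P.c }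
  obtain ⟨g, hg⟩ := LinearMap.exists_comp_eq_of_ker_le_ker (ρ := ρ) (φ := E φ) <| by
    intro (t : S) (ht : t * P.c = 0)
    obtain ⟨t', ht'⟩ := P.exact_right t ht
    have h₁ : E φ (t * P.e : S) = E φ t := LinearMap.congr_fun (congrArg E he) t
    have h₂ : E φ (t' * P.d : S) = 0 := LinearMap.congr_fun (congrArg E hd) t'
    change E φ t = 0
    rw [← h₁, ← ht', h₂]
  exact ⟨E.symm g, E.injective hg⟩

theorem isExact_coind (M : ModuleCat.{u} S) : P.IsExact ((coind k S).obj M) :=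
  ⟨exists_smul_eq_of_coind, exists_smul_eq_of_coind (P := P.swap)⟩

theorem toCoind_injective (M : ModuleCat.{u} S) :
    Function.Injective ((toCoind k S).app M).hom := by
  intro a b h
  have := LinearMap.congr_fun (congrArg (ModuleCat.CoextendScalars.equiv (algebraMap k S)
    ((ModuleCat.restrictScalars (algebraMap k S)).obj M)) h) (1 : S)
  exact (one_smul S a).symm.trans (this.trans (one_smul S b))

instance (M : ModuleCat.{u} S) : Mono ((toCoind k S).app M) :=
  (ModuleCat.mono_iff_injective _).2 (toCoind_injective M)

/-- The short exact sequence `0 → M → Hom_k(S, M) → ΣM → 0`. -/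
abbrev coindSequence (M : ModuleCat.{u} S) : ShortComplex (ModuleCat.{u} S) :=
  ShortComplex.mk ((toCoind k S).app M) (cokernel.π ((toCoind k S).app M)) (cokernel.condition _)

theorem coindSequence_shortExact (M : ModuleCat.{u} S) : (coindSequence (k := k) M).ShortExact :=
  shortExact_cokernel _

variable (k P) in
/-- The connecting homomorphism of a short exact sequence in the category of modules. -/
def connectingHom {E : ShortComplex (ModuleCat.{u} S)} (hE : E.ShortExact) :
    (P.homologyFunctor k).obj E.X₃ ⟶ (P.swap.homologyFunctor k).obj E.X₁ :=
  ModuleCat.ofHom (P.connecting k hE.moduleCat_injective_f hE.moduleCat_surjective_g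
    ((ShortComplex.ShortExact.moduleCat_exact_iff_function_exact E).1 hE.exact))

theorem connectingHom_naturality {E E' : ShortComplex (ModuleCat.{u} S)} (hE : E.ShortExact)
    (hE' : E'.ShortExact) (φ : E ⟶ E') :
    connectingHom k P hE ≫ (P.swap.homologyFunctor k).map φ.τ₁ =
      (P.homologyFunctor k).map φ.τ₃ ≫ connectingHom k P hE' := by
  refine ModuleCat.hom_ext (LinearMap.ext fun x => ?_)
  refine mapHomology_connecting hE.moduleCat_injective_f hE.moduleCat_surjective_g
    ((ShortComplex.ShortExact.moduleCat_exact_iff_function_exact E).1 hE.exact)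
    hE'.moduleCat_injective_f hE'.moduleCat_surjective_g
    ((ShortComplex.ShortExact.moduleCat_exact_iff_function_exact E').1 hE'.exact)
    (b := φ.τ₂.hom) ?_ ?_ x
  · exact congrArg ModuleCat.Hom.hom φ.comm₁₂.symm
  · exact congrArg ModuleCat.Hom.hom φ.comm₂₃.symm

variable (k P) in
/-- The homology of `ΣM` at `eΣM` is the homology of `M` at `fM`. -/
def homologyCosyzygyIso :
    cosyzygy k S ⋙ P.homologyFunctor k ≅ P.swap.homologyFunctor k :=
  NatIso.ofComponents (fun M => by
    have := ((isExact_iff k).1 (isExact_coind (k := k) (P := P) M)).1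
    have := ((isExact_iff k).1 (isExact_coind (k := k) (P := P) M)).2
    exact (LinearEquiv.ofBijective (P.connecting k _ _ _) (bijective_connecting
      (coindSequence_shortExact M).moduleCat_injective_f
      (coindSequence_shortExact M).moduleCat_surjective_g
      ((ShortComplex.ShortExact.moduleCat_exact_iff_function_exact _).1
        (coindSequence_shortExact (k := k) M).exact))).toModuleIso)
    fun {M N} φ => (connectingHom_naturality (coindSequence_shortExact (k := k) M)
      (coindSequence_shortExact (k := k) N)
      { τ₁ := φ
        τ₂ := (coind k S).map φ
        τ₃ := (cosyzygy k S).map φ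
        comm₁₂ := (toCoind k S).naturality φ
        comm₂₃ := (cokernel.π_desc _ _ _).symm }).symm

variable (k P) in
/-- The cosyzygy functor exchanges the two homology functors. -/
def totalHomologyCosyzygyIso :
    cosyzygy k S ⋙ P.totalHomology k ≅ P.totalHomology k ⋙ (modSqTriv k).shift :=
  NatIso.ofComponents (fun M => Iso.prod ((homologyCosyzygyIso k P).app M)
      ((homologyCosyzygyIso k P.swap).app M))
    fun φ => Prod.ext ((homologyCosyzygyIso k P).hom.naturality φ)
      ((homologyCosyzygyIso k P.swap).hom.naturality φ)

/-- If exact modules are trivial, then the cosyzygy functor descends to `Ho(S)`. -/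
theorem cosyzygyDescends (hP : ∀ M : ModuleCat.{u} S, P.IsExact M → IsTrivialModule S M) :
    CosyzygyDescends k S := by
  intro M N φ hφ
  refine isIso_toHo_map (k := k) hP _ ?_
  have := totalHomology_inverts (P := P) k φ hφ
  have := (NatIso.isIso_map_iff (totalHomologyCosyzygyIso k P) φ).2
    (inferInstanceAs (IsIso ((modSqTriv k).shift.map ((P.totalHomology k).map φ))))
  exact this

end PeriodicPair

/-! ### Modules representing the cycles -/

namespace PeriodicPair

open scoped ModuleCat

/-- `N` is cyclic, generated by a cycle `gen ∈ eN` which is universal (so that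
`N ≃ Se / Sd`), and its complex has homology `k · gen` at `eN` and none at `fN`. The homology is
described by `k`-linear maps, so that this persists for `N ⊗[k] V`. -/
structure Generator (k : Type u) [Field k] {S : Type u} [Ring S] [Algebra k S]
    (P : PeriodicPair S) (N : Type u) [AddCommGroup N] [Module k N] [Module S N] where
  gen : N
  e_smul_gen : P.e • gen = gen
  d_smul_gen : P.d • gen = 0
  exists_smul : ∀ x : N, ∃ s : S, s • gen = x
  exists_lift : ∀ {M : Type u} [AddCommGroup M] [Module S M] (m : M), P.e • m = m →
    P.d • m = 0 → ∃ φ : N →ₗ[S] M, φ gen = m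
  coeff : N →ₗ[k] k
  coeff_gen : coeff gen = 1
  coeff_c_smul : ∀ x : N, coeff (P.c • x) = 0
  exists_decomp : ∀ x : N, ∃ y : N, x = coeff x • gen + P.c • y
  retraction : N →ₗ[k] N
  retraction_c_smul : ∀ x : N, retraction (P.c • x) = P.f • x

namespace Generator

variable {k : Type u} [Field k] {S : Type u} [Ring S] [Algebra k S] {P : PeriodicPair S}
  {N : Type u} [AddCommGroup N] [Module k N] [Module S N] [IsScalarTower k S N]
  (G : P.Generator k N) {V : Type u} [AddCommGroup V] [Module k V]
  {M : Type u} [AddCommGroup M] [Module k M] [Module S M] [IsScalarTower k S M]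

omit [Module k M] [IsScalarTower k S M] in
include G in
theorem tensor_ext {φ ψ : N ⊗[k] V →ₗ[S] M}
    (h : ∀ v : V, φ (G.gen ⊗ₜ v) = ψ (G.gen ⊗ₜ v)) : φ = ψ := by
  refine LinearMap.ext fun x => ?_
  induction x with
  | zero => rw [map_zero, map_zero]
  | add x y hx hy => rw [map_add, map_add, hx, hy]
  | tmul n v =>
    obtain ⟨s, rfl⟩ := G.exists_smul n
    rw [← TensorProduct.smul_tmul', map_smul, map_smul, h]

/-- The universal property of `N ⊗[k] V`: it is the universal property of `N` for maps to the
`S`-module of `k`-linear maps from `V` to `M`. -/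
theorem exists_tensor_lift (α : V →ₗ[k] M) (h : ∀ v, α v ∈ P.cycles k M) :
    ∃ φ : N ⊗[k] V →ₗ[S] M, ∀ v, φ (G.gen ⊗ₜ v) = α v := by
  obtain ⟨φ, hφ⟩ := G.exists_lift (M := V →ₗ[k] M) α
    (LinearMap.ext fun v => (h v).1) (LinearMap.ext fun v => (h v).2)
  exact ⟨TensorProduct.AlgebraTensorModule.lift φ, fun v => by
    rw [TensorProduct.AlgebraTensorModule.lift_tmul, hφ]⟩

variable (V)

/-- The class of `gen ⊗ v`. -/
def toHomology : V →ₗ[k] P.Homology k (N ⊗[k] V) :=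
  P.cls k ∘ₗ LinearMap.codRestrict (P.cycles k (N ⊗[k] V)) (TensorProduct.mk k N V G.gen)
    fun v => ⟨congrArg (· ⊗ₜ[k] v) G.e_smul_gen,
      (congrArg (· ⊗ₜ[k] v) G.d_smul_gen).trans (TensorProduct.zero_tmul _ _)⟩

theorem toHomology_bijective : Function.Bijective (G.toHomology V) := by
  let l : N ⊗[k] V →ₗ[k] V := TensorProduct.lid k V ∘ₗ G.coeff.rTensor V
  have hl (n : N) (v : V) : l (n ⊗ₜ v) = G.coeff n • v := by simp [l]
  constructor
  · rw [injective_iff_map_eq_zero]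
    intro v hv
    obtain ⟨x, hx⟩ := cls_eq_zero.1 hv
    have hlx (x : N ⊗[k] V) : l (P.c • x) = 0 := by
      induction x with
      | zero => rw [smul_zero, map_zero]
      | add x y hx hy => rw [smul_add, map_add, hx, hy, add_zero]
      | tmul n v => rw [TensorProduct.smul_tmul', hl, G.coeff_c_smul, zero_smul]
    have h₁ : l (G.gen ⊗ₜ v) = v := by rw [hl, G.coeff_gen, one_smul]
    rw [← h₁, ← hlx x, hx]
    rfl
  · intro y
    obtain ⟨z, rfl⟩ := cls_surjective y
    have hdec (x : N ⊗[k] V) : ∃ y : N ⊗[k] V, P.c • y = G.gen ⊗ₜ l x - x := by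
      induction x with
      | zero => exact ⟨0, by simp⟩
      | add x y hx hy =>
        obtain ⟨x', hx'⟩ := hx
        obtain ⟨y', hy'⟩ := hy
        exact ⟨x' + y', by rw [smul_add, hx', hy', map_add, TensorProduct.tmul_add]; abel⟩
      | tmul n v =>
        obtain ⟨y, hy⟩ := G.exists_decomp n
        refine ⟨(-y) ⊗ₜ v, ?_⟩
        rw [hl, TensorProduct.smul_tmul', TensorProduct.tmul_smul, TensorProduct.smul_tmul',
          ← TensorProduct.sub_tmul]
        nth_rw 2 [hy]
        simp
    exact ⟨l z, cls_eq.2 (hdec z)⟩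

theorem subsingleton_swap_homology (G : P.Generator k N) :
    Subsingleton (P.swap.Homology k (N ⊗[k] V)) := by
  rw [subsingleton_homology_iff]
  intro x (hf : P.f • x = x) (hc : P.c • x = 0)
  have hr (x : N ⊗[k] V) : G.retraction.rTensor V (P.c • x) = P.f • x := by
    induction x with
    | zero => rw [smul_zero, smul_zero, map_zero]
    | add x y hx hy => rw [smul_add, map_add, hx, hy, smul_add]
    | tmul n v => rw [TensorProduct.smul_tmul', LinearMap.rTensor_tmul, G.retraction_c_smul,
        TensorProduct.smul_tmul']
  exact ⟨0, by rw [smul_zero, ← hf, ← hr, hc, map_zero]⟩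

end Generator

/-! ### The functor `(V₁, V₂) ↦ (N₁ ⊗ V₁) ⊕ (N₂ ⊗ V₂)` -/

section TensorSum

variable {k : Type u} [Field k] {S : Type u} [Ring S] [Algebra k S] {P : PeriodicPair S}
  {N₁ : Type u} [AddCommGroup N₁] [Module k N₁] [Module S N₁] [IsScalarTower k S N₁]
  {N₂ : Type u} [AddCommGroup N₂] [Module k N₂] [Module S N₂] [IsScalarTower k S N₂]
  (G₁ : P.Generator k N₁) (G₂ : P.swap.Generator k N₂)

/-- The homology of `(N₁ ⊗ V₁) ⊕ (N₂ ⊗ V₂)` at `e` is `V₁`. -/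
def homologyTensorSumEquiv₁ (V : ModuleCat.{u} k × ModuleCat.{u} k) :
    V.1 ≃ₗ[k] P.Homology k ((tensorSum k S N₁ N₂).obj V) :=
  LinearEquiv.ofBijective (P.mapHomology k (N := (tensorSum k S N₁ N₂).obj V)
    (LinearMap.inl S (N₁ ⊗[k] V.1) (N₂ ⊗[k] V.2)) ∘ₗ G₁.toHomology V.1) <| by
      have : Subsingleton (P.Homology k (N₂ ⊗[k] V.2)) := G₂.subsingleton_swap_homology V.2
      let X := (tensorSum k S N₁ N₂).obj V
      let i₁ : N₁ ⊗[k] V.1 →ₗ[S] X := LinearMap.inl S (N₁ ⊗[k] V.1) (N₂ ⊗[k] V.2)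
      let i₂ : N₂ ⊗[k] V.2 →ₗ[S] X := LinearMap.inr S (N₁ ⊗[k] V.1) (N₂ ⊗[k] V.2)
      let p₁ : X →ₗ[S] N₁ ⊗[k] V.1 := LinearMap.fst S (N₁ ⊗[k] V.1) (N₂ ⊗[k] V.2)
      let p₂ : X →ₗ[S] N₂ ⊗[k] V.2 := LinearMap.snd S (N₁ ⊗[k] V.1) (N₂ ⊗[k] V.2)
      exact (bijective_mapHomology_of_split (P := P) (φ := i₁) (π := p₁) (ψ := i₂)
        (π' := p₂) (LinearMap.ext fun _ => rfl)
        (LinearMap.ext fun x => Prod.ext (add_zero x.1) (zero_add x.2))).comp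
          (G₁.toHomology_bijective V.1)

/-- The homology of `(N₁ ⊗ V₁) ⊕ (N₂ ⊗ V₂)` at `f` is `V₂`. -/
def homologyTensorSumEquiv₂ (V : ModuleCat.{u} k × ModuleCat.{u} k) :
    V.2 ≃ₗ[k] P.swap.Homology k ((tensorSum k S N₁ N₂).obj V) :=
  LinearEquiv.ofBijective (P.swap.mapHomology k (N := (tensorSum k S N₁ N₂).obj V)
    (LinearMap.inr S (N₁ ⊗[k] V.1) (N₂ ⊗[k] V.2)) ∘ₗ G₂.toHomology V.2) <| by
      have : Subsingleton (P.swap.Homology k (N₁ ⊗[k] V.1)) := G₁.subsingleton_swap_homology V.1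
      let X := (tensorSum k S N₁ N₂).obj V
      let i₁ : N₁ ⊗[k] V.1 →ₗ[S] X := LinearMap.inl S (N₁ ⊗[k] V.1) (N₂ ⊗[k] V.2)
      let i₂ : N₂ ⊗[k] V.2 →ₗ[S] X := LinearMap.inr S (N₁ ⊗[k] V.1) (N₂ ⊗[k] V.2)
      let p₁ : X →ₗ[S] N₁ ⊗[k] V.1 := LinearMap.fst S (N₁ ⊗[k] V.1) (N₂ ⊗[k] V.2)
      let p₂ : X →ₗ[S] N₂ ⊗[k] V.2 := LinearMap.snd S (N₁ ⊗[k] V.1) (N₂ ⊗[k] V.2)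
      exact (bijective_mapHomology_of_split (P := P.swap) (φ := i₂) (π := p₂) (ψ := i₁)
        (π' := p₁) (LinearMap.ext fun _ => rfl)
        (LinearMap.ext fun x => Prod.ext (zero_add x.1) (add_zero x.2))).comp
          (G₂.toHomology_bijective V.2)

/-- The total homology of `(N₁ ⊗ V₁) ⊕ (N₂ ⊗ V₂)` is `(V₁, V₂)`. -/
def totalHomologyTensorSumIso :
    𝟭 (ModuleCat.{u} k × ModuleCat.{u} k) ≅ tensorSum k S N₁ N₂ ⋙ P.totalHomology k :=
  NatIso.ofComponents (fun V => Iso.prod (homologyTensorSumEquiv₁ G₁ G₂ V).toModuleIso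
      (homologyTensorSumEquiv₂ G₁ G₂ V).toModuleIso) fun {V W} φ => by
    refine Prod.ext ?_ ?_
    · refine ModuleCat.hom_ext (LinearMap.ext fun v => congrArg (P.cls k) (Subtype.ext ?_))
      exact Prod.ext rfl (map_zero (TensorProduct.AlgebraTensorModule.map
        (LinearMap.id : N₂ →ₗ[S] N₂) φ.2.hom)).symm
    · refine ModuleCat.hom_ext (LinearMap.ext fun v => congrArg (P.swap.cls k) (Subtype.ext ?_))
      exact Prod.ext (map_zero (TensorProduct.AlgebraTensorModule.map
        (LinearMap.id : N₁ →ₗ[S] N₁) φ.1.hom)).symm rfl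

/-- Every module `M` receives a map from `(N₁ ⊗ V₁) ⊕ (N₂ ⊗ V₂)`, where `(V₁, V₂)` is its homology,
which is the canonical isomorphism on homology: lift a choice of cycles representing the homology
classes. -/
theorem exists_comparison (M : ModuleCat.{u} S) :
    ∃ j : (tensorSum k S N₁ N₂).obj ((P.totalHomology k).obj M) ⟶ M,
      (totalHomologyTensorSumIso G₁ G₂).hom.app ((P.totalHomology k).obj M) ≫
        (P.totalHomology k).map j = 𝟙 _ := by
  obtain ⟨σ₁, hσ₁⟩ := (P.cls k (M := M)).exists_rightInverse_of_surjective
    (LinearMap.range_eq_top.2 cls_surjective)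
  obtain ⟨σ₂, hσ₂⟩ := (P.swap.cls k (M := M)).exists_rightInverse_of_surjective
    (LinearMap.range_eq_top.2 cls_surjective)
  obtain ⟨j₁, hj₁⟩ := G₁.exists_tensor_lift (Submodule.subtype _ ∘ₗ σ₁) fun v => (σ₁ v).2
  obtain ⟨j₂, hj₂⟩ := G₂.exists_tensor_lift (Submodule.subtype _ ∘ₗ σ₂) fun v => (σ₂ v).2
  refine ⟨ModuleCat.ofHom (j₁.coprod j₂), Prod.ext ?_ ?_⟩
  · refine ModuleCat.hom_ext (LinearMap.ext fun v => Eq.trans ?_ (LinearMap.congr_fun hσ₁ v))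
    refine congrArg (P.cls k) (Subtype.ext ?_)
    exact (congrArg (j₁ (G₁.gen ⊗ₜ v) + ·) (map_zero j₂)).trans ((add_zero _).trans (hj₁ v))
  · refine ModuleCat.hom_ext (LinearMap.ext fun v => Eq.trans ?_ (LinearMap.congr_fun hσ₂ v))
    refine congrArg (P.swap.cls k) (Subtype.ext ?_)
    exact (congrArg (· + j₂ (G₂.gen ⊗ₜ v)) (map_zero j₁)).trans ((zero_add _).trans (hj₂ v))

/-- A map out of `N ⊗ V` which vanishes on homology factors through the free module `S ⊗ V`. -/
theorem Generator.exists_factor {N : Type u} [AddCommGroup N] [Module k N] [Module S N]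
    [IsScalarTower k S N] (G : P.Generator k N) {V M : Type u} [AddCommGroup V] [Module k V]
    [AddCommGroup M] [Module k M] [Module S M] [IsScalarTower k S M] (φ : N ⊗[k] V →ₗ[S] M)
    (h : ∀ v, ∃ m : M, P.c • m = φ (G.gen ⊗ₜ v)) :
    ∃ (i : N ⊗[k] V →ₗ[S] S ⊗[k] V) (q : S ⊗[k] V →ₗ[S] M), q ∘ₗ i = φ := by
  obtain ⟨ι, hι⟩ := G.exists_lift P.c P.e_mul_c P.d_mul_c
  obtain ⟨w, hw⟩ := LinearMap.exists_comp_eq_of_range_le_range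
    (ρ := DistribSMul.toLinearMap k M P.c) (φ := φ.restrictScalars k ∘ₗ TensorProduct.mk k N V G.gen)
    (by rintro _ ⟨v, rfl⟩; exact h v)
  refine ⟨TensorProduct.AlgebraTensorModule.map ι LinearMap.id,
    TensorProduct.AlgebraTensorModule.lift (LinearMap.toSpanSingleton S (V →ₗ[k] M) w),
    G.tensor_ext fun v => ?_⟩
  rw [LinearMap.comp_apply, TensorProduct.AlgebraTensorModule.map_tmul, hι,
    TensorProduct.AlgebraTensorModule.lift_tmul]
  exact LinearMap.congr_fun hw v

include G₁ G₂ in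
/-- Maps out of `(N₁ ⊗ V₁) ⊕ (N₂ ⊗ V₂)` which agree on homology agree in `Ho(S)`. -/
theorem toHo_map_eq_of_totalHomology_map_eq {V : ModuleCat.{u} k × ModuleCat.{u} k}
    {M : ModuleCat.{u} S} {a b : (tensorSum k S N₁ N₂).obj V ⟶ M}
    (h : (P.totalHomology k).map a = (P.totalHomology k).map b) :
    (toHo S).map a = (toHo S).map b := by
  let ψ : (N₁ ⊗[k] V.1) × (N₂ ⊗[k] V.2) →ₗ[S] M := a.hom - b.hom
  have h₁ : P.mapHomology k (a - b).hom = 0 := by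
    rw [ModuleCat.hom_sub, mapHomology_sub, sub_eq_zero]
    exact congrArg (fun t => ModuleCat.Hom.hom (Prod.fst t)) h
  have h₂ : P.swap.mapHomology k (a - b).hom = 0 := by
    rw [ModuleCat.hom_sub, mapHomology_sub, sub_eq_zero]
    exact congrArg (fun t => ModuleCat.Hom.hom (Prod.snd t)) h
  obtain ⟨i₁, q₁, hq₁⟩ := G₁.exists_factor (ψ ∘ₗ LinearMap.inl S _ _) fun v =>
    cls_eq_zero.1 (LinearMap.congr_fun h₁ (homologyTensorSumEquiv₁ G₁ G₂ V v))
  obtain ⟨i₂, q₂, hq₂⟩ := G₂.exists_factor (ψ ∘ₗ LinearMap.inr S _ _) fun v =>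
    cls_eq_zero.1 (LinearMap.congr_fun h₂ (homologyTensorSumEquiv₂ G₁ G₂ V v))
  have hproj : Projective (ModuleCat.of S ((S ⊗[k] V.1) × (S ⊗[k] V.2))) := by
    rw [← IsProjective.iff_projective]
    infer_instance
  refine toHo_map_eq_of_sub_eq (P := ModuleCat.of S ((S ⊗[k] V.1) × (S ⊗[k] V.2)))
    (ModuleCat.ofHom (i₁.prodMap i₂)) (ModuleCat.ofHom (q₁.coprod q₂)) (ModuleCat.hom_ext ?_)
  refine LinearMap.ext fun (x : (N₁ ⊗[k] V.1) × (N₂ ⊗[k] V.2)) => ?_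
  change ψ x = q₁ (i₁ x.1) + q₂ (i₂ x.2)
  rw [← LinearMap.comp_apply q₁, ← LinearMap.comp_apply q₂, hq₁, hq₂]
  simp only [LinearMap.comp_apply]
  rw [← map_add]
  exact congrArg ψ (Prod.ext (add_zero x.1).symm (zero_add x.2).symm)

end TensorSum

end PeriodicPair

/-! ### Triangle equivalences -/

/-- The distinguished triangles are stable under isomorphism. -/
def TriangleData.IsoStable {C : Type*} [Category C] (T : TriangleData C) : Prop :=
  ∀ {X Y Z X' Y' Z' : C} {f : X ⟶ Y} {g : Y ⟶ Z} {h : Z ⟶ T.shift.obj X}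
    {f' : X' ⟶ Y'} {g' : Y' ⟶ Z'} {h' : Z' ⟶ T.shift.obj X'} (x : X ≅ X') (y : Y ≅ Y')
    (z : Z ≅ Z'), f ≫ y.hom = x.hom ≫ f' → g ≫ z.hom = y.hom ≫ g' →
    h ≫ T.shift.map x.hom = z.hom ≫ h' → T.distinguished f g h → T.distinguished f' g' h'

/-- An equivalence `F` is a triangle equivalence as soon as it has a quasi-inverse `G` which commutes
with the shifts and detects distinguished triangles. -/
theorem isTriangleEquivalence_of_quasiInverse {C D : Type*} [Category C] [Category D]
    {TC : TriangleData C} {TD : TriangleData D} (hTC : TC.IsoStable) (F : C ⥤ D) [F.IsEquivalence]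
    (G : D ⥤ C) [G.IsEquivalence] (η : 𝟭 C ≅ F ⋙ G) (ψ : TD.shift ⋙ G ≅ G ⋙ TC.shift)
    (hG : ∀ {X Y Z : D} (f : X ⟶ Y) (g : Y ⟶ Z) (h : Z ⟶ TD.shift.obj X),
      TD.distinguished f g h ↔
        TC.distinguished (G.map f) (G.map g) (G.map h ≫ ψ.hom.app X)) :
    IsTriangleEquivalence TC TD F := by
  let φ₀ : (TC.shift ⋙ F) ⋙ G ≅ (F ⋙ TD.shift) ⋙ G :=
    Functor.associator _ _ _ ≪≫ Functor.isoWhiskerLeft TC.shift η.symm ≪≫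
      (Functor.rightUnitor _ ≪≫ (Functor.leftUnitor _).symm) ≪≫
      Functor.isoWhiskerRight η TC.shift ≪≫ Functor.associator _ _ _ ≪≫
      Functor.isoWhiskerLeft F ψ.symm ≪≫ (Functor.associator _ _ _).symm
  have hφ₀ (X : C) : φ₀.hom.app X =
      η.inv.app (TC.shift.obj X) ≫ TC.shift.map (η.hom.app X) ≫ ψ.inv.app (F.obj X) := by
    simp [φ₀]
  let φ : TC.shift ⋙ F ≅ F ⋙ TD.shift :=
    NatIso.ofComponents (fun X => G.preimageIso (φ₀.app X)) fun {X Y} f => G.map_injective <| by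
      simpa using φ₀.hom.naturality f
  have hφ (X : C) : G.map (φ.hom.app X) ≫ ψ.hom.app (F.obj X) =
      η.inv.app (TC.shift.obj X) ≫ TC.shift.map (η.hom.app X) := by
    simp [φ, hφ₀]
  refine ⟨inferInstance, φ, fun {X Y Z} f g h => ?_⟩
  rw [hG, Functor.map_comp, Category.assoc, hφ]
  have nat {X Y : C} (f : X ⟶ Y) : f ≫ η.hom.app Y = η.hom.app X ≫ G.map (F.map f) :=
    η.hom.naturality f
  have nat' {X Y : C} (f : X ⟶ Y) : G.map (F.map f) ≫ η.inv.app Y = η.inv.app X ≫ f :=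
    η.inv.naturality f
  constructor
  · refine hTC (η.app X) (η.app Y) (η.app Z) (nat f) (nat g) ?_
    rw [reassoc_of% (nat' h)]
    simp
  · refine hTC (η.app X).symm (η.app Y).symm (η.app Z).symm (nat' f) (nat' g) ?_
    rw [reassoc_of% (nat' h)]
    simp [← Functor.map_comp]

/-! ### Distinguished triangles of pairs of vector spaces -/

section ModSq

variable {k : Type u} [Field k]

theorem range_eq_ker_of_iso {A B C A' B' C' : ModuleCat.{u} k} {f : A ⟶ B} {g : B ⟶ C}
    {f' : A' ⟶ B'} {g' : B' ⟶ C'} (a : A ≅ A') (b : B ≅ B') (c : C ≅ C')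
    (hf : f ≫ b.hom = a.hom ≫ f') (hg : g ≫ c.hom = b.hom ≫ g')
    (h : LinearMap.range f.hom = LinearMap.ker g.hom) :
    LinearMap.range f'.hom = LinearMap.ker g'.hom := by
  rw [eq_comm, ← LinearMap.exact_iff] at h ⊢
  refine (Function.Exact.iff_of_ladder_linearEquiv (e₁ := a.toLinearEquiv)
    (e₂ := b.toLinearEquiv) (e₃ := c.toLinearEquiv) ?_ ?_).2 h
  · exact congrArg ModuleCat.Hom.hom hf.symm
  · exact congrArg ModuleCat.Hom.hom hg.symm

theorem modSqTriv_isoStable : (modSqTriv k).IsoStable := by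
  intro X Y Z X' Y' Z' f g h f' g' h' x y z hf hg hh H
  have e {U V : ModuleCat.{u} k × ModuleCat.{u} k} (t : U ≅ V) : ∃ (t₁ : U.1 ≅ V.1)
      (t₂ : U.2 ≅ V.2), t₁.hom = t.hom.1 ∧ t₂.hom = t.hom.2 :=
    ⟨(CategoryTheory.Prod.fst _ _).mapIso t, (CategoryTheory.Prod.snd _ _).mapIso t, rfl, rfl⟩
  obtain ⟨x₁, x₂, hx₁, hx₂⟩ := e x
  obtain ⟨y₁, y₂, hy₁, hy₂⟩ := e y
  obtain ⟨z₁, z₂, hz₁, hz₂⟩ := e z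
  have hf₁ : f.1 ≫ y₁.hom = x₁.hom ≫ f'.1 := by rw [hx₁, hy₁]; exact congrArg (·.1) hf
  have hf₂ : f.2 ≫ y₂.hom = x₂.hom ≫ f'.2 := by rw [hx₂, hy₂]; exact congrArg (·.2) hf
  have hg₁ : g.1 ≫ z₁.hom = y₁.hom ≫ g'.1 := by rw [hz₁, hy₁]; exact congrArg (·.1) hg
  have hg₂ : g.2 ≫ z₂.hom = y₂.hom ≫ g'.2 := by rw [hz₂, hy₂]; exact congrArg (·.2) hg
  have hh₁ : h.1 ≫ x₂.hom = z₁.hom ≫ h'.1 := by rw [hx₂, hz₁]; exact congrArg (·.1) hh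
  have hh₂ : h.2 ≫ x₁.hom = z₂.hom ≫ h'.2 := by rw [hx₁, hz₂]; exact congrArg (·.2) hh
  exact ⟨⟨range_eq_ker_of_iso x₁ y₁ z₁ hf₁ hg₁ H.1.1, range_eq_ker_of_iso x₂ y₂ z₂ hf₂ hg₂ H.1.2⟩,
    ⟨range_eq_ker_of_iso y₁ z₁ x₂ hg₁ hh₁ H.2.1.1, range_eq_ker_of_iso y₂ z₂ x₁ hg₂ hh₂ H.2.1.2⟩,
    ⟨range_eq_ker_of_iso z₁ x₂ y₂ hh₁ hf₂ H.2.2.1, range_eq_ker_of_iso z₂ x₁ y₁ hh₂ hf₁ H.2.2.2⟩⟩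

/-- Over a field, an extension of a subspace `im h` by a quotient `V / ker g` is determined up to
isomorphism. -/
theorem exists_linearEquiv_of_exact {V W Z Z' : Type*} [AddCommGroup V] [Module k V]
    [AddCommGroup W] [Module k W] [AddCommGroup Z] [Module k Z] [AddCommGroup Z'] [Module k Z']
    {g : V →ₗ[k] Z} {h : Z →ₗ[k] W} {g' : V →ₗ[k] Z'} {h' : Z' →ₗ[k] W}
    (hex : Function.Exact g h) (hex' : Function.Exact g' h')
    (hker : LinearMap.ker g = LinearMap.ker g') (hrange : LinearMap.range h = LinearMap.range h') :
    ∃ e : Z ≃ₗ[k] Z', (∀ v, e (g v) = g' v) ∧ ∀ w, h' (e w) = h w := by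
  -- a map over `W`, corrected by a map to `ker h'` so as to be a map under `V`
  obtain ⟨t, ht⟩ := LinearMap.exists_comp_eq_of_range_le_range (ρ := h') (φ := h) hrange.le
  replace ht (z : Z) : h' (t z) = h z := LinearMap.congr_fun ht z
  obtain ⟨t', ht'⟩ := LinearMap.exists_comp_eq_of_ker_le_ker (ρ := g)
    (φ := (g' - t ∘ₗ g).codRestrict (LinearMap.ker h') fun v => by
      simp [ht, hex.apply_apply_eq_zero, hex'.apply_apply_eq_zero]) (by
    intro v hv
    have hv' : g' v = 0 := hker.le hv
    rw [LinearMap.mem_ker] at hv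
    simp [hv, hv'])
  let e : Z →ₗ[k] Z' := t + Submodule.subtype _ ∘ₗ t'
  have heg (v : V) : e (g v) = g' v := by
    have := congrArg Subtype.val (LinearMap.congr_fun ht' v)
    simp only [LinearMap.comp_apply, LinearMap.codRestrict_apply, LinearMap.sub_apply] at this
    simp [e, this]
  have hhe (z : Z) : h' (e z) = h z := by
    have : h' (t' z) = 0 := (t' z).2
    simp [e, ht, this]
  refine ⟨LinearEquiv.ofBijective e ⟨?_, fun z' => ?_⟩, heg, hhe⟩
  · rw [injective_iff_map_eq_zero]
    intro z hz
    obtain ⟨v, rfl⟩ := (hex z).1 (by rw [← hhe, hz, map_zero])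
    exact hker.ge ((heg v).symm.trans hz)
  · obtain ⟨z, hz⟩ := hrange.ge ⟨z', rfl⟩
    obtain ⟨v, hv⟩ := (hex' (z' - e z)).1 (by rw [map_sub, hhe, hz, sub_self])
    exact ⟨z + g v, by rw [map_add, heg, hv, add_sub_cancel]⟩

/-- A distinguished triangle is determined up to isomorphism by its first morphism. -/
theorem modSqTriv_exists_iso {X Y Z Z' : ModuleCat.{u} k × ModuleCat.{u} k} {f : X ⟶ Y}
    {g : Y ⟶ Z} {h : Z ⟶ (modSqTriv k).shift.obj X} {g' : Y ⟶ Z'}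
    {h' : Z' ⟶ (modSqTriv k).shift.obj X} (H : (modSqTriv k).distinguished f g h)
    (H' : (modSqTriv k).distinguished f g' h') :
    ∃ z : Z ≅ Z', g ≫ z.hom = g' ∧ z.hom ≫ h' = h := by
  obtain ⟨e₁, he₁, he₁'⟩ := exists_linearEquiv_of_exact (LinearMap.exact_iff.2 H.2.1.1.symm)
    (LinearMap.exact_iff.2 H'.2.1.1.symm) (H.1.1.symm.trans H'.1.1)
    (H.2.2.1.trans H'.2.2.1.symm)
  obtain ⟨e₂, he₂, he₂'⟩ := exists_linearEquiv_of_exact (LinearMap.exact_iff.2 H.2.1.2.symm)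
    (LinearMap.exact_iff.2 H'.2.1.2.symm) (H.1.2.symm.trans H'.1.2)
    (H.2.2.2.trans H'.2.2.2.symm)
  exact ⟨Iso.prod e₁.toModuleIso e₂.toModuleIso,
    Prod.ext (ModuleCat.hom_ext (LinearMap.ext he₁)) (ModuleCat.hom_ext (LinearMap.ext he₂)),
    Prod.ext (ModuleCat.hom_ext (LinearMap.ext he₁')) (ModuleCat.hom_ext (LinearMap.ext he₂'))⟩

end ModSq

/-! ### Homology as an equivalence -/

namespace PeriodicPair

open scoped ModuleCat

section Equivalence

variable {k : Type u} [Field k] {S : Type u} [Ring S] [Algebra k S]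

variable (k) in
/-- The total homology as a functor on `Ho(S)`. -/
def hoHomology (P : PeriodicPair S) : Ho S ⥤ ModuleCat.{u} k × ModuleCat.{u} k :=
  Localization.Construction.lift (P.totalHomology k) (totalHomology_inverts k)

variable (k) in
/-- `hoHomology` extends the total homology. -/
def hoHomologyFac (P : PeriodicPair S) : toHo S ⋙ P.hoHomology k ≅ P.totalHomology k :=
  eqToIso (Localization.Construction.fac _ _)

instance (P : PeriodicPair S) : Localization.Lifting (toHo S) (weakEquivalences S)
    (P.totalHomology k) (P.hoHomology k) := ⟨P.hoHomologyFac k⟩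

variable {P : PeriodicPair S}
  {N₁ : Type u} [AddCommGroup N₁] [Module k N₁] [Module S N₁] [IsScalarTower k S N₁]
  {N₂ : Type u} [AddCommGroup N₂] [Module k N₂] [Module S N₂] [IsScalarTower k S N₂]
  (G₁ : P.Generator k N₁) (G₂ : P.swap.Generator k N₂)
  (hP : ∀ M : ModuleCat.{u} S, P.IsExact M → IsTrivialModule S M)

/-- A choice of comparison map from the tensor sum on the homology of `M` to `M`. -/
def comparison (M : ModuleCat.{u} S) :
    (tensorSum k S N₁ N₂).obj ((P.totalHomology k).obj M) ⟶ M :=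
  (exists_comparison G₁ G₂ M).choose

theorem comparison_spec (M : ModuleCat.{u} S) :
    (totalHomologyTensorSumIso G₁ G₂).hom.app ((P.totalHomology k).obj M) ≫
      (P.totalHomology k).map (comparison G₁ G₂ M) = 𝟙 _ :=
  (exists_comparison G₁ G₂ M).choose_spec

/-- The comparison maps become natural isomorphisms in `Ho(S)`. -/
def comparisonIso : P.totalHomology k ⋙ tensorSum k S N₁ N₂ ⋙ toHo S ≅ toHo S :=
  NatIso.ofComponents (fun M => by
    have h := comparison_spec G₁ G₂ M
    have : IsIso ((P.totalHomology k).map (comparison G₁ G₂ M)) := by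
      have := IsIso.of_isIso_fac_left h
      exact this
    have := isIso_toHo_map hP (comparison G₁ G₂ M) this
    exact asIso ((toHo S).map (comparison G₁ G₂ M))) fun {M N} φ => by
    change (toHo S).map _ ≫ (toHo S).map _ = (toHo S).map _ ≫ (toHo S).map _
    rw [← Functor.map_comp, ← Functor.map_comp]
    refine toHo_map_eq_of_totalHomology_map_eq G₁ G₂ ?_
    rw [← cancel_epi ((totalHomologyTensorSumIso G₁ G₂).hom.app ((P.totalHomology k).obj M)),
      Functor.map_comp, Functor.map_comp, reassoc_of% (comparison_spec G₁ G₂ M)]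
    have := (totalHomologyTensorSumIso G₁ G₂).hom.naturality ((P.totalHomology k).map φ)
    rw [Functor.id_map, Functor.comp_map] at this
    rw [← reassoc_of% this, comparison_spec]
    exact Category.comp_id _

/-- The homology of the tensor sum, in terms of `hoHomology`. -/
def hoUnitIso : 𝟭 _ ≅ (tensorSum k S N₁ N₂ ⋙ toHo S) ⋙ P.hoHomology k :=
  totalHomologyTensorSumIso G₁ G₂ ≪≫
    Functor.isoWhiskerLeft (tensorSum k S N₁ N₂) (P.hoHomologyFac k).symm ≪≫
    (Functor.associator _ _ _).symm

/-- Homology is quasi-inverse to the tensor sum. -/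
def hoEquivalence : ModuleCat.{u} k × ModuleCat.{u} k ≌ Ho S :=
  CategoryTheory.Equivalence.mk (tensorSum k S N₁ N₂ ⋙ toHo S) (P.hoHomology k)
    (hoUnitIso G₁ G₂) <|
    Localization.liftNatIso (toHo S) (weakEquivalences S)
      (P.totalHomology k ⋙ tensorSum k S N₁ N₂ ⋙ toHo S) (toHo S) _ _ (comparisonIso G₁ G₂ hP)

end Equivalence

end PeriodicPair

/-! ### Homology and distinguished triangles -/

namespace PeriodicPair

open scoped ModuleCat

variable {k : Type u} [Field k] {S : Type u} [Ring S] [Algebra k S] {P : PeriodicPair S}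
  {N₁ : Type u} [AddCommGroup N₁] [Module k N₁] [Module S N₁] [IsScalarTower k S N₁]
  {N₂ : Type u} [AddCommGroup N₂] [Module k N₂] [Module S N₂] [IsScalarTower k S N₂]

section Shift

variable (hS : CosyzygyDescends k S)

/-- `Q`, followed by the shift and by homology, is the homology of the cosyzygy. -/
def hoShiftHomologyFac :
    toHo S ⋙ hoShift hS ⋙ P.hoHomology k ≅ cosyzygy k S ⋙ P.totalHomology k :=
  (Functor.associator _ _ _).symm ≪≫ Functor.isoWhiskerRight (hoShiftIso hS) (P.hoHomology k) ≪≫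
    Functor.associator _ _ _ ≪≫ Functor.isoWhiskerLeft (cosyzygy k S) (P.hoHomologyFac k)

instance : Localization.Lifting (toHo S) (weakEquivalences S) (cosyzygy k S ⋙ P.totalHomology k)
    (hoShift hS ⋙ P.hoHomology k) := ⟨hoShiftHomologyFac hS⟩

/-- Homology commutes with the shifts. -/
def hoHomologyShiftIso : hoShift hS ⋙ P.hoHomology k ≅ P.hoHomology k ⋙ (modSqTriv k).shift :=
  Localization.liftNatIso (toHo S) (weakEquivalences S) (cosyzygy k S ⋙ P.totalHomology k)
    (P.totalHomology k ⋙ (modSqTriv k).shift) _ _ (totalHomologyCosyzygyIso k P)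

theorem hoHomologyShiftIso_hom_app (M : ModuleCat.{u} S) :
    (hoHomologyShiftIso (P := P) hS).hom.app ((toHo S).obj M) =
      (P.hoHomology k).map ((hoShiftIso hS).hom.app M) ≫
        (P.hoHomologyFac k).hom.app ((cosyzygy k S).obj M) ≫
        (totalHomologyCosyzygyIso k P).hom.app M ≫
        (modSqTriv k).shift.map ((P.hoHomologyFac k).inv.app M) := by
  refine (Localization.liftNatTrans_app _ _ _ _ _ _ _ _).trans ?_
  change (hoShiftHomologyFac hS).hom.app M ≫ _ ≫
    (modSqTriv k).shift.map ((P.hoHomologyFac k).inv.app M) = _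
  simp [hoShiftHomologyFac]

/-- The homology of the triangle of a short exact sequence is distinguished, by the long exact
sequence. -/
theorem distinguished_totalHomology {E : ShortComplex (ModuleCat.{u} S)} (hE : E.ShortExact)
    (b : E.X₂ ⟶ (coind k S).obj E.X₁) (δ : E.X₃ ⟶ (cosyzygy k S).obj E.X₁)
    (hb : E.f ≫ b = (toCoind k S).app E.X₁)
    (hδ : E.g ≫ δ = b ≫ cokernel.π ((toCoind k S).app E.X₁)) :
    (modSqTriv k).distinguished ((P.totalHomology k).map E.f) ((P.totalHomology k).map E.g)
      ((P.totalHomology k).map δ ≫ (totalHomologyCosyzygyIso k P).hom.app E.X₁) := by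
  have hex := (ShortComplex.ShortExact.moduleCat_exact_iff_function_exact E).1 hE.exact
  have key (P : PeriodicPair S) :
      (P.homologyFunctor k).map δ ≫ connectingHom k P (coindSequence_shortExact E.X₁) =
        connectingHom k P hE := by
    refine (connectingHom_naturality hE (coindSequence_shortExact E.X₁)
      { τ₁ := 𝟙 _, τ₂ := b, τ₃ := δ, comm₁₂ := ?_, comm₂₃ := hδ.symm }).symm.trans ?_
    · exact (Category.id_comp _).trans hb.symm
    · exact (congrArg (_ ≫ ·) (CategoryTheory.Functor.map_id _ _)).trans (Category.comp_id _)
  have h : (P.totalHomology k).map δ ≫ (totalHomologyCosyzygyIso k P).hom.app E.X₁ =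
      Prod.mkHom (connectingHom k P hE) (connectingHom k P.swap hE) :=
    Prod.ext (key P) (key P.swap)
  rw [h]
  have hinj := hE.moduleCat_injective_f
  have hsurj := hE.moduleCat_surjective_g
  have h₁ (P : PeriodicPair S) := (LinearMap.exact_iff.1
    (exact_mapHomology (k := k) (P := P) hinj hsurj hex)).symm
  have h₂ (P : PeriodicPair S) := (LinearMap.exact_iff.1
    (exact_mapHomology_connecting (k := k) (P := P) hinj hsurj hex)).symm
  have h₃ (P : PeriodicPair S) := (LinearMap.exact_iff.1
    (exact_connecting_mapHomology (k := k) (P := P) hinj hsurj hex)).symm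
  exact ⟨⟨h₁ P, h₁ P.swap⟩, ⟨h₂ P, h₂ P.swap⟩, ⟨h₃ P, h₃ P.swap⟩⟩

/-- The homology of a distinguished triangle of `Ho(S)` is distinguished. -/
theorem distinguished_hoHomology {X Y Z : Ho S} {f : X ⟶ Y} {g : Y ⟶ Z}
    {h : Z ⟶ (hoShift hS).obj X} (H : (hoTriangles hS).distinguished f g h) :
    (modSqTriv k).distinguished ((P.hoHomology k).map f) ((P.hoHomology k).map g)
      ((P.hoHomology k).map h ≫ (hoHomologyShiftIso hS).hom.app X) := by
  obtain ⟨E, hE, b, δ, hb, hδ, x, y, z, hf, hg, hh⟩ := H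
  let i {W : Ho S} {M : ModuleCat.{u} S} (t : W ≅ (toHo S).obj M) :
      (P.hoHomology k).obj W ≅ (P.totalHomology k).obj M :=
    (P.hoHomology k).mapIso t ≪≫ (P.hoHomologyFac k).app M
  have nat {M N : ModuleCat.{u} S} (φ : M ⟶ N) :
      (P.hoHomology k).map ((toHo S).map φ) ≫ (P.hoHomologyFac k).hom.app N =
        (P.hoHomologyFac k).hom.app M ≫ (P.totalHomology k).map φ :=
    (P.hoHomologyFac k).hom.naturality φ
  have sq {W W' : Ho S} {M N : ModuleCat.{u} S} {t : W ≅ (toHo S).obj M}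
      {t' : W' ≅ (toHo S).obj N} {a : W ⟶ W'} {φ : M ⟶ N}
      (h : a ≫ t'.hom = t.hom ≫ (toHo S).map φ) :
      (P.hoHomology k).map a ≫ (i t').hom = (i t).hom ≫ (P.totalHomology k).map φ := by
    simp only [i, Iso.trans_hom, Functor.mapIso_hom, Iso.app_hom, Category.assoc]
    rw [← nat, ← Functor.map_comp_assoc, h, Functor.map_comp_assoc]
  have key : (P.hoHomology k).map h ≫ (hoHomologyShiftIso hS).hom.app X ≫
      (modSqTriv k).shift.map (i x).hom =
        (i z).hom ≫ (P.totalHomology k).map δ ≫ (totalHomologyCosyzygyIso k P).hom.app E.X₁ := by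
    have nat' : (P.hoHomology k).map ((hoShift hS).map x.hom) ≫
        (hoHomologyShiftIso hS).hom.app ((toHo S).obj E.X₁) =
          (hoHomologyShiftIso hS).hom.app X ≫
            (modSqTriv k).shift.map ((P.hoHomology k).map x.hom) :=
      (hoHomologyShiftIso hS).hom.naturality x.hom
    simp only [i, Iso.trans_hom, Functor.mapIso_hom, Iso.app_hom, Functor.map_comp]
    rw [← reassoc_of% nat', ← Functor.map_comp_assoc, hh, hoHomologyShiftIso_hom_app]
    simp only [Functor.map_comp, Category.assoc]
    have e₁ : (P.hoHomology k).map ((hoShiftIso hS).inv.app E.X₁) ≫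
        (P.hoHomology k).map ((hoShiftIso hS).hom.app E.X₁) = 𝟙 _ := by
      rw [← Functor.map_comp, Iso.inv_hom_id_app, CategoryTheory.Functor.map_id]
    have e₂ : (modSqTriv k).shift.map ((P.hoHomologyFac k).inv.app E.X₁) ≫
        (modSqTriv k).shift.map ((P.hoHomologyFac k).hom.app E.X₁) = 𝟙 _ := by
      rw [← Functor.map_comp, Iso.inv_hom_id_app, CategoryTheory.Functor.map_id]
    rw [reassoc_of% e₁, e₂]
    exact congrArg ((P.hoHomology k).map z.hom ≫ ·) ((congrArg (_ ≫ _ ≫ ·)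
      (Category.comp_id _)).trans ((reassoc_of% (nat δ)) _))
  refine modSqTriv_isoStable (i x).symm (i y).symm (i z).symm ?_ ?_ ?_
    (distinguished_totalHomology hE b δ hb hδ)
  · rw [Iso.symm_hom, Iso.symm_hom, Iso.comp_inv_eq, Category.assoc, sq hf, Iso.inv_hom_id_assoc]
  · rw [Iso.symm_hom, Iso.symm_hom, Iso.comp_inv_eq, Category.assoc, sq hg, Iso.inv_hom_id_assoc]
  · rw [Iso.symm_hom, Iso.symm_hom, ← cancel_epi (i z).hom, Iso.hom_inv_id_assoc, Category.assoc,
      ← reassoc_of% key, ← Functor.map_comp, Iso.hom_inv_id]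
    simp

/-- The image in `Ho(S)` of a morphism of modules is part of a distinguished triangle: the morphism
may be replaced by an injection, by adding `Hom_k(S, -)` of its source to its target. -/
theorem exists_distinguished_map (hP : ∀ M : ModuleCat.{u} S, P.IsExact M → IsTrivialModule S M)
    {M N : ModuleCat.{u} S} (φ : M ⟶ N) :
    ∃ (Z : Ho S) (g : (toHo S).obj N ⟶ Z) (h : Z ⟶ (hoShift hS).obj ((toHo S).obj M)),
      (hoTriangles hS).distinguished ((toHo S).map φ) g h := by
  let C : ModuleCat.{u} S := (coind k S).obj M
  let ι : M ⟶ C := (toCoind k S).app M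
  have hι : Mono ι := inferInstanceAs (Mono ((toCoind k S).app M))
  have hC : IsTrivialModule S C := hP _ (isExact_coind M)
  let u : M ⟶ N ⊞ C := biprod.lift φ ι
  have hu : u ≫ biprod.snd = ι := biprod.lift_snd _ _
  have : Mono u := by rw [← hu] at hι; exact mono_of_mono u biprod.snd
  have : IsIso ((toHo S).map (biprod.fst : N ⊞ C ⟶ N)) :=
    isIso_toHo_map_of_basic <| .inl ⟨inferInstance,
      isTrivialModule_of_iso kernelBiprodFstIso.symm hC⟩
  let y : (toHo S).obj N ≅ (toHo S).obj (N ⊞ C) := (asIso ((toHo S).map biprod.fst)).symm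
  let δ : cokernel u ⟶ (cosyzygy k S).obj M := cokernel.desc u (biprod.snd ≫ cokernel.π ι) <|
    (Category.assoc _ _ _).symm.trans ((congrArg (· ≫ cokernel.π ι) hu).trans
      (cokernel.condition ι))
  refine ⟨(toHo S).obj (cokernel u), y.hom ≫ (toHo S).map (cokernel.π u),
    (toHo S).map δ ≫ (hoShiftIso hS).inv.app M,
    ShortComplex.mk u (cokernel.π u) (cokernel.condition u), shortExact_cokernel u,
    biprod.snd, δ, hu, cokernel.π_desc _ _ _, Iso.refl _, y, Iso.refl _, ?_, ?_, ?_⟩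
  · have h : u ≫ biprod.fst = φ := biprod.lift_fst _ _
    have hy : y.hom ≫ (toHo S).map biprod.fst = 𝟙 _ := y.hom_inv_id
    rw [← cancel_mono ((toHo S).map biprod.fst), Category.assoc, hy, Iso.refl_hom,
      Category.id_comp, ← Functor.map_comp, h, Category.comp_id]
  · exact Category.comp_id _
  · refine (congrArg (_ ≫ ·) (CategoryTheory.Functor.map_id _ _)).trans ?_
    exact (Category.comp_id _).trans (Category.id_comp _).symm

/-- Every morphism of `Ho(S)` is part of a distinguished triangle. -/
theorem exists_distinguished (G₁ : P.Generator k N₁) (G₂ : P.swap.Generator k N₂)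
    (hP : ∀ M : ModuleCat.{u} S, P.IsExact M → IsTrivialModule S M) {X Y : Ho S} (f : X ⟶ Y) :
    ∃ (Z : Ho S) (g : Y ⟶ Z) (h : Z ⟶ (hoShift hS).obj X),
      (hoTriangles hS).distinguished f g h := by
  let ε (W : Ho S) : W ≅ (toHo S).obj ((tensorSum k S N₁ N₂).obj ((P.hoHomology k).obj W)) :=
    ((hoEquivalence G₁ G₂ hP).counitIso.app W).symm
  have nat : f ≫ (ε Y).hom = (ε X).hom ≫
      (toHo S).map ((tensorSum k S N₁ N₂).map ((P.hoHomology k).map f)) :=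
    (hoEquivalence G₁ G₂ hP).counitIso.inv.naturality f
  obtain ⟨Z, g, h, E, hE, b, δ, hb, hδ, x, y, z, hf, hg, hh⟩ := exists_distinguished_map hS hP
    ((tensorSum k S N₁ N₂).map ((P.hoHomology k).map f))
  refine ⟨Z, (ε Y).hom ≫ g, h ≫ (hoShift hS).map (ε X).inv,
    E, hE, b, δ, hb, hδ, ε X ≪≫ x, ε Y ≪≫ y, z, ?_, ?_, ?_⟩
  · rw [Iso.trans_hom, Iso.trans_hom, reassoc_of% nat, hf, Category.assoc]
  · rw [Iso.trans_hom, Category.assoc, hg, Category.assoc]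
  · have e : (hoShift hS).map (ε X).inv ≫ (hoShift hS).map (ε X ≪≫ x).hom =
        (hoShift hS).map x.hom := by
      rw [← Functor.map_comp, Iso.trans_hom, Iso.inv_hom_id_assoc]
    exact (Category.assoc _ _ _).trans ((congrArg (h ≫ ·) e).trans hh)

/-- Homology detects distinguished triangles. -/
theorem distinguished_iff (G₁ : P.Generator k N₁) (G₂ : P.swap.Generator k N₂)
    (hP : ∀ M : ModuleCat.{u} S, P.IsExact M → IsTrivialModule S M) {X Y Z : Ho S} (f : X ⟶ Y)
    (g : Y ⟶ Z) (h : Z ⟶ (hoShift hS).obj X) :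
    (hoTriangles hS).distinguished f g h ↔
      (modSqTriv k).distinguished ((P.hoHomology k).map f) ((P.hoHomology k).map g)
        ((P.hoHomology k).map h ≫ (hoHomologyShiftIso hS).hom.app X) := by
  refine ⟨distinguished_hoHomology hS, fun H => ?_⟩
  have : (P.hoHomology k).IsEquivalence := (hoEquivalence G₁ G₂ hP).isEquivalence_inverse
  obtain ⟨Z', g', h', H'⟩ := exists_distinguished hS G₁ G₂ hP f
  obtain ⟨z, hz, hz'⟩ := modSqTriv_exists_iso H (distinguished_hoHomology hS H')
  let w := (P.hoHomology k).preimageIso z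
  have hw : (P.hoHomology k).map w.hom = z.hom := (P.hoHomology k).map_preimage z.hom
  have hg : g ≫ w.hom = g' := (P.hoHomology k).map_injective <| by
    rw [Functor.map_comp, hw, hz]
  have hh : w.hom ≫ h' = h := (P.hoHomology k).map_injective <| by
    rw [← cancel_mono ((hoHomologyShiftIso hS).hom.app X), ← hz', Functor.map_comp, Category.assoc,
      hw]
  obtain ⟨E, hE, b, δ, hb, hδ, x, y, z', hf, hg', hh'⟩ := H'
  refine ⟨E, hE, b, δ, hb, hδ, x, y, w ≪≫ z', hf, ?_, ?_⟩
  · rw [Iso.trans_hom, reassoc_of% hg, hg']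
  · rw [← hh, Category.assoc, hh', Iso.trans_hom, Category.assoc]

end Shift

/-- The tensor sum of two modules representing the cycles is a triangle equivalence, provided that
modules without homology have finite projective dimension. -/
theorem isTriangleEquivalence_tensorSum (G₁ : P.Generator k N₁) (G₂ : P.swap.Generator k N₂)
    (hP : ∀ M : ModuleCat.{u} S, P.IsExact M → IsTrivialModule S M) :
    ∃ hS : CosyzygyDescends k S, IsTriangleEquivalence (modSqTriv k) (hoTriangles hS)
      (tensorSum k S N₁ N₂ ⋙ toHo S) := by
  have : (P.hoHomology k).IsEquivalence := (hoEquivalence G₁ G₂ hP).isEquivalence_inverse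
  have : (tensorSum k S N₁ N₂ ⋙ toHo S).IsEquivalence :=
    (hoEquivalence G₁ G₂ hP).isEquivalence_functor
  exact ⟨cosyzygyDescends hP, isTriangleEquivalence_of_quasiInverse modSqTriv_isoStable _
    (P.hoHomology k) (hoUnitIso G₁ G₂) (hoHomologyShiftIso _)
    fun f g h => distinguished_iff _ G₁ G₂ hP f g h⟩

end PeriodicPair

/-! ### The structure of the algebra `R` -/

namespace RAlg

variable (k : Type u) [Field k]

theorem e_zero_add_e_one : e k 0 + e k 1 = 1 := by
  simpa [e] using RingQuot.mkAlgHom_rel k (RRel.sum (k := k))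

theorem e_mul_e (i j : Fin 2) : e k i * e k j = if i = j then e k i else 0 := by
  have := RingQuot.mkAlgHom_rel k (RRel.idem (k := k) i j)
  rw [map_mul] at this
  refine this.trans ?_
  split_ifs
  · rfl
  · exact map_zero _

theorem e_mul_T (i : Fin 2) : e k i * T k = T k * e k (1 - i) := by
  simpa [e, T] using RingQuot.mkAlgHom_rel k (RRel.swap (k := k) i)

theorem T_mul_T : T k * T k = 0 := by
  simpa [T] using RingQuot.mkAlgHom_rel k (RRel.sq (k := k))

theorem adjoin_eq_top : Algebra.adjoin k {e k 0, e k 1, T k} = ⊤ := by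
  have h := FreeAlgebra.adjoin_range_ι (R := k) (X := RGen)
  have h' := congrArg (Subalgebra.map (RingQuot.mkAlgHom k (RRel k))) h
  rw [AlgHom.map_adjoin, Algebra.map_top,
    (AlgHom.range_eq_top _).2 (RingQuot.mkAlgHom_surjective k (RRel k)), ← Set.range_comp] at h'
  rw [← top_le_iff, ← h']
  refine Algebra.adjoin_mono ?_
  rintro _ ⟨g | _, rfl⟩
  · fin_cases g
    · exact .inl rfl
    · exact .inr (.inl rfl)
  · exact .inr (.inr rfl)

open DualNumber in
/-- The values on the generators of the faithful representation of `R` by `2 × 2` matrices over the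
dual numbers, where `T` acts as `ε` times the antidiagonal matrix. -/
def modelGen : RGen → Matrix (Fin 2) (Fin 2) k[ε]
  | .e i => ![!![1, 0; 0, 0], !![0, 0; 0, 1]] i
  | .T => !![0, ε; ε, 0]

open DualNumber in
/-- The faithful representation of `R` by `2 × 2` matrices over the dual numbers. -/
def model : RAlg k →ₐ[k] Matrix (Fin 2) (Fin 2) k[ε] :=
  RingQuot.liftAlgHom k ⟨FreeAlgebra.lift k (modelGen k), by
    intro x y h
    induction h with
    | sum => simp [modelGen, Matrix.one_fin_two]
    | idem a b =>
      refine Matrix.ext fun i j => ?_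
      fin_cases a <;> fin_cases b <;> fin_cases i <;> fin_cases j <;> simp [modelGen]
    | swap a =>
      refine Matrix.ext fun i j => ?_
      fin_cases a <;> fin_cases i <;> fin_cases j <;> simp [modelGen]
    | sq => simp [modelGen, ← Matrix.ext_iff, Fin.forall_fin_two]⟩

theorem model_e (i : Fin 2) :
    model k (e k i) = ![!![1, 0; 0, 0], !![0, 0; 0, 1]] i := by
  simp [model, e, modelGen]

open DualNumber in
theorem model_T : model k (T k) = !![0, ε; ε, 0] := by
  simp [model, T, modelGen]

/-- The `k`-basis `e₁, e₂, T e₁, T e₂` of `R`. -/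
def basisVec : Fin 4 → RAlg k := ![e k 0, e k 1, T k * e k 0, T k * e k 1]

theorem coeff_eq_zero_of_model_eq_zero {g : Fin 4 → k}
    (h : model k (∑ i, g i • basisVec k i) = 0) (i : Fin 4) : g i = 0 := by
  simp only [basisVec, Fin.sum_univ_four, map_add, map_smul, map_mul, model_e, model_T,
    Matrix.cons_val, Matrix.mul_fin_two] at h
  have h₁ := congrArg TrivSqZeroExt.fst (congrFun (congrFun h 0) 0)
  have h₂ := congrArg TrivSqZeroExt.fst (congrFun (congrFun h 1) 1)
  have h₃ := congrArg TrivSqZeroExt.snd (congrFun (congrFun h 1) 0)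
  have h₄ := congrArg TrivSqZeroExt.snd (congrFun (congrFun h 0) 1)
  simp at h₁ h₂ h₃ h₄
  fin_cases i <;> assumption

theorem linearIndependent_basisVec : LinearIndependent k (basisVec k) :=
  Fintype.linearIndependent_iff.2 fun g hg =>
    coeff_eq_zero_of_model_eq_zero k (by rw [hg, map_zero])

theorem span_basisVec : ⊤ ≤ Submodule.span k (Set.range (basisVec k)) := by
  let W := Submodule.span k (Set.range (basisVec k))
  have hb (i : Fin 4) : basisVec k i ∈ W := Submodule.subset_span ⟨i, rfl⟩
  have key (x : RAlg k) : ∀ w ∈ W, x * w ∈ W := by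
    have hx : x ∈ Algebra.adjoin k {e k 0, e k 1, T k} := by rw [adjoin_eq_top]; trivial
    have gen {g : RAlg k} (hg : ∀ i, g * basisVec k i ∈ W) : ∀ w ∈ W, g * w ∈ W := by
      have : W ≤ W.comap (LinearMap.mulLeft k g) := Submodule.span_le.2 <| by
        rintro _ ⟨i, rfl⟩
        exact hg i
      exact fun w hw => this hw
    induction hx using Algebra.adjoin_induction with
    | mem g hg =>
      have he (i : Fin 2) : ∀ j, e k i * basisVec k j ∈ W := by
        intro j
        fin_cases i <;> fin_cases j <;>
          simp [basisVec, ← mul_assoc, e_mul_T, mul_assoc (T k), e_mul_e] <;>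
          first | exact hb 0 | exact hb 1 | exact hb 2 | exact hb 3
      obtain rfl | rfl | rfl := hg
      · exact gen (he 0)
      · exact gen (he 1)
      · refine gen fun j => ?_
        fin_cases j
        · exact hb 2
        · exact hb 3
        · simp [basisVec, ← mul_assoc, T_mul_T]
        · simp [basisVec, ← mul_assoc, T_mul_T]
    | algebraMap a =>
      intro w hw
      rw [← Algebra.smul_def]
      exact W.smul_mem a hw
    | add x y _ _ hx hy =>
      intro w hw
      rw [add_mul]
      exact W.add_mem (hx w hw) (hy w hw)
    | mul x y _ _ hx hy =>
      intro w hw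
      rw [mul_assoc]
      exact hx _ (hy w hw)
  intro x _
  have h1 : (1 : RAlg k) ∈ W := by
    rw [← e_zero_add_e_one]
    exact W.add_mem (hb 0) (hb 1)
  simpa using key x 1 h1

/-- The `k`-basis `e₁, e₂, T e₁, T e₂` of `R`. -/
def basis : Module.Basis (Fin 4) k (RAlg k) :=
  .mk (linearIndependent_basisVec k) (span_basisVec k)

theorem model_injective : Function.Injective (model k) := by
  rw [injective_iff_map_eq_zero]
  intro x hx
  have h : ∑ i, (basis k).repr x i • basisVec k i = x := by
    simpa [basis] using (basis k).sum_repr x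
  rw [← h] at hx ⊢
  exact Finset.sum_eq_zero fun i _ => by rw [coeff_eq_zero_of_model_eq_zero k hx, zero_smul]

theorem finrank_eq : Module.finrank k (RAlg k) = 4 := by
  rw [Module.finrank_eq_card_basis (basis k), Fintype.card_fin]

theorem exists_eq_combination (s : RAlg k) : ∃ a b c d : k,
    s = a • e k 0 + b • e k 1 + c • (T k * e k 0) + d • (T k * e k 1) := by
  refine ⟨(basis k).repr s 0, (basis k).repr s 1, (basis k).repr s 2, (basis k).repr s 3,
    ((basis k).sum_repr s).symm.trans ?_⟩
  simp [Fin.sum_univ_four, basis, basisVec]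

theorem combination_eq_zero {a b : k} (h : a • (T k * e k 0) + b • (T k * e k 1) = 0) :
    a = 0 ∧ b = 0 := by
  have := Fintype.linearIndependent_iff.1 (linearIndependent_basisVec k) ![0, 0, a, b]
    (by simpa [Fin.sum_univ_four, basisVec] using h)
  exact ⟨this 2, this 3⟩

theorem exists_T_mul {s : RAlg k} (h : T k * s = 0) : ∃ t, T k * t = s := by
  obtain ⟨a, b, c, d, rfl⟩ := exists_eq_combination k s
  simp only [mul_add, mul_smul_comm, ← mul_assoc, T_mul_T, zero_mul, smul_zero, add_zero] at h
  obtain ⟨rfl, rfl⟩ := combination_eq_zero k h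
  exact ⟨c • e k 0 + d • e k 1, by simp [mul_add]⟩

theorem exists_mul_T {s : RAlg k} (h : s * T k = 0) : ∃ t, t * T k = s := by
  obtain ⟨a, b, c, d, rfl⟩ := exists_eq_combination k s
  simp only [add_mul, smul_mul_assoc, mul_assoc, e_mul_T] at h
  simp only [← mul_assoc, T_mul_T, zero_mul, smul_zero, add_zero] at h
  obtain ⟨rfl, rfl⟩ := combination_eq_zero k (a := b) (b := a) (by
    rw [add_comm]; simpa using h)
  exact ⟨c • e k 1 + d • e k 0, by simp [add_mul, e_mul_T]⟩

end RAlg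

/-! ### Contracting homotopies: self-injectivity of `R`, and exact modules are projective -/

/-- An exact differential on a vector space has a contracting homotopy. -/
theorem LinearMap.exists_contraction {k M : Type*} [Field k] [AddCommGroup M] [Module k M]
    {t : M →ₗ[k] M} (ht : Function.Exact t t) : ∃ τ : M →ₗ[k] M, ∀ m, t (τ m) + τ (t m) = m := by
  obtain ⟨g, hg⟩ := LinearMap.exists_comp_eq_of_range_le_range (ρ := t)
    (φ := (LinearMap.range t).subtype) (by simp)
  obtain ⟨g', hg'⟩ := LinearMap.exists_extend g
  -- a generalised inverse `g'` of `t`, and the projection `t ∘ g'` onto `ker t = im t`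
  have htg (m : M) : t (g' (t m)) = t m := by
    have h₁ : g' (t m) = g ⟨t m, m, rfl⟩ := LinearMap.congr_fun hg' ⟨t m, m, rfl⟩
    exact (congrArg t h₁).trans (LinearMap.congr_fun hg _)
  have htt (m : M) : t (t m) = 0 := ht.apply_apply_eq_zero m
  refine ⟨(LinearMap.id - t ∘ₗ g') ∘ₗ g' ∘ₗ t ∘ₗ g', fun m => ?_⟩
  obtain ⟨n, hn⟩ := (ht (g' (t m) - m)).1 (by rw [map_sub, htg, sub_self])
  have h₂ : g' (t m) = m + t n := by rw [hn]; abel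
  simp only [LinearMap.comp_apply, LinearMap.sub_apply, LinearMap.id_apply, map_sub, htt, sub_zero,
    htg]
  rw [h₂, map_add, map_add, htg]
  abel

section SelfInjective

variable {k : Type*} [Field k] {S : Type*} [Ring S] [Algebra k S]

/-- Elements which generate `S` and satisfy the relations of `R` that do not involve `t²`; both `R`
and its opposite algebra have such generators. -/
structure RGenerators (k : Type*) [Field k] (S : Type*) [Ring S] [Algebra k S] where
  (e e' t : S)
  add_eq_one : e + e' = 1
  e_mul_e' : e * e' = 0
  e'_mul_e : e' * e = 0
  e_mul_t : e * t = t * e'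
  e'_mul_t : e' * t = t * e
  adjoin_eq_top : Algebra.adjoin k {e, e', t} = ⊤

namespace RGenerators

variable (G : RGenerators k S) {M N : Type*} [AddCommGroup M] [Module k M] [Module S M]
  [IsScalarTower k S M] [AddCommGroup N] [Module k N] [Module S N] [IsScalarTower k S N]

include G

theorem exists_linearMap (φ : M →ₗ[k] N) (he : ∀ m, φ (G.e • m) = G.e • φ m)
    (he' : ∀ m, φ (G.e' • m) = G.e' • φ m) (ht : ∀ m, φ (G.t • m) = G.t • φ m) :
    ∃ ψ : M →ₗ[S] N, ∀ m, ψ m = φ m := by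
  refine ⟨{ φ with map_smul' := fun s => ?_ }, fun _ => rfl⟩
  have hs : s ∈ Algebra.adjoin k {G.e, G.e', G.t} := by rw [G.adjoin_eq_top]; trivial
  change ∀ m, φ (s • m) = s • φ m
  induction hs using Algebra.adjoin_induction with
  | mem g hg => obtain rfl | rfl | rfl := hg <;> assumption
  | algebraMap a => intro m; rw [algebraMap_smul, algebraMap_smul, map_smul]
  | add x y _ _ hx hy => intro m; rw [add_smul, add_smul, map_add, hx, hy]
  | mul x y _ _ hx hy => intro m; rw [mul_smul, mul_smul, hx, hy]

theorem e_mul_e : G.e * G.e = G.e := by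
  have := congrArg (G.e * ·) G.add_eq_one
  simpa [mul_add, G.e_mul_e'] using this

theorem e'_mul_e' : G.e' * G.e' = G.e' := by
  have := congrArg (G.e' * ·) G.add_eq_one
  simpa [mul_add, G.e'_mul_e] using this

/-- A `k`-linear map commuting with `t` becomes `S`-linear by averaging over the two idempotents. -/
theorem exists_average (φ : M →ₗ[k] N) (ht : ∀ m, φ (G.t • m) = G.t • φ m) :
    ∃ ψ : M →ₗ[S] N, ∀ m, ψ m = G.e • φ (G.e • m) + G.e' • φ (G.e' • m) := by
  refine G.exists_linearMap
    { toFun m := G.e • φ (G.e • m) + G.e' • φ (G.e' • m)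
      map_add' m n := by simp only [smul_add, map_add]; abel
      map_smul' a m := by
        simp only [smul_comm _ a, map_smul, smul_add, RingHom.id_apply] } ?_ ?_ ?_ <;> intro m
  · simp only [LinearMap.coe_mk, AddHom.coe_mk, smul_add, ← mul_smul, G.e_mul_e, G.e'_mul_e,
      G.e_mul_e', zero_smul, map_zero, smul_zero, add_zero]
  · simp only [LinearMap.coe_mk, AddHom.coe_mk, smul_add, ← mul_smul, G.e'_mul_e', G.e'_mul_e,
      G.e_mul_e', zero_smul, map_zero, smul_zero, zero_add]
  · simp only [LinearMap.coe_mk, AddHom.coe_mk, smul_add, ← mul_smul, G.e_mul_t, G.e'_mul_t]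
    simp only [mul_smul, ht]
    simp only [← mul_smul, G.e_mul_t, G.e'_mul_t]
    rw [add_comm]

omit [Module k M] [IsScalarTower k S M] in
theorem e_smul_add (m : M) : G.e • (G.e • m) + G.e' • (G.e' • m) = m := by
  rw [← mul_smul, ← mul_smul, G.e_mul_e, G.e'_mul_e', ← add_smul, G.add_eq_one, one_smul]

theorem exists_contraction (ht : G.t * G.t = 0)
    (hM : ∀ m : M, G.t • m = 0 → ∃ n : M, G.t • n = m) :
    ∃ τ : M →ₗ[k] M, ∀ m, G.t • τ m + τ (G.t • m) = m :=
  LinearMap.exists_contraction (t := DistribSMul.toLinearMap k M G.t) fun m => ⟨hM m, by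
    rintro ⟨n, rfl⟩
    change G.t • G.t • n = 0
    rw [← mul_smul, ht, zero_smul]⟩

/-- If `t` acts exactly on `M`, then `M` is projective: a contracting homotopy `τ` for `t` turns a
`k`-linear section `σ` into the section `t σ τ + σ τ t`, which commutes with `t`. -/
theorem projective (ht : G.t * G.t = 0) (hM : ∀ m : M, G.t • m = 0 → ∃ n : M, G.t • n = m) :
    Module.Projective S M := by
  obtain ⟨τ, hτ⟩ := G.exists_contraction (k := k) ht hM
  let p := Finsupp.linearCombination S (id : M → M)
  obtain ⟨σ, hσ⟩ := (p.restrictScalars k).exists_rightInverse_of_surjective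
    (LinearMap.range_eq_top.2 (Finsupp.linearCombination_id_surjective S M))
  replace hσ (m : M) : p (σ m) = m := LinearMap.congr_fun hσ m
  let φ : M →ₗ[k] (M →₀ S) := DistribSMul.toLinearMap k (M →₀ S) G.t ∘ₗ σ ∘ₗ τ +
    σ ∘ₗ τ ∘ₗ DistribSMul.toLinearMap k M G.t
  have hφ (m : M) : φ m = G.t • σ (τ m) + σ (τ (G.t • m)) := rfl
  obtain ⟨ψ, hψ⟩ := G.exists_average φ fun m => by
    rw [hφ, hφ, smul_add, ← mul_smul G.t G.t m, ← mul_smul G.t G.t (σ (τ m)), ht]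
    simp
  have hp (m : M) : p (φ m) = m := by rw [hφ, map_add, map_smul, hσ, hσ, hτ]
  refine ⟨ψ, fun m => ?_⟩
  change p (ψ m) = m
  rw [hψ, map_add, map_smul p, map_smul p, hp, hp, G.e_smul_add]

omit [Module k M] [IsScalarTower k S M] in
include k in
/-- If `t` acts exactly on `M`, then `M` is injective: a contracting homotopy `τ` for `t` turns a
`k`-linear extension `ρ` into the extension `t τ ρ + τ ρ t`, which commutes with `t`. -/
theorem injective (ht : G.t * G.t = 0) (hM : ∀ m : M, G.t • m = 0 → ∃ n : M, G.t • n = m) :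
    Module.Injective S M where
  out X Y _ _ _ _ f hf g := by
    let : Module k M := Module.restrictScalars k S M
    have : IsScalarTower k S M := IsScalarTower.restrictScalars k S M
    let : Module k X := Module.restrictScalars k S X
    have : IsScalarTower k S X := IsScalarTower.restrictScalars k S X
    let : Module k Y := Module.restrictScalars k S Y
    have : IsScalarTower k S Y := IsScalarTower.restrictScalars k S Y
    obtain ⟨τ, hτ⟩ := G.exists_contraction (k := k) ht hM
    obtain ⟨l, hl⟩ := (f.restrictScalars k).exists_leftInverse_of_injective
      (LinearMap.ker_eq_bot.2 hf)
    let ρ : Y →ₗ[k] M := g.restrictScalars k ∘ₗ l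
    have hρ (x : X) : ρ (f x) = g x := congrArg g (LinearMap.congr_fun hl x)
    let φ : Y →ₗ[k] M := DistribSMul.toLinearMap k M G.t ∘ₗ τ ∘ₗ ρ +
      τ ∘ₗ ρ ∘ₗ DistribSMul.toLinearMap k Y G.t
    have hφ (y : Y) : φ y = G.t • τ (ρ y) + τ (ρ (G.t • y)) := rfl
    obtain ⟨ψ, hψ⟩ := G.exists_average φ fun y => by
      rw [hφ, hφ, smul_add, ← mul_smul G.t G.t y, ← mul_smul G.t G.t (τ (ρ y)), ht]
      simp
    have hf (x : X) : φ (f x) = g x := by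
      rw [hφ, ← map_smul f, hρ, hρ, map_smul g, hτ]
    refine ⟨ψ, fun x => ?_⟩
    rw [hψ, ← map_smul f, ← map_smul f, hf, hf, map_smul g, map_smul g, G.e_smul_add]

end RGenerators

end SelfInjective

/-! ### The homotopy category of `R` -/

namespace RAlg

variable (k : Type u) [Field k]

/-- The generators of `R`. -/
def generators : RGenerators k (RAlg k) where
  e := e k 0
  e' := e k 1
  t := T k
  add_eq_one := e_zero_add_e_one k
  e_mul_e' := by simp [e_mul_e]
  e'_mul_e := by simp [e_mul_e]
  e_mul_t := by simp [e_mul_T]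
  e'_mul_t := by simp [e_mul_T]
  adjoin_eq_top := adjoin_eq_top k

/-- The generators of the opposite algebra of `R`. -/
def opGenerators : RGenerators k (RAlg k)ᵐᵒᵖ where
  e := .op (e k 0)
  e' := .op (e k 1)
  t := .op (T k)
  add_eq_one := by rw [← MulOpposite.op_add, e_zero_add_e_one, MulOpposite.op_one]
  e_mul_e' := by rw [← MulOpposite.op_mul]; simp [e_mul_e]
  e'_mul_e := by rw [← MulOpposite.op_mul]; simp [e_mul_e]
  e_mul_t := by rw [← MulOpposite.op_mul, ← MulOpposite.op_mul]; simp [e_mul_T]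
  e'_mul_t := by rw [← MulOpposite.op_mul, ← MulOpposite.op_mul]; simp [e_mul_T]
  adjoin_eq_top := by
    have := congrArg Subalgebra.op (adjoin_eq_top k)
    rw [Subalgebra.op_adjoin, Subalgebra.op_top] at this
    rw [← this]
    congr 1
    ext x
    simp [← MulOpposite.unop_inj]

theorem injective : Module.Injective (RAlg k) (RAlg k) :=
  (generators k).injective (T_mul_T k) fun _ => exists_T_mul k

theorem op_injective : Module.Injective (RAlg k)ᵐᵒᵖ (RAlg k) :=
  (opGenerators k).injective (congrArg MulOpposite.op (T_mul_T k)) fun _ => exists_mul_T k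

/-- The periodic pair `e₁R ⇄ e₂R` given by multiplication with `T`. -/
@[simps]
def pair : PeriodicPair (RAlg k) where
  e := e k 0
  f := e k 1
  c := e k 0 * T k
  d := e k 1 * T k
  e_mul_e := by simp [e_mul_e]
  f_mul_f := by simp [e_mul_e]
  e_mul_c := by simp [← mul_assoc, e_mul_e]
  c_mul_f := by simp [mul_assoc, e_mul_T, e_mul_e]
  f_mul_d := by simp [← mul_assoc, e_mul_e]
  d_mul_e := by simp [mul_assoc, e_mul_T, e_mul_e]
  c_mul_d := by
    rw [e_mul_T k 1, mul_assoc, ← mul_assoc (T k) (T k), T_mul_T, zero_mul, mul_zero]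
  d_mul_c := by
    rw [e_mul_T k 0, mul_assoc, ← mul_assoc (T k) (T k), T_mul_T, zero_mul, mul_zero]
  exact_left s he hd := by
    obtain ⟨t, ht⟩ := exists_T_mul k (s := s) (by
      rw [← he, ← mul_assoc]; simpa [e_mul_T] using hd)
    exact ⟨t, by rw [mul_assoc, ht, he]⟩
  exact_left' s he hd := by
    obtain ⟨t, ht⟩ := exists_T_mul k (s := s) (by
      rw [← he, ← mul_assoc]; simpa [e_mul_T] using hd)
    exact ⟨t, by rw [mul_assoc, ht, he]⟩
  exact_right s hs := by
    obtain ⟨t, ht⟩ := exists_mul_T k (s := s * e k 0) (by rw [mul_assoc, hs])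
    refine ⟨t, ?_⟩
    have h : e k 1 * T k = T k * e k 0 := by simp [e_mul_T]
    rw [h, ← mul_assoc, ht, mul_assoc, e_mul_e, if_pos rfl]
  exact_right' s hs := by
    obtain ⟨t, ht⟩ := exists_mul_T k (s := s * e k 1) (by rw [mul_assoc, hs])
    refine ⟨t, ?_⟩
    have h : e k 0 * T k = T k * e k 1 := by simp [e_mul_T]
    rw [h, ← mul_assoc, ht, mul_assoc, e_mul_e, if_pos rfl]

open scoped ModuleCat in
/-- Modules over `R` on which `T` acts exactly are projective. -/
theorem isTrivialModule_of_isExact (M : ModuleCat.{u} (RAlg k)) (hM : (pair k).IsExact M) :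
    IsTrivialModule (RAlg k) M := by
  have : Module.Projective (RAlg k) M := by
    refine (generators k).projective (T_mul_T k) fun m (hm : T k • m = 0) => ?_
    obtain ⟨n, hn⟩ := hM.1 (e k 0 • m) (by rw [← mul_smul]; simp [e_mul_e]) (by
      rw [← mul_smul, pair_d, mul_assoc, ← show e k 1 * T k = T k * e k 0 by simp [e_mul_T],
        mul_smul, mul_smul, hm, smul_zero, smul_zero])
    obtain ⟨n', hn'⟩ := hM.2 (e k 1 • m) (by rw [← mul_smul]; simp [e_mul_e]) (by
      rw [← mul_smul, pair_c, mul_assoc, ← show e k 0 * T k = T k * e k 1 by simp [e_mul_T],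
        mul_smul, mul_smul, hm, smul_zero, smul_zero])
    refine ⟨e k 1 • n + e k 0 • n', ?_⟩
    have h : (e k 0 + e k 1) • m = m := by rw [e_zero_add_e_one, one_smul]
    rw [← h, add_smul, ← hn, ← hn', smul_add]
    simp [← mul_smul, generators, e_mul_T]
  have := IsProjective.iff_projective M |>.1 this
  exact isTrivialModule_of_projective M

/-- The underlying vector space of `χ_i`. -/
def charEquiv (i : Fin 2) : CharModule k i ≃ₗ[k] k := LinearEquiv.refl k k

variable {k} in
theorem smul_charModule (i : Fin 2) (r : RAlg k) (x : CharModule k i) :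
    r • x = character k i r • x := rfl

/-- The module `χ_i` represents the cycles. -/
def charGenerator (i : Fin 2) (P : PeriodicPair (RAlg k)) (he : P.e = e k i)
    (hf : P.f = e k (1 - i)) (hc : P.c = e k i * T k) (hd : P.d = e k (1 - i) * T k) :
    P.Generator k (CharModule k i) where
  gen := (charEquiv k i).symm 1
  e_smul_gen := by rw [he, smul_charModule, character_e, if_pos rfl, one_smul]
  d_smul_gen := by rw [hd, smul_charModule, map_mul, character_T, mul_zero, zero_smul]
  exists_smul x := ⟨algebraMap k _ (charEquiv k i x), by
    rw [algebraMap_smul, ← map_smul, smul_eq_mul, mul_one, LinearEquiv.symm_apply_apply]⟩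
  exists_lift {M} _ _ m hm hm' := by
    let : Module k M := Module.restrictScalars k (RAlg k) M
    have : IsScalarTower k (RAlg k) M := IsScalarTower.restrictScalars k (RAlg k) M
    have hT : T k • m = 0 := by
      have h : P.d * P.e = T k * e k i := by rw [P.d_mul_e, hd, e_mul_T, sub_sub_cancel]
      rw [← hm, he, ← mul_smul, ← h, mul_smul, hm, hm']
    have hej (j : Fin 2) : e k j • m = character k i (e k j) • m := by
      rw [character_e]
      nth_rw 1 [← hm]
      rw [he, ← mul_smul, e_mul_e]
      split_ifs with h₁ h₂ h₂
      · rw [one_smul, h₁, ← he, hm]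
      · exact absurd h₁.symm h₂
      · exact absurd h₂.symm h₁
      · rw [zero_smul, zero_smul]
    let φ : CharModule k i →ₗ[k] M := LinearMap.toSpanSingleton k M m ∘ₗ (charEquiv k i).toLinearMap
    have key {r : RAlg k} (h : r • m = character k i r • m) (x : CharModule k i) :
        φ (r • x) = r • φ x := by
      rw [smul_charModule, map_smul]
      change _ = r • charEquiv k i x • m
      rw [smul_comm, h, smul_comm]
      rfl
    obtain ⟨ψ, hψ⟩ := (generators k).exists_linearMap φ (key (hej 0)) (key (hej 1))
      (key (r := T k) (by rw [character_T, zero_smul, hT]))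
    exact ⟨ψ, (hψ _).trans (one_smul k m)⟩
  coeff := (charEquiv k i).toLinearMap
  coeff_gen := (charEquiv k i).apply_symm_apply 1
  coeff_c_smul x := by
    rw [hc, smul_charModule, map_mul, character_T, mul_zero, zero_smul, map_zero]
  exists_decomp x := ⟨0, by
    rw [smul_zero, add_zero, ← map_smul, smul_eq_mul, mul_one]
    exact ((charEquiv k i).symm_apply_apply x).symm⟩
  retraction := 0
  retraction_c_smul x := by
    rw [hf, smul_charModule i (e k (1 - i)) x, character_e, if_neg (by fin_cases i <;> simp),
      zero_smul, LinearMap.zero_apply]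

theorem exists_isTriangleEquivalence : ∃ hR : CosyzygyDescends k (RAlg k),
    IsTriangleEquivalence (modSqTriv k) (hoTriangles hR) (functorR k) :=
  PeriodicPair.isTriangleEquivalence_tensorSum
    (charGenerator k 0 (pair k) rfl rfl rfl rfl)
    (charGenerator k 1 (pair k).swap rfl rfl rfl rfl) (isTrivialModule_of_isExact k)

end RAlg

/-! ### The regular components of the finite Hecke algebra -/

namespace RAlg

variable (k : Type u) [Field k]

variable {k} in
theorem algHom_ext {B : Type*} [Ring B] [Algebra k B] {φ ψ : RAlg k →ₐ[k] B}
    (h₀ : φ (e k 0) = ψ (e k 0)) (h₁ : φ (e k 1) = ψ (e k 1)) (hT : φ (T k) = ψ (T k)) :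
    φ = ψ := by
  refine AlgHom.ext_of_adjoin_eq_top (adjoin_eq_top k) ?_
  rintro _ (rfl | rfl | rfl) <;> assumption

variable {B : Type*} [Ring B] [Algebra k B]

/-- A copy `(a, b, t)` of the relations of `R` in an algebra `B`, relative to the idempotent
`a + b` instead of the unit of `B`. -/
structure CornerRelations (a b t : B) : Prop where
  aa : a * a = a
  bb : b * b = b
  ab : a * b = 0
  ba : b * a = 0
  a_t : a * t = t * b
  b_t : b * t = t * a
  t_t : t * t = 0
  unit_t : (a + b) * t = t

namespace CornerRelations

variable {k} {a b t : B}

theorem t_unit (h : CornerRelations a b t) : t * (a + b) = t := by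
  rw [mul_add, ← h.a_t, ← h.b_t, add_comm, ← add_mul, h.unit_t]

variable (h : CornerRelations a b t)

/-- The unital homomorphism `R → B` with `e₁ ↦ a`, `e₂ ↦ 1 - a` and `T ↦ t`. -/
def unitalLift : RAlg k →ₐ[k] B :=
  have h₁ : (1 - a) * t = t * a := by
    rw [sub_mul, one_mul, ← h.b_t, sub_eq_iff_eq_add', ← add_mul, h.unit_t]
  have h₂ : t * (1 - a) = a * t := by
    rw [mul_sub, mul_one, ← h.b_t, sub_eq_iff_eq_add, ← add_mul, h.unit_t]
  RingQuot.liftAlgHom k ⟨FreeAlgebra.lift k fun g => match g with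
    | .e i => ![a, 1 - a] i
    | .T => t, by
    intro x y hxy
    induction hxy with
    | sum => simp
    | idem i j => fin_cases i <;> fin_cases j <;> simp [h.aa, mul_sub, sub_mul]
    | swap i => fin_cases i <;> simp [h₁, h₂]
    | sq => simp [h.t_t]⟩

theorem unitalLift_e_zero : h.unitalLift (e k 0) = a := by simp [unitalLift, e]

theorem unitalLift_e_one : h.unitalLift (e k 1) = 1 - a := by simp [unitalLift, e]

theorem unitalLift_T : h.unitalLift (T k) = t := by simp [unitalLift, T]

theorem unitalLift_mem {W : Subalgebra k B} (ha : a ∈ W) (ht : t ∈ W) (x : RAlg k) :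
    h.unitalLift x ∈ W := by
  have : Algebra.adjoin k {e k 0, e k 1, T k} ≤ W.comap h.unitalLift := by
    rw [Algebra.adjoin_le_iff]
    rintro _ (rfl | rfl | rfl)
    · simpa [h.unitalLift_e_zero] using ha
    · simpa [h.unitalLift_e_one] using W.sub_mem W.one_mem ha
    · simpa [h.unitalLift_T] using ht
  rw [adjoin_eq_top] at this
  exact this trivial

theorem unit_mul_unit (h : CornerRelations a b t) : (a + b) * (a + b) = a + b := by
  rw [mul_add, add_mul, add_mul, h.aa, h.ab, h.ba, h.bb, add_zero, zero_add]

theorem commute_unit (x : RAlg k) : (a + b) * h.unitalLift x = h.unitalLift x * (a + b) := by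
  have := h.unitalLift_mem (W := Subalgebra.centralizer k {a + b})
    (by simp [Subalgebra.mem_centralizer_iff, add_mul, mul_add, h.ab, h.ba])
    (by simp [Subalgebra.mem_centralizer_iff, h.unit_t, h.t_unit]) x
  exact Subalgebra.mem_centralizer_iff k |>.1 this _ rfl

/-- The non-unital homomorphism `R → B` with `e₁ ↦ a`, `e₂ ↦ b` and `T ↦ t`. -/
def lift : RAlg k →ₙₐ[k] B where
  toFun x := (a + b) * h.unitalLift x
  map_smul' c x := by simp
  map_zero' := by simp
  map_add' x y := by simp [mul_add]
  map_mul' x y := by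
    rw [map_mul, mul_assoc, ← mul_assoc _ (a + b), ← h.commute_unit, ← mul_assoc, ← mul_assoc,
      ← mul_assoc, h.unit_mul_unit]

theorem lift_apply (x : RAlg k) : h.lift x = (a + b) * h.unitalLift x := rfl

theorem lift_one : h.lift (1 : RAlg k) = a + b := by rw [lift_apply, map_one, mul_one]

theorem lift_e_zero : h.lift (e k 0) = a := by
  rw [lift_apply, unitalLift_e_zero, add_mul, h.aa, h.ba, add_zero]

theorem lift_e_one : h.lift (e k 1) = b := by
  rw [lift_apply, unitalLift_e_one, mul_sub, mul_one, add_mul, h.aa, h.ba, add_zero,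
    add_sub_cancel_left]

theorem lift_T : h.lift (T k) = t := by rw [lift_apply, unitalLift_T, h.unit_t]

end CornerRelations

end RAlg

namespace HeckeAff

variable {k : Type u} [Field k] {D : Type v} [CommGroup D]
  {U : Type v} [CommGroup U] [Fintype U] {s : D →* D} {α : U →* D}

theorem torus_mul_torus (t t' : D) :
    torus k s α t * torus k s α t' = torus k s α (t * t') := by
  simpa [torus] using RingQuot.mkAlgHom_rel k (HeckeRel.mul (k := k) (s := s) (α := α) t t')

theorem refl_mul_torus (i : Fin 2) (t : D) :
    refl k s α i * torus k s α t = torus k s α (s t) * refl k s α i := by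
  simpa [torus, refl] using
    RingQuot.mkAlgHom_rel k (HeckeRel.braid (k := k) (s := s) (α := α) i t)

theorem refl_mul_refl (i : Fin 2) :
    refl k s α i * refl k s α i = refl k s α i * ∑ x, torus k s α (α x) := by
  simpa [torus, refl] using RingQuot.mkAlgHom_rel k (HeckeRel.quad (k := k) (s := s) (α := α) i)

theorem torus_mem_finiteHecke (t : D) : torus k s α t ∈ finiteHecke k s α :=
  Algebra.subset_adjoin (.inl ⟨t, rfl⟩)

theorem refl_mem_finiteHecke : refl k s α 0 ∈ finiteHecke k s α :=
  Algebra.subset_adjoin (.inr rfl)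

/-- A regular character is nontrivial on the image of the coroot, since `t` and `s t` differ by an
element of that image. So its values on the coroot sum to zero. -/
theorem sum_coroot_eq_zero (hα : ∀ t, ∃ x, t = s t * α x) {ξ : D →* kˣ} (hξ : ξ ≠ ξ.comp s) :
    ∑ x, (ξ (α x) : k) = 0 := by
  classical
  have : (Units.coeHom k).comp (ξ.comp α) ≠ 1 := by
    intro h
    refine hξ (MonoidHom.ext fun t => ?_)
    obtain ⟨x, hx⟩ := hα t
    have h' : ξ (α x) = 1 := Units.ext (DFunLike.congr_fun h x)
    rw [MonoidHom.comp_apply]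
    nth_rw 1 [hx]
    rw [map_mul, h', mul_one]
  simpa using sum_hom_units_eq_zero _ this

open DualNumber in
/-- The representation of the affine Hecke algebra by `2 × 2` matrices over the dual numbers in
which the torus acts diagonally through `ξ` and `ξ ∘ s`, and each `T_{s_i}` acts as `ε` times the
antidiagonal matrix. It separates the elements of the component of `{ξ, ξ ∘ s}`. -/
def model (hs : Function.Involutive s) (hα : ∀ t, ∃ x, t = s t * α x)
    {ξ : D →* kˣ} (hξ : ξ ≠ ξ.comp s) :
    HeckeAff k s α →ₐ[k] Matrix (Fin 2) (Fin 2) k[ε] :=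
  RingQuot.liftAlgHom k ⟨FreeAlgebra.lift k fun g => match g with
    | .torus t => !![algebraMap k k[ε] (ξ t), 0; 0, algebraMap k k[ε] (ξ (s t))]
    | .refl _ => !![0, ε; ε, 0], by
    intro x y hxy
    induction hxy with
    | one => simp [Matrix.one_fin_two]
    | mul t t' =>
      refine Matrix.ext fun i j => ?_
      fin_cases i <;> fin_cases j <;> simp [Matrix.mul_apply]
    | braid i t =>
      refine Matrix.ext fun i j => ?_
      fin_cases i <;> fin_cases j <;> simp [Matrix.mul_apply, hs t, mul_comm]
    | quad i =>
      have hss : (ξ.comp s).comp s = ξ := MonoidHom.ext fun t => congrArg ξ (hs t)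
      have h₀ := congrArg (algebraMap k k[ε]) (sum_coroot_eq_zero hα hξ)
      have h₁ := congrArg (algebraMap k k[ε]) (sum_coroot_eq_zero hα (ξ := ξ.comp s)
        (by rw [hss]; exact hξ.symm))
      rw [map_sum, map_zero] at h₀ h₁
      have hz : ∑ x, !![algebraMap k k[ε] (ξ (α x)), 0; 0, algebraMap k k[ε] (ξ (s (α x)))] = 0 := by
        refine Matrix.ext fun i j => ?_
        rw [Matrix.sum_apply]
        fin_cases i <;> fin_cases j <;> simp
        · exact h₀
        · exact h₁
      simp only [map_mul, map_sum, FreeAlgebra.lift_ι_apply, hz, mul_zero, mul_zero]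
      simp [← Matrix.ext_iff, Fin.forall_fin_two]⟩

section

variable (hs : Function.Involutive s) (hα : ∀ t, ∃ x, t = s t * α x)
  {ξ : D →* kˣ} (hξ : ξ ≠ ξ.comp s)

open DualNumber in
theorem model_torus (t : D) : model hs hα hξ (torus k s α t) =
    !![algebraMap k k[ε] (ξ t), 0; 0, algebraMap k k[ε] (ξ (s t))] := by
  simp [model, torus]

open DualNumber in
theorem model_refl (i : Fin 2) : model hs hα hξ (refl k s α i) = !![0, ε; ε, 0] := by
  simp [model, refl]

end

variable [Fintype D]

theorem torus_mul_idem (ξ : D →* kˣ) (t : D) :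
    torus k s α t * idem k s α ξ = (ξ t : k) • idem k s α ξ := by
  rw [idem, mul_smul_comm, smul_comm (ξ t : k), Finset.mul_sum,
    Finset.smul_sum (r := (ξ t : k))]
  congr 1
  refine Fintype.sum_equiv (Equiv.mulLeft t) _ _ fun x => ?_
  rw [mul_smul_comm, torus_mul_torus, Equiv.coe_mulLeft, smul_smul, ← Units.val_mul, ← map_mul]
  simp

theorem idem_mul_torus (ξ : D →* kˣ) (t : D) :
    idem k s α ξ * torus k s α t = (ξ t : k) • idem k s α ξ := by
  rw [← torus_mul_idem, idem, smul_mul_assoc, mul_smul_comm, Finset.sum_mul, Finset.mul_sum]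
  simp_rw [smul_mul_assoc, mul_smul_comm, torus_mul_torus, mul_comm]

open Classical in
/-- Orthogonality of characters. -/
theorem card_inv_mul_sum (hD : (Fintype.card D : k) ≠ 0) (ξ η : D →* kˣ) :
    (Fintype.card D : k)⁻¹ * ∑ t : D, (ξ t⁻¹ : k) * (η t : k) = if ξ = η then 1 else 0 := by
  split_ifs with h
  · subst h
    simp [hD]
  · have : (Units.coeHom k).comp (ξ⁻¹ * η) ≠ 1 := by
      intro h'
      refine h (MonoidHom.ext fun t => ?_)
      have := DFunLike.congr_fun h' t
      have h'' : (ξ⁻¹ * η) t = 1 := Units.ext this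
      rwa [MonoidHom.mul_apply, MonoidHom.inv_apply, inv_mul_eq_one] at h''
    have := sum_hom_units_eq_zero _ this
    simp only [MonoidHom.comp_apply, MonoidHom.mul_apply, MonoidHom.inv_apply,
      Units.coeHom_apply, Units.val_mul] at this
    simp only [map_inv, this, mul_zero]

open Classical in
theorem idem_mul_idem (hD : (Fintype.card D : k) ≠ 0) (ξ η : D →* kˣ) :
    idem k s α ξ * idem k s α η = if ξ = η then idem k s α η else 0 := by
  rw [idem, smul_mul_assoc, Finset.sum_mul]
  simp_rw [smul_mul_assoc, torus_mul_idem, smul_smul]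
  rw [← Finset.sum_smul, smul_smul, card_inv_mul_sum hD, ite_smul, one_smul, zero_smul]

theorem refl_mul_idem (hs : Function.Involutive s) (i : Fin 2) (ξ : D →* kˣ) :
    refl k s α i * idem k s α ξ = idem k s α (ξ.comp s) * refl k s α i := by
  rw [idem, idem, mul_smul_comm, smul_mul_assoc, Finset.mul_sum, Finset.sum_mul]
  congr 1
  refine Fintype.sum_equiv hs.toPerm _ _ fun t => ?_
  rw [mul_smul_comm, refl_mul_torus, smul_mul_assoc, MonoidHom.comp_apply,
    Function.Involutive.coe_toPerm, map_inv s, hs]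

theorem idem_mem_finiteHecke (ξ : D →* kˣ) : idem k s α ξ ∈ finiteHecke k s α :=
  Subalgebra.smul_mem _ (Subalgebra.sum_mem _ fun t _ =>
    Subalgebra.smul_mem _ (torus_mem_finiteHecke t) _) _

theorem idem_mul_sum_torus {ξ : D →* kˣ} (h : ∑ x, (ξ (α x) : k) = 0) :
    idem k s α ξ * ∑ x, torus k s α (α x) = 0 := by
  simp_rw [Finset.mul_sum, idem_mul_torus, ← Finset.sum_smul, h, zero_smul]

/-- `e_ξ`, `e_{ξ^s}` and `e_γ T_{s_0}` satisfy the relations of `R`. The square of `e_γ T_{s_0}`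
vanishes since the quadratic relation brings in the sum of a nontrivial character. -/
theorem cornerRelations (hs : Function.Involutive s) (hα : ∀ t, ∃ x, t = s t * α x)
    (hD : (Fintype.card D : k) ≠ 0) {ξ : D →* kˣ} (hξ : ξ ≠ ξ.comp s) :
    RAlg.CornerRelations (idem k s α ξ) (idem k s α (ξ.comp s))
      ((idem k s α ξ + idem k s α (ξ.comp s)) * refl k s α 0) := by
  have hss : (ξ.comp s).comp s = ξ := MonoidHom.ext fun t => congrArg ξ (hs t)
  have aa : idem k s α ξ * idem k s α ξ = idem k s α ξ := by rw [idem_mul_idem hD, if_pos rfl]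
  have bb : idem k s α (ξ.comp s) * idem k s α (ξ.comp s) = idem k s α (ξ.comp s) := by
    rw [idem_mul_idem hD, if_pos rfl]
  have ab : idem k s α ξ * idem k s α (ξ.comp s) = 0 := by rw [idem_mul_idem hD, if_neg hξ]
  have ba : idem k s α (ξ.comp s) * idem k s α ξ = 0 := by rw [idem_mul_idem hD, if_neg hξ.symm]
  have ra := refl_mul_idem (α := α) hs 0 ξ
  have rb := refl_mul_idem (α := α) hs 0 (ξ.comp s)
  rw [hss] at rb
  have za := idem_mul_sum_torus (s := s) (sum_coroot_eq_zero hα hξ)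
  have zb := idem_mul_sum_torus (s := s) (sum_coroot_eq_zero hα (ξ := ξ.comp s)
    (by rw [hss]; exact hξ.symm))
  have rr := refl_mul_refl (k := k) (s := s) (α := α) 0
  generalize idem k s α ξ = a at *
  generalize idem k s α (ξ.comp s) = b at *
  generalize refl k s α 0 = r at *
  generalize ∑ x, torus k s α (α x) = z at *
  refine ⟨aa, bb, ab, ba, ?_, ?_, ?_, ?_⟩
  · rw [mul_assoc, rb, ← mul_assoc, ← mul_assoc]
    simp only [mul_add, add_mul, aa, ab, ba]
  · rw [mul_assoc, ra, ← mul_assoc, ← mul_assoc]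
    simp only [mul_add, add_mul, bb, ab, ba]
  · have hc : r * (a + b) = (a + b) * r := by rw [mul_add, add_mul, ra, rb, add_comm]
    have hz : (a + b) * z = 0 := by rw [add_mul, za, zb, add_zero]
    rw [mul_assoc, ← mul_assoc r, hc, mul_assoc (a + b) r r, rr, ← mul_assoc (a + b) r z, ← hc,
      mul_assoc r, hz, mul_zero, mul_zero]
  · rw [← mul_assoc]
    simp only [mul_add, add_mul, aa, bb, ab, ba, add_zero, zero_add]

open DualNumber Classical in
theorem model_idem (hs : Function.Involutive s) (hα : ∀ t, ∃ x, t = s t * α x)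
    {ξ : D →* kˣ} (hξ : ξ ≠ ξ.comp s) (hD : (Fintype.card D : k) ≠ 0) (η : D →* kˣ) :
    model hs hα hξ (idem k s α η) =
      !![if η = ξ then 1 else 0, 0; 0, if η = ξ.comp s then 1 else 0] := by
  have h (ζ : D →* kˣ) := congrArg (algebraMap k k[ε]) (card_inv_mul_sum hD η ζ)
  refine Matrix.ext fun i j => ?_
  simp only [idem, map_smul, map_sum, model_torus, Matrix.smul_apply, Matrix.sum_apply]
  fin_cases i <;> fin_cases j
  · refine Eq.trans ?_ ((h ξ).trans ?_)
    · simp [Algebra.smul_def]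
    · split_ifs <;> simp [*]
  · simp
  · simp
  · refine Eq.trans ?_ ((h (ξ.comp s)).trans ?_)
    · simp [Algebra.smul_def]
    · split_ifs <;> simp [*]

/-- The relations give a homomorphism from `R` to the component. It is injective because its
composite with the representation `model` is the faithful representation of `R`. -/
theorem regularComponentsAreR (hs : Function.Involutive s) (hα : ∀ t, ∃ x, t = s t * α x)
    (hD : (Fintype.card D : k) ≠ 0) : RegularComponentsAreR k s α := by
  intro ξ hξ
  have h := cornerRelations (α := α) hs hα hD hξ
  refine ⟨h.lift, ?_, ?_, h.lift_one, h.lift_e_zero, h.lift_e_one, h.lift_T⟩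
  · have hunit : model hs hα hξ (idem k s α ξ + idem k s α (ξ.comp s)) = 1 := by
      rw [map_add, model_idem hs hα hξ hD, model_idem hs hα hξ hD, Matrix.one_fin_two]
      simp [hξ, hξ.symm]
    have hmodel : (model hs hα hξ).comp h.unitalLift = RAlg.model k := by
      apply RAlg.algHom_ext
      · rw [AlgHom.comp_apply, h.unitalLift_e_zero, model_idem hs hα hξ hD, RAlg.model_e]
        simp [hξ]
      · rw [AlgHom.comp_apply, h.unitalLift_e_one, map_sub, map_one,
          model_idem hs hα hξ hD, RAlg.model_e, Matrix.one_fin_two]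
        refine Matrix.ext fun i j => ?_
        fin_cases i <;> fin_cases j <;> simp [hξ]
      · rw [AlgHom.comp_apply, h.unitalLift_T, map_mul, hunit, one_mul, model_refl, RAlg.model_T]
    intro x y hxy
    apply RAlg.model_injective k
    have := congrArg (model hs hα hξ) hxy
    rwa [h.lift_apply, h.lift_apply, map_mul, map_mul, hunit, one_mul, one_mul,
      ← AlgHom.comp_apply, ← AlgHom.comp_apply, hmodel] at this
  · refine Set.Subset.antisymm ?_ ?_
    · rintro _ ⟨x, rfl⟩
      exact ⟨_, h.unitalLift_mem (idem_mem_finiteHecke ξ) (Subalgebra.mul_mem _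
        (Subalgebra.add_mem _ (idem_mem_finiteHecke ξ) (idem_mem_finiteHecke _))
        refl_mem_finiteHecke) x, h.lift_apply x⟩
    · rintro _ ⟨y, hy, rfl⟩
      rw [finiteHecke] at hy
      induction hy using Algebra.adjoin_induction with
      | mem y hy =>
        obtain ⟨t, rfl⟩ | rfl := hy
        · refine ⟨(ξ t : k) • RAlg.e k 0 + (ξ (s t) : k) • RAlg.e k 1, ?_⟩
          rw [map_add, map_smul, map_smul, h.lift_e_zero, h.lift_e_one, add_mul, idem_mul_torus,
            idem_mul_torus]
          rfl
        · exact ⟨_, h.lift_T⟩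
      | algebraMap c =>
        refine ⟨c • 1, ?_⟩
        rw [map_smul, h.lift_one, Algebra.algebraMap_eq_smul_one, mul_smul_comm, mul_one]
      | add y z _ _ hy hz =>
        obtain ⟨y', hy⟩ := hy
        obtain ⟨z', hz⟩ := hz
        exact ⟨y' + z', by rw [map_add, hy, hz, mul_add]⟩
      | mul y z _ _ hy hz =>
        obtain ⟨y', hy⟩ := hy
        obtain ⟨z', hz⟩ := hz
        refine ⟨y' * z', ?_⟩
        -- the component absorbs its unit on the right
        have hy' : h.lift y' * (idem k s α ξ + idem k s α (ξ.comp s)) = h.lift y' := by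
          rw [h.lift_apply, mul_assoc, ← h.commute_unit, ← mul_assoc, h.unit_mul_unit]
        rw [map_mul, hz, ← mul_assoc, hy', hy, mul_assoc]

end HeckeAff

/-- The order `q - 1` of `F_qˣ` is prime to the characteristic. -/
theorem card_units_ne_zero (p : ℕ) [Fact p.Prime] (k : Type u) [Field k] [CharP k p]
    (F : Type v) [Field F] [Fintype F] [DecidableEq F] [CharP F p] :
    (Fintype.card Fˣ : k) ≠ 0 := by
  obtain ⟨n, -, hn⟩ := FiniteField.card F p
  have h : Fintype.card Fˣ + 1 = p ^ (n : ℕ) := by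
    rw [← hn, Fintype.card_units, Nat.sub_add_cancel Fintype.card_pos]
  have h' := congrArg (Nat.cast : ℕ → k) h
  rw [Nat.cast_add, Nat.cast_pow, CharP.cast_eq_zero k p, zero_pow n.ne_zero, Nat.cast_one] at h'
  intro h₀
  rw [h₀, zero_add] at h'
  exact one_ne_zero h'

theorem regularComponentsAreR_SL (p : ℕ) [Fact p.Prime] (k : Type u) [Field k] [CharP k p]
    (F : Type v) [Field F] [Fintype F] [DecidableEq F] [CharP F p] :
    RegularComponentsAreR k (weylInv F) (corootSL F) :=
  HeckeAff.regularComponentsAreR inv_involutive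
    (fun t => ⟨t * t, by simp [weylInv, corootSL]⟩) (card_units_ne_zero p k F)

theorem regularComponentsAreR_GL (p : ℕ) [Fact p.Prime] (k : Type u) [Field k] [CharP k p]
    (F : Type v) [Field F] [Fintype F] [DecidableEq F] [CharP F p] :
    RegularComponentsAreR k (weylGL F) (corootGL F) :=
  HeckeAff.regularComponentsAreR (fun _ => rfl)
    (fun t => ⟨t.1 * t.2⁻¹, by simp [weylGL, corootGL]⟩) (by
      rw [Fintype.card_prod, Nat.cast_mul]
      exact mul_ne_zero (card_units_ne_zero p k F) (card_units_ne_zero p k F))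

theorem regularComponentsAreR_PGL (p : ℕ) [Fact p.Prime] (k : Type u) [Field k] [CharP k p]
    (F : Type v) [Field F] [Fintype F] [DecidableEq F] [CharP F p] :
    RegularComponentsAreR k (weylInv F) (corootPGL F) :=
  HeckeAff.regularComponentsAreR inv_involutive
    (fun t => ⟨t, by simp [weylInv, corootPGL, sq]⟩) (card_units_ne_zero p k F)

/-! ### Projective modules over rings all of whose ideals are projective -/

section Hereditary

variable {B : Type u} [CommRing B]

/-- Over a ring all of whose ideals are projective, quotients of injective modules are injective:
in Baer's criterion a map from an ideal to the quotient lifts. -/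
theorem Module.Baer.of_surjective [∀ I : Ideal B, Module.Projective B I] {E Q : Type*}
    [AddCommGroup E] [Module B E] [AddCommGroup Q] [Module B Q] (hE : Module.Baer B E)
    (π : E →ₗ[B] Q) (hπ : Function.Surjective π) : Module.Baer B Q := by
  intro I g
  obtain ⟨g', hg'⟩ := Module.projective_lifting_property π g hπ
  obtain ⟨h, hh⟩ := hE I g'
  refine ⟨π ∘ₗ h, fun x hx => ?_⟩
  rw [LinearMap.comp_apply, hh x hx, ← LinearMap.comp_apply, hg']

/-- Over a ring all of whose ideals are projective, submodules of projective modules are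
projective, also those of infinite rank: to lift a map to a quotient `X / L`, embed `X` in an
injective module `E`, extend the map to the injective module `E / L`, and lift that. -/
theorem Module.Projective.of_injective [∀ I : Ideal B, Module.Projective B I] {N F : Type u}
    [AddCommGroup N] [Module B N] [AddCommGroup F] [Module B F] [Module.Projective B F]
    (i : N →ₗ[B] F) (hi : Function.Injective i) : Module.Projective B N := by
  refine Module.Projective.of_lifting_property fun {X Y} _ _ _ _ π f hπ => ?_
  let E : ModuleCat.{u} B := CategoryTheory.Injective.under (ModuleCat.of B X)
  let j : X →ₗ[B] E := (CategoryTheory.Injective.ι (ModuleCat.of B X)).hom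
  have hj : Function.Injective j := (ModuleCat.mono_iff_injective _).1 inferInstance
  have hE : Module.Baer B E := .of_injective <|
    have : CategoryTheory.Injective (ModuleCat.of B E) :=
      CategoryTheory.Injective.injective_under (ModuleCat.of B X)
    Module.injective_module_of_injective_object B E
  let L := (LinearMap.ker π).map j
  obtain ⟨j', hj'⟩ : ∃ j' : Y →ₗ[B] E ⧸ L, j' ∘ₗ π = L.mkQ ∘ₗ j := by
    refine ⟨(LinearMap.ker π).mapQ L j (Submodule.le_comap_map _ _) ∘ₗ
      (π.quotKerEquivOfSurjective hπ).symm.toLinearMap, LinearMap.ext fun x => ?_⟩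
    have : (π.quotKerEquivOfSurjective hπ).symm (π x) = (LinearMap.ker π).mkQ x := by
      rw [LinearEquiv.symm_apply_eq]
      rfl
    rw [LinearMap.comp_apply, LinearMap.comp_apply, LinearEquiv.coe_coe, this]
    rfl
  obtain ⟨g, hg⟩ := (hE.of_surjective L.mkQ L.mkQ_surjective).extension_property i hi (j' ∘ₗ f)
  obtain ⟨g', hg'⟩ := Module.projective_lifting_property L.mkQ g L.mkQ_surjective
  have key (n : N) : ∃ x, j x = g' (i n) ∧ π x = f n := by
    obtain ⟨x, hx⟩ := hπ (f n)
    have h : L.mkQ (g' (i n)) = L.mkQ (j x) := by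
      rw [← LinearMap.comp_apply L.mkQ g', hg', ← LinearMap.comp_apply g i, hg,
        ← LinearMap.comp_apply L.mkQ j, ← hj', LinearMap.comp_apply, LinearMap.comp_apply, hx]
    obtain ⟨y, hy, hxy⟩ : g' (i n) - j x ∈ L := by
      rwa [← sub_eq_zero, ← map_sub, Submodule.mkQ_apply, Submodule.Quotient.mk_eq_zero] at h
    refine ⟨y + x, ?_, ?_⟩
    · rw [map_add, hxy, sub_add_cancel]
    · rw [map_add, hx, LinearMap.mem_ker.1 hy, zero_add]
  have hrange : ∀ n, (g' ∘ₗ i) n ∈ LinearMap.range j := fun n => by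
    obtain ⟨x, hx, -⟩ := key n
    exact ⟨x, hx⟩
  refine ⟨(LinearEquiv.ofInjective j hj).symm.toLinearMap ∘ₗ (g' ∘ₗ i).codRestrict _ hrange, ?_⟩
  refine LinearMap.ext fun n => ?_
  obtain ⟨x, hx, hx'⟩ := key n
  have : (LinearEquiv.ofInjective j hj).symm ((g' ∘ₗ i).codRestrict _ hrange n) = x := by
    rw [LinearEquiv.symm_apply_eq]
    exact Subtype.ext hx.symm
  rw [LinearMap.comp_apply, LinearMap.comp_apply, LinearEquiv.coe_coe, this, hx']

end Hereditary

/-! ### Exact modules over a ring with two complementary zero divisors -/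

section Gluing

variable {A : Type u} [CommRing A]

instance (I : Ideal A) (F : Type*) [AddCommGroup F] [Module A F] [Module.Projective A F] :
    Module.Projective (A ⧸ I) (F ⧸ (I • ⊤ : Submodule A F)) :=
  Module.Projective.of_equiv ((TensorProduct.quotTensorEquivQuotSMul F I).extendScalarsOfSurjective
    Ideal.Quotient.mk_surjective)

/-- If `q : Z → K` is surjective, injective on `IZ`, and `K / IK` is projective over `A / I`, then
`q` splits: `Z` is the fibre product of `K` and `Z / IZ` over `K / IK`, and a section of
`Z / IZ → K / IK` induces one of `q`. -/
theorem LinearMap.exists_section_of_projective_quotient (I : Ideal A) {Z K : Type*}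
    [AddCommGroup Z] [Module A Z] [AddCommGroup K] [Module A K] (q : Z →ₗ[A] K)
    (hq : Function.Surjective q) (h : ∀ z ∈ (I • ⊤ : Submodule A Z), q z = 0 → z = 0)
    [Module.Projective (A ⧸ I) (K ⧸ (I • ⊤ : Submodule A K))] :
    ∃ s : K →ₗ[A] Z, q ∘ₗ s = LinearMap.id := by
  let q' : (Z ⧸ (I • ⊤ : Submodule A Z)) →ₗ[A] K ⧸ (I • ⊤ : Submodule A K) :=
    Submodule.mapQ _ _ q (Submodule.smul_top_le_comap_smul_top I q)
  have hq' : Function.Surjective q' := by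
    intro y
    obtain ⟨m, rfl⟩ := Submodule.mkQ_surjective _ y
    obtain ⟨z, rfl⟩ := hq m
    exact ⟨Submodule.mkQ _ z, rfl⟩
  obtain ⟨s', hs'⟩ := LinearMap.exists_rightInverse_of_surjective
    (q'.extendScalarsOfSurjective (S := A ⧸ I) Ideal.Quotient.mk_surjective)
    (LinearMap.range_eq_top.2 hq')
  have hs (m : K ⧸ (I • ⊤ : Submodule A K)) : q' (s' m) = m := LinearMap.congr_fun hs' m
  -- the graph of the induced section
  let G : Submodule A Z := LinearMap.ker
    (Submodule.mkQ _ - s'.restrictScalars A ∘ₗ Submodule.mkQ _ ∘ₗ q)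
  have hG (z : Z) : z ∈ G ↔ Submodule.mkQ (I • ⊤ : Submodule A Z) z = s' (Submodule.mkQ _ (q z)) := by
    rw [LinearMap.mem_ker, LinearMap.sub_apply, sub_eq_zero]
    rfl
  have hbij : Function.Bijective (q ∘ₗ G.subtype) := by
    refine ⟨(injective_iff_map_eq_zero _).2 fun z hz => ?_, fun m => ?_⟩
    · have hz' := (hG z).1 z.2
      have hz : q z = 0 := hz
      rw [hz, map_zero, map_zero, Submodule.mkQ_apply, Submodule.Quotient.mk_eq_zero] at hz'
      exact Subtype.ext (h _ hz' hz)
    · obtain ⟨z, hz⟩ := Submodule.mkQ_surjective _ (s' (Submodule.mkQ _ m))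
      have h₁ : Submodule.mkQ (I • ⊤ : Submodule A K) (q z) = Submodule.mkQ _ m := by
        have := congrArg q' hz
        rw [hs] at this
        exact this
      have h₂ : m - q z ∈ (I • ⊤ : Submodule A K) := by
        rw [← Submodule.Quotient.mk_eq_zero, ← Submodule.mkQ_apply, map_sub, h₁, sub_self]
      rw [← LinearMap.range_eq_top.2 hq, LinearMap.range_eq_map, ← Submodule.map_smul''] at h₂
      obtain ⟨w, hw, hwm⟩ := h₂
      have hm : q (z + w) = m := by rw [map_add, hwm, add_sub_cancel]
      refine ⟨⟨z + w, (hG _).2 ?_⟩, hm⟩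
      rw [hm, ← hz, map_add, add_eq_left]
      exact (Submodule.Quotient.mk_eq_zero _).2 hw
  let e := LinearEquiv.ofBijective _ hbij
  exact ⟨G.subtype ∘ₗ e.symm.toLinearMap, LinearMap.ext fun m => e.apply_symm_apply m⟩

theorem Submodule.mem_span_singleton_smul_top {M : Type*} [AddCommGroup M] [Module A M] {r : A}
    {m : M} : m ∈ (Ideal.span {r} • ⊤ : Submodule A M) ↔ ∃ n, r • n = m := by
  simp [Submodule.ideal_span_singleton_smul, Submodule.mem_smul_pointwise_iff_exists]

/-- If `K ≤ F` with `F` projective, and `K ∩ rF = rK`, then `K / rK` is a submodule of the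
projective module `F / rF`. -/
theorem Module.Projective.quotient_of_injective {r : A}
    [∀ I : Ideal (A ⧸ Ideal.span {r}), Module.Projective (A ⧸ Ideal.span {r}) I] {K F : Type u}
    [AddCommGroup K] [Module A K] [AddCommGroup F] [Module A F] [Module.Projective A F]
    (i : K →ₗ[A] F) (h : ∀ m n, i m = r • n → ∃ m', r • m' = m) :
    Module.Projective (A ⧸ Ideal.span {r}) (K ⧸ (Ideal.span {r} • ⊤ : Submodule A K)) := by
  let i' : (K ⧸ (Ideal.span {r} • ⊤ : Submodule A K)) →ₗ[A]
      F ⧸ (Ideal.span {r} • ⊤ : Submodule A F) :=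
    Submodule.mapQ _ _ i (Submodule.smul_top_le_comap_smul_top _ i)
  refine .of_injective (i'.extendScalarsOfSurjective Ideal.Quotient.mk_surjective) ?_
  refine (injective_iff_map_eq_zero _).2 fun m hm => ?_
  obtain ⟨m, rfl⟩ := Submodule.mkQ_surjective _ m
  have hm : Submodule.mkQ _ (i m) = 0 := hm
  rw [Submodule.mkQ_apply, Submodule.Quotient.mk_eq_zero,
    Submodule.mem_span_singleton_smul_top] at hm ⊢
  obtain ⟨n, hn⟩ := hm
  exact h m n hn.symm

variable {x y : A} [∀ I : Ideal (A ⧸ Ideal.span {x}), Module.Projective (A ⧸ Ideal.span {x}) I]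
  [∀ I : Ideal (A ⧸ Ideal.span {y}), Module.Projective (A ⧸ Ideal.span {y}) I]

/-- A submodule `K` of a projective module whose annihilated parts are `ker x = yK` and
`ker y = xK` is projective: a free cover `P → K` with kernel `L` is split in two steps, first
`P / xL → K` and then the preimage in `P` of the image of this first section. -/
theorem Module.Projective.of_exact (hxy : x * y = 0)
    (hinf : ∀ a b : A, x * a = y * b → x * a = 0) {K F : Type u}
    [AddCommGroup K] [Module A K] [AddCommGroup F] [Module A F] [Module.Projective A F]
    (i : K →ₗ[A] F) (hi : Function.Injective i)
    (hx : ∀ m : K, x • m = 0 → ∃ n : K, y • n = m) (hy : ∀ m : K, y • m = 0 → ∃ n : K, x • n = m)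
    (hA : ∀ a : A, y * a = 0 → ∃ b, x * b = a) : Module.Projective A K := by
  have hyx : y * x = 0 := by rw [mul_comm, hxy]
  have hKx : Module.Projective (A ⧸ Ideal.span {x}) (K ⧸ (Ideal.span {x} • ⊤ : Submodule A K)) :=
    .quotient_of_injective i fun m n h => hy m (hi (by
      rw [map_smul, h, smul_smul, hyx, zero_smul, map_zero]))
  have hKy : Module.Projective (A ⧸ Ideal.span {y}) (K ⧸ (Ideal.span {y} • ⊤ : Submodule A K)) :=
    .quotient_of_injective i fun m n h => hx m (hi (by
      rw [map_smul, h, smul_smul, hxy, zero_smul, map_zero]))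
  let P := K →₀ A
  let π : P →ₗ[A] K := Finsupp.linearCombination A id
  have hπ : Function.Surjective π := Finsupp.linearCombination_id_surjective A K
  have hPinf (p p' : P) (h : x • p = y • p') : x • p = 0 :=
    Finsupp.ext fun m => hinf (p m) (p' m) (DFunLike.congr_fun h m)
  have hP (p : P) (h : y • p = 0) : ∃ p', x • p' = p := by
    have (m : K) : ∃ b, x * b = p m ∧ (p m = 0 → b = 0) := by
      by_cases hm : p m = 0
      · exact ⟨0, by rw [hm, mul_zero], fun _ => rfl⟩
      · obtain ⟨b, hb⟩ := hA (p m) (DFunLike.congr_fun h m)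
        exact ⟨b, hb, fun h => absurd h hm⟩
    choose b hb hb' using this
    refine ⟨Finsupp.onFinset p.support b fun m hm => Finsupp.mem_support_iff.2 fun h =>
      hm (hb' m h), Finsupp.ext hb⟩
  let L := LinearMap.ker π
  -- exactness of the kernel at the spot that is used
  have hL (l : P) (hl : l ∈ L) (h : y • l = 0) : ∃ l' ∈ L, x • l' = l := by
    obtain ⟨p, rfl⟩ := hP l h
    rw [LinearMap.mem_ker, map_smul] at hl
    obtain ⟨n, hn⟩ := hx _ hl
    obtain ⟨p', rfl⟩ := hπ n
    refine ⟨p - y • p', ?_, ?_⟩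
    · rw [LinearMap.mem_ker, map_sub, map_smul, hn, sub_self]
    · rw [smul_sub, smul_smul, hxy, zero_smul, sub_zero]
  let xL : Submodule A P := L.map (LinearMap.lsmul A P x)
  have hxL : xL ≤ L := by
    rintro _ ⟨l, hl, rfl⟩
    exact L.smul_mem x hl
  let q : (P ⧸ xL) →ₗ[A] K := xL.liftQ π hxL
  have hq (p : P) : q (xL.mkQ p) = π p := rfl
  obtain ⟨s, hs⟩ := LinearMap.exists_section_of_projective_quotient (Ideal.span {x}) q
    (fun m => by
      obtain ⟨p, rfl⟩ := hπ m
      exact ⟨xL.mkQ p, rfl⟩)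
    fun z hz hqz => by
      obtain ⟨z, rfl⟩ := Submodule.mem_span_singleton_smul_top.1 hz
      obtain ⟨p, rfl⟩ := xL.mkQ_surjective z
      rw [← map_smul, hq] at hqz
      obtain ⟨l, hl, h⟩ := hL (x • p) hqz (by rw [smul_smul, hyx, zero_smul])
      rw [← map_smul, Submodule.mkQ_apply, Submodule.Quotient.mk_eq_zero]
      exact ⟨l, hl, h⟩
  have hs (m : K) : q (s m) = m := LinearMap.congr_fun hs m
  let P' : Submodule A P := LinearMap.ker (xL.mkQ - s ∘ₗ π)
  have hP' (p : P) : p ∈ P' ↔ xL.mkQ p = s (π p) := by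
    rw [LinearMap.mem_ker, LinearMap.sub_apply, sub_eq_zero]
    rfl
  obtain ⟨s', hs'⟩ := LinearMap.exists_section_of_projective_quotient (Z := P') (Ideal.span {y})
    (π ∘ₗ P'.subtype)
    (fun m => by
      obtain ⟨p, hp⟩ := xL.mkQ_surjective (s m)
      have hm : π p = m := by rw [← hq, hp, hs]
      exact ⟨⟨p, (hP' p).2 (by rw [hp, hm])⟩, hm⟩)
    fun z hz hqz => by
      obtain ⟨p, rfl⟩ := Submodule.mem_span_singleton_smul_top.1 hz
      have hqz : π (y • (p : P)) = 0 := hqz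
      have h := (hP' _).1 (y • p).2
      rw [Submodule.coe_smul, hqz, map_zero, Submodule.mkQ_apply,
        Submodule.Quotient.mk_eq_zero] at h
      obtain ⟨l, -, hl⟩ := h
      have hl : x • l = y • (p : P) := hl
      exact Subtype.ext (hl.symm.trans (hPinf l p hl))
  exact .of_split (P'.subtype ∘ₗ s') π hs'

end Gluing

/-! ### The algebra `A` -/

namespace AAlg

variable (k : Type u) [Field k]

/-- The class of the variable `X_i` in `A`, for uniform treatment of both variables. -/
def X (i : Fin 2) : AAlg k := Ideal.Quotient.mk _ (MvPolynomial.X i)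

theorem mk_eq_zero_iff (i : Fin 2) (a : MvPolynomial (Fin 2) k) :
    (Ideal.Quotient.mk _ a : AAlg k) = 0 ↔ ∃ b, a = MvPolynomial.X i * (MvPolynomial.X (1 - i) * b) := by
  rw [Ideal.Quotient.eq_zero_iff_mem, Ideal.mem_span_singleton, dvd_def]
  fin_cases i
  · simp [mul_assoc]
  · simp [mul_assoc, mul_left_comm]

theorem X_mul_X (i : Fin 2) : X k i * X k (1 - i) = 0 := by
  rw [X, X, ← map_mul, mk_eq_zero_iff k i]
  exact ⟨1, by rw [mul_one]⟩

variable {k}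

theorem exists_X_mul_eq (i : Fin 2) (a : AAlg k) (h : X k (1 - i) * a = 0) : ∃ b, X k i * b = a := by
  obtain ⟨a, rfl⟩ := Ideal.Quotient.mk_surjective a
  rw [X, ← map_mul, mk_eq_zero_iff k i] at h
  obtain ⟨b, hb⟩ := h
  rw [mul_left_comm] at hb
  have := mul_left_cancel₀ (MvPolynomial.X_ne_zero _) hb
  exact ⟨Ideal.Quotient.mk _ b, by rw [this, X, map_mul]⟩

theorem not_X_dvd_X (i : Fin 2) :
    ¬ (MvPolynomial.X i : MvPolynomial (Fin 2) k) ∣ MvPolynomial.X (1 - i) := by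
  rw [MvPolynomial.X_dvd_X]
  fin_cases i <;> simp

/-- The ideals generated by the two variables have trivial intersection. -/
theorem X_mul_eq_zero_of_eq (i : Fin 2) (a b : AAlg k) (h : X k i * a = X k (1 - i) * b) :
    X k i * a = 0 := by
  obtain ⟨a, rfl⟩ := Ideal.Quotient.mk_surjective a
  obtain ⟨b, rfl⟩ := Ideal.Quotient.mk_surjective b
  rw [X, X, ← map_mul, ← map_mul, ← sub_eq_zero, ← map_sub, mk_eq_zero_iff k i] at h
  obtain ⟨c, hc⟩ := h
  have h : MvPolynomial.X i ∣ MvPolynomial.X (1 - i) * b :=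
    ⟨a - MvPolynomial.X (1 - i) * c, by rw [mul_sub, ← hc, sub_sub_cancel]⟩
  obtain ⟨b, rfl⟩ := (MvPolynomial.X_dvd_mul_iff.1 h).resolve_left (not_X_dvd_X i)
  rw [X, ← map_mul, mk_eq_zero_iff k i]
  exact ⟨b + c, by rw [mul_add, mul_add, ← hc]; ring⟩

variable (k) in
/-- The component `A / X_j A` of `A`. -/
abbrev Component (j : Fin 2) : Type u := AAlg k ⧸ Ideal.span {X k j}

/-- The variable `X_i` is not a zero divisor modulo the other one. -/
theorem mk_eq_zero_of_mk_X_mul_eq_zero (i : Fin 2) (a : AAlg k)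
    (h : (Ideal.Quotient.mk (Ideal.span {X k (1 - i)})) (X k i * a) = 0) :
    Ideal.Quotient.mk (Ideal.span {X k (1 - i)}) a = 0 := by
  rw [Ideal.Quotient.eq_zero_iff_mem, Ideal.mem_span_singleton] at h ⊢
  obtain ⟨b, hb⟩ := h
  obtain ⟨c, rfl⟩ := exists_X_mul_eq (1 - i) a (by
    rw [sub_sub_cancel]
    exact X_mul_eq_zero_of_eq i a b hb)
  exact ⟨c, rfl⟩

variable (k) in
/-- The map from a polynomial ring in one variable onto a component of `A`. -/
def polynomialMap (i : Fin 2) : Polynomial k →ₐ[k] Component k (1 - i) :=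
  Polynomial.aeval (Ideal.Quotient.mk _ (X k i))

theorem polynomialMap_surjective (i : Fin 2) : Function.Surjective (polynomialMap k i) := by
  intro z
  obtain ⟨a, rfl⟩ := Ideal.Quotient.mk_surjective z
  obtain ⟨a, rfl⟩ := Ideal.Quotient.mk_surjective a
  rw [← AlgHom.mem_range]
  induction a using MvPolynomial.induction_on with
  | C c => exact (polynomialMap k i).range.algebraMap_mem c
  | add a b ha hb =>
    rw [map_add, map_add]
    exact add_mem ha hb
  | mul_X a j ha =>
    rw [map_mul, map_mul]
    refine mul_mem ha ?_
    obtain rfl | rfl : j = i ∨ j = 1 - i := by omega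
    · exact ⟨Polynomial.X, Polynomial.aeval_X _⟩
    · have : Ideal.Quotient.mk (Ideal.span {X k (1 - i)}) (X k (1 - i)) = 0 :=
        Ideal.Quotient.eq_zero_iff_mem.2 (Ideal.mem_span_singleton_self _)
      exact this.symm ▸ zero_mem (polynomialMap k i).range

instance (j : Fin 2) : IsPrincipalIdealRing (Component k j) := by
  obtain ⟨i, rfl⟩ : ∃ i, j = 1 - i := ⟨1 - j, (sub_sub_cancel 1 j).symm⟩
  exact .of_surjective (polynomialMap k i) (polynomialMap_surjective i)

instance (j : Fin 2) : IsDomain (Component k j) := by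
  obtain ⟨i, rfl⟩ : ∃ i, j = 1 - i := ⟨1 - j, (sub_sub_cancel 1 j).symm⟩
  rw [Ideal.Quotient.isDomain_iff_prime]
  have : (Ideal.span {(MvPolynomial.X (1 - i) : MvPolynomial (Fin 2) k)}).IsPrime := by
    rw [Ideal.span_singleton_prime (MvPolynomial.X_ne_zero _)]
    exact MvPolynomial.X_prime
  have h := Ideal.map_isPrime_of_surjective (f := Ideal.Quotient.mk
    (Ideal.span {(MvPolynomial.X 0 * MvPolynomial.X 1 : MvPolynomial (Fin 2) k)}))
    Ideal.Quotient.mk_surjective (I := Ideal.span {MvPolynomial.X (1 - i)}) (by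
      rw [Ideal.mk_ker, Ideal.span_singleton_le_span_singleton]
      fin_cases i
      · exact ⟨_, mul_comm _ _⟩
      · exact ⟨_, rfl⟩)
  rwa [Ideal.map_span, Set.image_singleton] at h

variable (k) in
/-- The value at the origin on a component of `A`. -/
def evalZero (j : Fin 2) : (Component k j) →ₐ[k] k :=
  Ideal.Quotient.liftₐ _ (Ideal.Quotient.liftₐ _ (MvPolynomial.aeval 0) (by
    intro a ha
    obtain ⟨b, rfl⟩ := Ideal.mem_span_singleton.1 ha
    simp)) (by
    intro a ha
    obtain ⟨b, rfl⟩ := Ideal.mem_span_singleton.1 ha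
    rw [map_mul]
    refine mul_eq_zero_of_left ?_ _
    change MvPolynomial.aeval 0 (MvPolynomial.X j) = (0 : k)
    simp)

theorem evalZero_X (i j : Fin 2) : evalZero k j (Ideal.Quotient.mk _ (X k i)) = 0 := by
  change MvPolynomial.aeval 0 (MvPolynomial.X i) = (0 : k)
  simp

/-- Each element of a component is the sum of its value at the origin and a multiple of the
variable. -/
theorem exists_decomp (i : Fin 2) (z : Component k (1 - i)) :
    ∃ y, z = evalZero k (1 - i) z • 1 + X k i • y := by
  obtain ⟨p, rfl⟩ := polynomialMap_surjective i z
  refine ⟨polynomialMap k i p.divX, ?_⟩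
  have hX : polynomialMap k i Polynomial.X = Ideal.Quotient.mk _ (X k i) := Polynomial.aeval_X _
  have h : polynomialMap k i p = p.coeff 0 • 1 +
      Ideal.Quotient.mk _ (X k i) * polynomialMap k i p.divX := by
    nth_rw 1 [← Polynomial.X_mul_divX_add p]
    rw [map_add, map_mul, hX, add_comm]
    refine congrArg (· + _) ?_
    exact (Polynomial.aeval_C _ _).trans (Algebra.algebraMap_eq_smul_one _)
  have h' : evalZero k (1 - i) (polynomialMap k i p) = p.coeff 0 := by
    rw [h, map_add, map_mul, evalZero_X, zero_mul, add_zero, map_smul, map_one, smul_eq_mul, mul_one]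
  rw [h', h]
  rfl

/-- The component `A / X_{1-i} A` represents the annihilator of `X_{1-i}`. -/
theorem nonempty_generator (i : Fin 2) (P : PeriodicPair (AAlg k)) (he : P.e = 1) (hf : P.f = 1)
    (hc : P.c = X k i) (hd : P.d = X k (1 - i)) :
    Nonempty (P.Generator k (Component k (1 - i))) := by
  let μ : (Component k (1 - i)) →ₗ[k] Component k (1 - i) :=
    LinearMap.mulLeft k (Ideal.Quotient.mk _ (X k i))
  have hμ : LinearMap.ker μ = ⊥ := by
    rw [LinearMap.ker_eq_bot']
    intro z hz
    obtain ⟨a, rfl⟩ := Ideal.Quotient.mk_surjective z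
    exact mk_eq_zero_of_mk_X_mul_eq_zero i a hz
  obtain ⟨ρ, hρ⟩ := μ.exists_leftInverse_of_injective hμ
  exact ⟨{
    gen := 1
    e_smul_gen := by rw [he, one_smul]
    d_smul_gen := by
      rw [hd, ← map_one (Ideal.Quotient.mk _), ← Ideal.Quotient.mk_eq_mk,
        ← Submodule.Quotient.mk_smul, Submodule.Quotient.mk_eq_zero, smul_eq_mul, mul_one]
      exact Ideal.mem_span_singleton_self _
    exists_smul := fun z => by
      obtain ⟨a, rfl⟩ := Ideal.Quotient.mk_surjective z
      refine ⟨a, ?_⟩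
      change a • (Submodule.Quotient.mk 1 : Component k (1 - i)) = Submodule.Quotient.mk a
      rw [← Submodule.Quotient.mk_smul, smul_eq_mul, mul_one]
    exists_lift := fun {M} _ _ m _ hm => by
      refine ⟨Submodule.liftQ _ (LinearMap.toSpanSingleton (AAlg k) M m) ?_, one_smul _ m⟩
      intro z hz
      obtain ⟨b, rfl⟩ := Ideal.mem_span_singleton.1 hz
      rw [LinearMap.mem_ker, LinearMap.toSpanSingleton_apply, mul_comm (X k (1 - i)) b, mul_smul,
        show X k (1 - i) • m = 0 from hd ▸ hm, smul_zero]
    coeff := (evalZero k (1 - i)).toLinearMap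
    coeff_gen := map_one (evalZero k (1 - i))
    coeff_c_smul := fun z => by
      rw [hc]
      refine (map_mul (evalZero k (1 - i)) (Ideal.Quotient.mk _ (X k i)) z).trans ?_
      exact mul_eq_zero_of_left (evalZero_X i _) _
    exists_decomp := fun z => by
      rw [hc]
      exact exists_decomp i z
    retraction := ρ
    retraction_c_smul := fun z => by
      rw [hf, one_smul, hc]
      exact LinearMap.congr_fun hρ z }⟩

variable (k)

/-- The complex `⋯ → M → M → M → ⋯` whose maps are alternately `X₁` and `X₂`. -/
def pair : PeriodicPair (AAlg k) where
  e := 1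
  f := 1
  c := X₁ k
  d := X₂ k
  e_mul_e := mul_one _
  f_mul_f := mul_one _
  e_mul_c := one_mul _
  c_mul_f := mul_one _
  f_mul_d := one_mul _
  d_mul_e := mul_one _
  c_mul_d := X_mul_X k 0
  d_mul_c := X_mul_X k 1
  exact_left s _ hs := exists_X_mul_eq 0 s hs
  exact_left' s _ hs := exists_X_mul_eq 1 s hs
  exact_right s hs := by
    obtain ⟨b, hb⟩ := exists_X_mul_eq (k := k) 1 s (by rw [mul_comm]; exact hs)
    exact ⟨b, by rw [mul_one, mul_comm]; exact hb⟩
  exact_right' s hs := by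
    obtain ⟨b, hb⟩ := exists_X_mul_eq (k := k) 0 s (by rw [mul_comm]; exact hs)
    exact ⟨b, by rw [mul_one, mul_comm]; exact hb⟩

open scoped ModuleCat in
/-- Exact modules over `A` have projective dimension at most one: the first syzygy is an exact
submodule of a projective module. -/
theorem isTrivialModule_of_isExact (M : ModuleCat.{u} (AAlg k)) (h : (pair k).IsExact M) :
    IsTrivialModule (AAlg k) M := by
  let π := Projective.π M
  let K : ModuleCat.{u} (AAlg k) := kernel π
  have hE := PeriodicPair.shortExact_kernel π
  have hF : Module.Projective (AAlg k) ((Projective.over M : ModuleCat.{u} (AAlg k)) : Type u) :=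
    (IsProjective.iff_projective _).2 (Projective.projective_over M)
  have hK : (pair k).IsExact K := by
    refine PeriodicPair.isExact_X₁ k hE ?_
    have hF' := (pair k).isExact_of_projective (M := ((Projective.over M : ModuleCat.{u} (AAlg k)) : Type u))
    rw [PeriodicPair.isExact_iff k] at h hF'
    have := h.1
    have := h.2
    have := hF'.1
    have := hF'.2
    rw [PeriodicPair.isIso_totalHomology_map_iff]
    exact ⟨⟨Function.injective_of_subsingleton _, Function.surjective_to_subsingleton _⟩,
      ⟨Function.injective_of_subsingleton _, Function.surjective_to_subsingleton _⟩⟩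
  have : Module.Projective (AAlg k) K := by
    refine Module.Projective.of_exact (x := X k 0) (y := X k 1) (X_mul_X k 0)
      (X_mul_eq_zero_of_eq 0) (kernel.ι π).hom ((ModuleCat.mono_iff_injective _).1 inferInstance)
      (fun m hm => hK.2 m (one_smul _ m) hm) (fun m hm => hK.1 m (one_smul _ m) hm)
      (exists_X_mul_eq 0)
  have : Projective K := (IsProjective.iff_projective _).1 this
  exact ⟨1, (hE.hasProjectiveDimensionLT_X₃_iff 0 inferInstance).2 inferInstance⟩

theorem exists_isTriangleEquivalence : ∃ hA : CosyzygyDescends k (AAlg k),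
    IsTriangleEquivalence (modSqTriv k) (hoTriangles hA) (functorA k) := by
  obtain ⟨G₁⟩ := nonempty_generator (k := k) 0 (pair k) rfl rfl rfl rfl
  obtain ⟨G₂⟩ := nonempty_generator (k := k) 1 (pair k).swap rfl rfl rfl rfl
  exact PeriodicPair.isTriangleEquivalence_tensorSum G₁ G₂ (isTrivialModule_of_isExact k)

end AAlg

end

theorem mainTheorem12 (p : ℕ) [Fact p.Prime]
    (k : Type u) [Field k] [Algebra (ZMod p) k] [IsAlgClosure (ZMod p) k] :
    -- `R` is the component `e_γ H_{x_0}`, for `SL₂`, `GL₂`, `PGL₂` and all regular `γ`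
    (∀ (F : Type v) [Field F] [Fintype F] [DecidableEq F] [CharP F p],
      RegularComponentsAreR k (weylInv F) (corootSL F) ∧
      RegularComponentsAreR k (weylGL F) (corootGL F) ∧
      RegularComponentsAreR k (weylInv F) (corootPGL F)) ∧
    -- `R` is a 4-dimensional self-injective algebra
    Module.finrank k (RAlg k) = 4 ∧
    Module.Injective (RAlg k) (RAlg k) ∧
    Module.Injective (RAlg k)ᵐᵒᵖ (RAlg k) ∧
    -- `(V₁, V₂) ↦ χ₁ ⊗ V₁ ⊕ χ₂ ⊗ V₂` is a triangle equivalence `Mod(k²)_{2,triv} ≃ Ho(R)`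
    (∃ hR : CosyzygyDescends k (RAlg k),
      IsTriangleEquivalence (modSqTriv k) (hoTriangles hR) (functorR k)) ∧
    -- `(V₁, V₂) ↦ A/X₂A ⊗ V₁ ⊕ A/X₁A ⊗ V₂` is a triangle equivalence `Mod(k²)_{2,triv} ≃ Ho(A)`
    (∃ hA : CosyzygyDescends k (AAlg k),
      IsTriangleEquivalence (modSqTriv k) (hoTriangles hA) (functorA k)) := by
  have : CharP k p := charP_of_injective_algebraMap (algebraMap (ZMod p) k).injective p
  exact ⟨fun F _ _ _ _ => ⟨regularComponentsAreR_SL p k F, regularComponentsAreR_GL p k F,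
      regularComponentsAreR_PGL p k F⟩,
    RAlg.finrank_eq k, RAlg.injective k, RAlg.op_injective k,
    RAlg.exists_isTriangleEquivalence k, AAlg.exists_isTriangleEquivalence k⟩
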